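/- **Theorem (strong selection consistency for complexity priors).** *Setting.* For each $n$ let $X_n$ be an $n\times p_n$ design matrix, and let $\bm y_n = X_n\bm\beta_0+\bm\epsilon_n$, where the entries of $\bm\epsilon_n$ are i.i.d. $N(0,\sigma_0^2)$ with $\sigma_0^2>0$. The nonzero entries of $\bm\beta_0\in\mathbb R^{p_n}$ are exactly those with index in a finite set $\bm t$, where $\bm t\subseteq\{1,\dots,p_n\}$ for all large $n$; the set $\bm t$, the values $\bm\beta_{0,\bm t}$ and $\sigma_0^2$ do not depend on $n$. A model is a subset $\bm k\subseteq\{1,\dots,p_n\}$ of size $k=|\bm k|$; $X_{\bm k}$ consists of the columns of $X_n$ indexed by $\bm k$, and $A_{\bm k}$ is the principal submatrix, indexed by $\bm k$, of a symmetric $p_n\times p_n$ matrix $A_{p_n}$. *Bayesian model.* Fix an integer $r\ge1$ and constants $\alpha_1,\alpha_2,c_1,c_2>0$. Consider the hierarchical model $$\bm Y_n\mid\bm\beta_{\bm k},\sigma^2,\bm k\sim N(X_{\bm k}\bm\beta_{\bm k},\sigma^2I_n),$$ $$\pi(\bm\beta_{\bm k}\mid\tau,\sigma^2,\bm k)=d_{\bm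 k}(2\pi)^{-k/2}(\tau\sigma^2)^{-rk-k/2}|A_{\bm k}|^{1/2}\exp\Big\{-\frac{\bm\beta_{\bm k}'A_{\bm k}\bm\beta_{\bm k}}{2\tau\sigma^2}\Big\}\prod_{i\in\bm k}\beta_i^{2r},$$ $$\pi(\tau)=\frac{(n/2)^{1/2}}{\Gamma(1/2)}\tau^{-3/2}e^{-n/(2\tau)},\qquad \pi(\sigma^2)=\frac{\alpha_2^{\alpha_1}}{\Gamma(\alpha_1)}(\sigma^2)^{-(\alpha_1+1)}e^{-\alpha_2/\sigma^2},$$ where $d_{\bm k}$ is the normalizing constant, with the truncated complexity prior $$\pi(\bm k)\propto c_1^{-k}p_n^{-c_2k}\ \text{ if } k\le q_n,\qquad \pi(\bm k)=0\ \text{ if } k>q_n .$$ Let $m_{\bm k}(\bm y)$ be the marginal density of the response under $\bm k$, obtained by integrating out $\bm\beta_{\bm k},\sigma^2,\tau$, and let $\pi(\bm k\mid\bm y_n)=\pi(\bm k)m_{\bm k}(\bm y_n)/\sum_{\bm l}\pi(\bm l)m_{\bm l}(\bm y_n)$ be the posterior probability of $\bm k$. *Assumptions.* 1. There are $\epsilon_n\in(0,1)$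 with $\epsilon_n^{-1}=O((\log n)^{1/8})$ such that, for every $n\ge1$ and every model $\bm k$ with $|\bm k|\le q_n+|\bm t|$, the matrix $X_{\bm k}^TX_{\bm k}/n$ has $\min(n,k)$ nonzero eigenvalues (counted with multiplicity), all of them in $[\epsilon_n,\epsilon_n^{-1}]$. 2. $q_n=O(n^\xi)$ for some $\xi<1$, and $|\bm t|\le q_n$ for all large $n$. 3. There are constants $a_1, a_2$ with $0<a_1<a_2<\infty$ such that, for every $n\ge1$, all eigenvalues of $A_{p_n}$ lie in $(a_1,a_2)$. 4. $\log p_n=O(n^\kappa)$ for some $0<\kappa<1$ (so $p_n$ may grow sub-exponentially in $n$). 5. $c_2>1$. *Conclusion.* $\pi(\bm t\mid\bm y_n)\to1$ in probability as $n\to\infty$. -/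

import Mathlib

/-- A model is a set `k` of covariates; `modelCols X k` is the design matrix `X_k` formed from the
columns of `X` that belong to `k`. -/
def modelCols {n p : ℕ} (X : Matrix (Fin n) (Fin p) ℝ) (k : Finset (Fin p)) :
    Matrix (Fin n) k ℝ :=
  X.submatrix id Subtype.val

/-- The principal submatrix `A_k` of `A` with rows and columns in `k`. -/
def modelSub {p : ℕ} (A : Matrix (Fin p) (Fin p) ℝ) (k : Finset (Fin p)) : Matrix k k ℝ :=
  A.submatrix Subtype.val Subtype.val

/-- `X_kᵀ X_k / n`. -/
noncomputable def scaledGram {n p : ℕ} (X : Matrix (Fin n) (Fin p) ℝ) (k : Finset (Fin p)) :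
    Matrix k k ℝ :=
  (n : ℝ)⁻¹ • ((modelCols X k).transpose * modelCols X k)

theorem scaledGram_isHermitian {n p : ℕ} (X : Matrix (Fin n) (Fin p) ℝ) (k : Finset (Fin p)) :
    (scaledGram X k).IsHermitian := by
  simp [scaledGram, Matrix.IsHermitian, Matrix.conjTranspose_eq_transpose_of_trivial]

/-- `ε ≤ λ_k^m ≤ λ_k^M ≤ ε⁻¹`, where `λ_k^m` and `λ_k^M` are the minimum and the maximum over
`1 ≤ j ≤ min (n, |k|)` of `ν_j`, the `j`-th largest nonzero eigenvalue of `X_kᵀ X_k / n`.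
`eigenvalues₀` lists the eigenvalues, with multiplicity, in decreasing order (indexed from `0`).
The matrix is positive semidefinite of rank at most `min (n, |k|)`, so its nonzero eigenvalues are
among the first `min (n, |k|)` of the list; for `0 < ε` the condition says that there are exactly
that many of them and that all of them lie in `[ε, ε⁻¹]`. -/
def EigenBounds {n p : ℕ} (X : Matrix (Fin n) (Fin p) ℝ) (k : Finset (Fin p)) (ε : ℝ) : Prop :=
  ∀ j : Fin (Fintype.card k), (j : ℕ) < min n k.card →
    ε ≤ (scaledGram_isHermitian X k).eigenvalues₀ j ∧
      (scaledGram_isHermitian X k).eigenvalues₀ j ≤ ε⁻¹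

/-- Density at `y` of the normal distribution `N(X_k β, s I_n)`; `s` is the variance `σ²`. -/
noncomputable def likelihood {n p : ℕ} (X : Matrix (Fin n) (Fin p) ℝ) (k : Finset (Fin p))
    (β : k → ℝ) (s : ℝ) (y : Fin n → ℝ) : ℝ :=
  (2 * Real.pi * s) ^ (-(n : ℝ) / 2) *
    Real.exp (-(∑ i, (y i - (modelCols X k).mulVec β i) ^ 2) / (2 * s))

/-- The pMOM density of order `r`, with scale `τ` and variance `s = σ²`, without the normalizing
constant `d_k`. -/
noncomputable def pMOMUnnormalized {p : ℕ} (r : ℕ) (A : Matrix (Fin p) (Fin p) ℝ)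
    (k : Finset (Fin p)) (τ s : ℝ) (β : k → ℝ) : ℝ :=
  (2 * Real.pi) ^ (-(k.card : ℝ) / 2) *
    (τ * s) ^ (-((r : ℝ) * (k.card : ℝ)) - (k.card : ℝ) / 2) *
    Real.sqrt (modelSub A k).det *
    Real.exp (-(β ⬝ᵥ (modelSub A k).mulVec β) / (2 * τ * s)) *
    ∏ i, β i ^ (2 * r)

/-- The normalizing constant `d_k` of the pMOM density. It does not depend on `τ` and `σ²` (the
substitution `β ↦ √(τ σ²) β` removes them), so it is computed at `τ = σ² = 1`. -/
noncomputable def pMOMConst {p : ℕ} (r : ℕ) (A : Matrix (Fin p) (Fin p) ℝ)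
    (k : Finset (Fin p)) : ℝ :=
  (∫ β : k → ℝ, pMOMUnnormalized r A k 1 1 β)⁻¹

/-- The pMOM prior density of `β_k` given `τ`, `s = σ²` and the model `k`. -/
noncomputable def pMOMDensity {p : ℕ} (r : ℕ) (A : Matrix (Fin p) (Fin p) ℝ)
    (k : Finset (Fin p)) (τ s : ℝ) (β : k → ℝ) : ℝ :=
  pMOMConst r A k * pMOMUnnormalized r A k τ s β

/-- The Inverse-Gamma density with shape `a` and scale `b`, at `x > 0`. -/
noncomputable def invGammaDensity (a b x : ℝ) : ℝ :=
  b ^ a / Real.Gamma a * x ^ (-(a + 1)) * Real.exp (-b / x)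

/-- The marginal density `m_k(y)` of the response vector under the model `k`: the likelihood is
integrated against the pMOM prior on `β_k`, the Inverse-Gamma`(α₁, α₂)` prior on `s = σ²` and the
Inverse-Gamma`(1/2, n/2)` prior on `τ`. -/
noncomputable def marginalDensity {n p : ℕ} (r : ℕ) (α₁ α₂ : ℝ)
    (X : Matrix (Fin n) (Fin p) ℝ) (A : Matrix (Fin p) (Fin p) ℝ) (k : Finset (Fin p))
    (y : Fin n → ℝ) : ENNReal :=
  ∫⁻ τ in Set.Ioi (0 : ℝ), ∫⁻ s in Set.Ioi (0 : ℝ), ∫⁻ β : k → ℝ,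
    ENNReal.ofReal (likelihood X k β s y * pMOMDensity r A k τ s β *
      invGammaDensity (1 / 2) ((n : ℝ) / 2) τ * invGammaDensity α₁ α₂ s)

/-- The unnormalized complexity prior `c₁^(-|k|) p^(-c₂ |k|)` of the model `k`, set to zero on the
models with more than `q` covariates. -/
noncomputable def complexityWeight {p : ℕ} (c₁ c₂ : ℝ) (q : ℕ) (k : Finset (Fin p)) : ℝ :=
  if k.card ≤ q then c₁ ^ (-(k.card : ℝ)) * (p : ℝ) ^ (-(c₂ * (k.card : ℝ))) else 0

/-- The complexity prior `π(k)` on the models, a probability distribution. -/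
noncomputable def complexityPrior {p : ℕ} (c₁ c₂ : ℝ) (q : ℕ) (k : Finset (Fin p)) : ℝ :=
  complexityWeight c₁ c₂ q k / ∑ l : Finset (Fin p), complexityWeight c₁ c₂ q l

/-- The posterior probability `π(k | y) = π(k) m_k(y) / ∑_l π(l) m_l(y)` of the model `k`. -/
noncomputable def posterior {n p : ℕ} (r : ℕ) (α₁ α₂ c₁ c₂ : ℝ) (q : ℕ)
    (X : Matrix (Fin n) (Fin p) ℝ) (A : Matrix (Fin p) (Fin p) ℝ) (k : Finset (Fin p))
    (y : Fin n → ℝ) : ℝ :=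
  (ENNReal.ofReal (complexityPrior c₁ c₂ q k) * marginalDensity r α₁ α₂ X A k y /
    ∑ l : Finset (Fin p),
      ENNReal.ofReal (complexityPrior c₁ c₂ q l) * marginalDensity r α₁ α₂ X A l y).toReal

/-- The set `t` of covariate indices as a model with `p` covariates. -/
def modelOf (t : Finset ℕ) (p : ℕ) : Finset (Fin p) :=
  Finset.univ.filter fun j => (j : ℕ) ∈ t

/-- The response vector `y = X β₀ + e`; the coefficients are the first `p` entries of `β₀`. -/
def response {n p : ℕ} (X : Matrix (Fin n) (Fin p) ℝ) (β₀ : ℕ → ℝ) (e : Fin n → ℝ) :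
    Fin n → ℝ :=
  fun i => X.mulVec (fun j : Fin p => β₀ j) i + e i

/-! Let `f` be the true density of the response and `m k` the marginal density of the model `k`. One
minus the posterior probability of `t` is at most the sum over `k ≠ t` of `π(k) m k / (π(t) m t)`.
The proof replaces `m t` by a deterministic lower bound `L f`, valid for every response, and then
applies Markov's inequality to the `θ`-th power of the sum for a fixed `θ` with `1/c₂ < θ < 1`.
Since `x ↦ x ^ θ` is subadditive, the fractional moments `∫ f (m k / f) ^ θ` can be bounded one
model at a time (`measure_posterior_le`). The choice of `θ` does two jobs. From `θ < 1` comes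
Hölder's inequality `∫ f (m/f)^θ w^θ v^(1-θ) ≤ (∫ m w)^θ (∫ f v)^(1-θ)`, which separates an integral
under the model from one under the truth. From `c₂ θ ≥ 1` it follows that the prior penalty, after
the power `θ`, still offsets the number of models: `p · p^(-c₂ θ) ≤ 1`.

Lower bound (`exists_le_marginalDensity`): it suffices to integrate over `τ` of order `n`, `s`
within a relative distance `1/n` above the true variance, and coefficients in a box of side `√(ε/n)`
at the true ones. The box is placed on the side, chosen from the residual, where moving the
coefficients does not make the cross term unfavourable. No probabilistic statement about the noise
is needed.

Models containing `t` (`exists_lintegral_ratio_rpow_le_of_mem`): the Hölder weights are opposite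
Gaussian tilts of the response inside the column space, calibrated so that they cancel. Under the
model the tilt forces the coefficients towards the true ones at scale `(n ε)^(-1/2)`. There the
factor `β^(2r)` of the nonlocal prior gives each superfluous covariate `(n ε)^(-(r+1/2))`, and
integrating out `τ` gives each covariate a further `n^(-(r+1/2))`, up to powers of `|k|`. Relative
to `L`, each superfluous covariate costs a factor of order `(q/n)^2` times a power of `1/ε`
(`superset_bound_le`), which tends to zero.

Models missing part of `t` (`lintegral_ratio_rpow_le_of_dist`): the true mean is at squared distance
of order `n ε` from the column space. A scale-free test compares the energy of the response along
the unexplained direction with that in the remaining orthogonal directions. Both its errors are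
exponentially small in `n ε`, uniformly in the model's coefficients and variance, hence also under
the prior mixture. This beats the price `exp (O (n^κ))` of the prior odds and of `1/L`, because `ε`
decays slower than any power of `n`.

Summation over all models is by the binomial theorem (`sum_prior_mul_le`), and
`exists_measure_posterior_le` collects everything in a finite-sample inequality. -/

namespace PMOM

open MeasureTheory ProbabilityTheory Real

/-! ### Gaussian moments and inverse-gamma integrals in one variable. -/

/-- **Tonelli's theorem** for a product of functions of one variable each. -/
theorem lintegral_pi_prod {ι : Type*} [Fintype ι] (f : ι → ℝ → ENNReal)
    (hf : ∀ i, Measurable (f i)) :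
    ∫⁻ x : ι → ℝ, ∏ i, f i (x i) = ∏ i, ∫⁻ x, f i x := by
  have key : ∀ (n : ℕ) (g : Fin n → ℝ → ENNReal), (∀ i, Measurable (g i)) →
      ∫⁻ x : Fin n → ℝ, ∏ i, g i (x i) = ∏ i, ∫⁻ x, g i x := by
    intro n
    induction n with
    | zero => intro g _; simp [lintegral_unique, volume_pi]
    | succ n ih =>
      intro g hg
      have hm := (volume_preserving_piFinSuccAbove (fun _ : Fin (n + 1) => ℝ) 0).symm
      calc _ = ∫⁻ x : ℝ × (Fin n → ℝ), g 0 x.1 * ∏ i : Fin n, g i.succ (x.2 i) := by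
            refine (hm.lintegral_comp_emb (MeasurableEquiv.measurableEmbedding _) _).symm.trans
              (lintegral_congr fun x => ?_)
            simp [Fin.prod_univ_succ, Fin.insertNthEquiv]
        _ = _ := by
            rw [Fin.prod_univ_succ, ← ih (fun i => g i.succ) fun i => hg i.succ]
            exact lintegral_prod_mul (hg 0).aemeasurable (Finset.measurable_fun_prod _
              fun (i : Fin n) _ => (hg i.succ).comp (measurable_pi_apply i)).aemeasurable
  let e := (Fintype.equivFin ι).symm
  rw [← (volume_measurePreserving_piCongrLeft (fun _ : ι => ℝ) e).lintegral_comp_emb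
    (MeasurableEquiv.measurableEmbedding _)]
  simp_rw [← e.prod_comp, MeasurableEquiv.coe_piCongrLeft, Equiv.piCongrLeft_apply_apply]
  exact key _ _ fun i => hf _

theorem lintegral_exp_neg_sq {A : ℝ} (hA : 0 < A) (p : ℝ) :
    ∫⁻ x, ENNReal.ofReal (exp (-(x - p) ^ 2 / (2 * A))) = ENNReal.ofReal √(2 * π * A) := by
  have h0 : ∀ x : ℝ, -(x - p) ^ 2 / (2 * A) = -(1 / (2 * A)) * (x - p) ^ 2 := by
    intro x; field_simp
  have hi : Integrable fun x : ℝ => exp (-(1 / (2 * A)) * (x - p) ^ 2) :=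
    (integrable_exp_neg_mul_sq (b := 1 / (2 * A)) (by positivity)).comp_sub_right p
  simp_rw [h0]
  rw [← ofReal_integral_eq_lintegral_ofReal hi (.of_forall fun _ => (exp_pos _).le),
    integral_sub_right_eq_self (fun x : ℝ => exp (-(1 / (2 * A)) * x ^ 2)) p, integral_gaussian]
  congr 2
  field_simp

/-- Completing the square turns the product into one Gaussian in `x` times a Gaussian in `p - q`
whose variance is the sum of the two. -/
theorem lintegral_exp_neg_sq_mul {A B : ℝ} (hA : 0 < A) (hB : 0 < B) (p q : ℝ) :
    ∫⁻ x, ENNReal.ofReal (exp (-(x - p) ^ 2 / (2 * A)) * exp (-(x - q) ^ 2 / (2 * B))) =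
      ENNReal.ofReal (√(2 * π * (A * B / (A + B))) * exp (-(p - q) ^ 2 / (2 * (A + B)))) := by
  have h0 : ∀ x : ℝ, exp (-(x - p) ^ 2 / (2 * A)) * exp (-(x - q) ^ 2 / (2 * B)) =
      exp (-(x - (B * p + A * q) / (A + B)) ^ 2 / (2 * (A * B / (A + B)))) *
        exp (-(p - q) ^ 2 / (2 * (A + B))) := by
    intro x
    rw [← exp_add, ← exp_add]
    congr 1
    field_simp
    ring
  simp_rw [h0, ENNReal.ofReal_mul (exp_pos _).le, ENNReal.ofReal_mul (sqrt_nonneg _)]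
  rw [lintegral_mul_const _ (by fun_prop), lintegral_exp_neg_sq (by positivity)]

/-- `∫ x ^ (2 r) exp (- x² / 2) dx`. -/
noncomputable def gaussMoment (r : ℕ) : ℝ := ∫ x : ℝ, x ^ (2 * r) * exp (-x ^ 2 / (2 * 1))

theorem integrable_pow_mul_exp (r : ℕ) {A : ℝ} (hA : 0 < A) :
    Integrable fun x : ℝ => x ^ (2 * r) * exp (-x ^ 2 / (2 * A)) := by
  have := integrable_rpow_mul_exp_neg_mul_sq (b := 1 / (2 * A)) (by positivity)
    (s := ((2 * r : ℕ) : ℝ)) (by have : (0 : ℝ) ≤ ((2 * r : ℕ) : ℝ) := by positivity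
                                 linarith)
  simp_rw [rpow_natCast] at this
  convert this using 4
  field_simp

theorem even_pow_nonneg (x : ℝ) (r : ℕ) : 0 ≤ x ^ (2 * r) := by
  rw [pow_mul]; positivity

theorem gaussMoment_pos (r : ℕ) : 0 < gaussMoment r := by
  rw [gaussMoment, integral_pos_iff_support_of_nonneg
    (fun x => mul_nonneg (even_pow_nonneg x r) (exp_pos _).le)
    (integrable_pow_mul_exp r one_pos)]
  have : Set.Ioo (0 : ℝ) 1 ⊆
      Function.support fun x : ℝ => x ^ (2 * r) * exp (-x ^ 2 / (2 * 1)) := by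
    intro x hx
    have := hx.1
    simp only [Function.mem_support]
    positivity
  exact lt_of_lt_of_le (by simp) (measure_mono this)

theorem integral_pow_mul_exp (r : ℕ) {A : ℝ} (hA : 0 < A) :
    ∫ x : ℝ, x ^ (2 * r) * exp (-x ^ 2 / (2 * A)) =
      gaussMoment r * A ^ ((r : ℝ) + 1 / 2) := by
  have h := Measure.integral_comp_mul_left
    (fun x : ℝ => x ^ (2 * r) * exp (-x ^ 2 / (2 * A))) √A
  have hs : 0 < √A := sqrt_pos.2 hA
  have h1 : ∀ x : ℝ, (√A * x) ^ (2 * r) * exp (-(√A * x) ^ 2 / (2 * A)) =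
      A ^ r * (x ^ (2 * r) * exp (-x ^ 2 / (2 * 1))) := by
    intro x
    have : (√A * x) ^ 2 = A * x ^ 2 := by rw [mul_pow, sq_sqrt hA.le]
    rw [pow_mul, this, mul_pow, ← pow_mul, mul_assoc]
    congr 3
    field_simp
  simp_rw [h1, integral_const_mul, abs_of_pos (inv_pos.2 hs), smul_eq_mul] at h
  rw [rpow_add hA, rpow_natCast, ← sqrt_eq_rpow]
  unfold gaussMoment
  field_simp at h ⊢
  linarith

theorem lintegral_pow_mul_exp (r : ℕ) {A : ℝ} (hA : 0 < A) :
    ∫⁻ x, ENNReal.ofReal (x ^ (2 * r) * exp (-x ^ 2 / (2 * A))) =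
      ENNReal.ofReal (gaussMoment r * A ^ ((r : ℝ) + 1 / 2)) := by
  rw [← integral_pow_mul_exp r hA, ofReal_integral_eq_lintegral_ofReal
    (integrable_pow_mul_exp r hA)
    (.of_forall fun x => mul_nonneg (even_pow_nonneg x r) (exp_pos _).le)]

/-- From `|x| ≤ 2 max (|b|, |x - b|)`. It splits the moment factor of a true covariate into the
value at the true coefficient and the fluctuation around it. -/
theorem pow_le_add_sub (r : ℕ) (x b : ℝ) :
    x ^ (2 * r) ≤ 4 ^ r * (b ^ (2 * r) + (x - b) ^ (2 * r)) := by
  have h1 : x ^ 2 ≤ 4 * max (b ^ 2) ((x - b) ^ 2) := by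
    have := le_max_left (b ^ 2) ((x - b) ^ 2)
    have := le_max_right (b ^ 2) ((x - b) ^ 2)
    nlinarith [sq_nonneg (b - (x - b))]
  calc x ^ (2 * r) = (x ^ 2) ^ r := pow_mul _ _ _
    _ ≤ (4 * max (b ^ 2) ((x - b) ^ 2)) ^ r := by gcongr
    _ = 4 ^ r * (max (b ^ 2) ((x - b) ^ 2)) ^ r := mul_pow _ _ _
    _ ≤ _ := by
      gcongr
      rw [pow_mul b, pow_mul (x - b)]
      rcases max_choice (b ^ 2) ((x - b) ^ 2) with h | h <;> rw [h]
      · have : 0 ≤ ((x - b) ^ 2) ^ r := by positivity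
        linarith
      · have : 0 ≤ (b ^ 2) ^ r := by positivity
        linarith

theorem lintegral_pow_mul_exp_sub_le (r : ℕ) {A : ℝ} (hA : 0 < A) (b : ℝ) :
    ∫⁻ x, ENNReal.ofReal (x ^ (2 * r) * exp (-(x - b) ^ 2 / (2 * A))) ≤
      ENNReal.ofReal (4 ^ r * (b ^ (2 * r) * √(2 * π * A) +
        gaussMoment r * A ^ ((r : ℝ) + 1 / 2))) := by
  calc _ ≤ ∫⁻ x, (ENNReal.ofReal (4 ^ r * b ^ (2 * r)) *
          ENNReal.ofReal (exp (-(x - b) ^ 2 / (2 * A))) +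
        ENNReal.ofReal (4 ^ r) * ENNReal.ofReal ((x - b) ^ (2 * r) *
          exp (-(x - b) ^ 2 / (2 * A)))) := by
        refine lintegral_mono fun x => ?_
        have h1 := even_pow_nonneg b r
        have h2 := even_pow_nonneg (x - b) r
        rw [← ENNReal.ofReal_mul (by positivity), ← ENNReal.ofReal_mul (by positivity),
          ← ENNReal.ofReal_add (by positivity) (by positivity)]
        apply ENNReal.ofReal_le_ofReal
        have := mul_le_mul_of_nonneg_right (pow_le_add_sub r x b)
          (exp_pos (-(x - b) ^ 2 / (2 * A))).le
        linarith
    _ = _ := by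
        have h1 := even_pow_nonneg b r
        have := gaussMoment_pos r
        rw [lintegral_add_left (by fun_prop), lintegral_const_mul _ (by fun_prop),
          lintegral_const_mul _ (by fun_prop), lintegral_exp_neg_sq hA,
          lintegral_sub_right_eq_self
            (fun x : ℝ => ENNReal.ofReal (x ^ (2 * r) * exp (-x ^ 2 / (2 * A)))) b,
          lintegral_pow_mul_exp r hA, ← ENNReal.ofReal_mul (by positivity),
          ← ENNReal.ofReal_mul (by positivity), ← ENNReal.ofReal_add (by positivity)
            (by positivity)]
        congr 1
        ring

/-- The substitution `x ↦ 1/x` reduces it to the Gamma integral. -/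
theorem lintegral_rpow_mul_exp_neg_div {a b : ℝ} (ha : 0 < a) (hb : 0 < b) :
    ∫⁻ x in Set.Ioi (0 : ℝ), ENNReal.ofReal (x ^ (-(a + 1)) * exp (-b / x)) =
      ENNReal.ofReal (Gamma a * b ^ (-a)) := by
  have e : ∀ x ∈ Set.Ioi (0 : ℝ), (|(-1 : ℝ)| * x ^ ((-1 : ℝ) - 1)) •
      ((x ^ (-1 : ℝ)) ^ (a - 1) * exp (-(b * x ^ (-1 : ℝ)))) =
        x ^ (-(a + 1)) * exp (-b / x) := by
    intro x hx
    have hx : 0 < x := hx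
    rw [← rpow_mul hx.le, smul_eq_mul, ← mul_assoc, abs_neg, abs_one, one_mul, ← rpow_add hx,
      rpow_neg_one]
    congr 2
    · ring
    · field_simp
  have hg : IntegrableOn (fun y : ℝ => y ^ (a - 1) * exp (-(b * y))) (Set.Ioi 0) := by
    have := integrableOn_rpow_mul_exp_neg_mul_rpow (s := a - 1) (p := 1) (b := b)
      (by linarith) one_pos hb
    simpa [neg_mul] using this
  have hi := (integrableOn_Ioi_comp_rpow_iff (fun y : ℝ => y ^ (a - 1) * exp (-(b * y)))
    (p := -1) (by norm_num)).2 hg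
  have hv := integral_comp_rpow_Ioi (fun y : ℝ => y ^ (a - 1) * exp (-(b * y)))
    (p := -1) (by norm_num)
  rw [setIntegral_congr_fun measurableSet_Ioi e, integral_rpow_mul_exp_neg_mul_Ioi ha hb] at hv
  rw [integrableOn_congr_fun e measurableSet_Ioi] at hi
  rw [← ofReal_integral_eq_lintegral_ofReal hi, hv]
  · rw [one_div, inv_rpow hb.le, ← rpow_neg hb.le, mul_comm]
  · filter_upwards [self_mem_ae_restrict measurableSet_Ioi] with x hx
    have hx : 0 < x := hx
    simp only [Pi.zero_apply]
    positivity

/-- The `m`-th power of `x/m ≤ exp (x/m)`. It serves to trade large powers of `1/τ` and `1 + 1/s`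
for half of the exponential decay of the inverse-gamma densities, at the price `m ^ m`. -/
theorem rpow_le_rpow_self_mul_exp {x m : ℝ} (hx : 0 ≤ x) (hm : 0 ≤ m) :
    x ^ m ≤ m ^ m * exp x := by
  rcases hm.eq_or_lt with rfl | hm
  · simpa using hx
  · have h1 : x / m ≤ exp (x / m) := by linarith [add_one_le_exp (x / m)]
    have h2 := rpow_le_rpow (by positivity) h1 hm.le
    rw [div_rpow hx hm.le, ← exp_mul, div_mul_cancel₀ _ hm.ne', div_le_iff₀ (by positivity)] at h2
    linarith
-- Orthonormal coordinates adapted to a subspace.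
/-- The coordinate of a vector along the `i`-th element of an orthonormal basis. -/
noncomputable def coord {n : ℕ} {ι : Type*} [Fintype ι]
    (b : OrthonormalBasis ι ℝ (EuclideanSpace ℝ (Fin n))) (y : Fin n → ℝ) (i : ι) : ℝ :=
  inner ℝ (b i) (WithLp.toLp 2 y)

theorem coord_sub {n : ℕ} {ι : Type*} [Fintype ι]
    (b : OrthonormalBasis ι ℝ (EuclideanSpace ℝ (Fin n))) (y z : Fin n → ℝ) (i : ι) :
    coord b (y - z) i = coord b y i - coord b z i := by
  simp [coord, WithLp.toLp_sub, inner_sub_right]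

theorem sum_coord_sq {n : ℕ} {ι : Type*} [Fintype ι]
    (b : OrthonormalBasis ι ℝ (EuclideanSpace ℝ (Fin n))) (y : Fin n → ℝ) :
    ∑ i, coord b y i ^ 2 = ∑ i, y i ^ 2 := by
  have := b.sum_sq_norm_inner_right (WithLp.toLp 2 y)
  rw [EuclideanSpace.norm_sq_eq] at this
  simpa [coord] using this

theorem measurable_coord {n : ℕ} {ι : Type*} [Fintype ι]
    (b : OrthonormalBasis ι ℝ (EuclideanSpace ℝ (Fin n))) (i : ι) :
    Measurable fun y : Fin n → ℝ => coord b y i := by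
  have : Continuous fun y : Fin n → ℝ => coord b y i := by
    unfold coord
    fun_prop
  exact this.measurable

/-- Integration in the coordinates of an orthonormal basis. -/
theorem lintegral_prod_coord {n : ℕ} {ι : Type*} [Fintype ι]
    (b : OrthonormalBasis ι ℝ (EuclideanSpace ℝ (Fin n))) (F : ι → ℝ → ENNReal)
    (hF : ∀ i, Measurable (F i)) :
    ∫⁻ y : Fin n → ℝ, ∏ i, F i (coord b y i) = ∏ i, ∫⁻ x, F i x := by
  rw [← lintegral_pi_prod F hF]
  have h1 := (PiLp.volume_preserving_toLp (Fin n)).lintegral_comp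
    (f := fun v => ∏ i, F i (inner ℝ (b i) v)) (Finset.measurable_fun_prod _ fun i _ =>
      (hF i).comp (by fun_prop))
  have h2 := b.measurePreserving_repr.lintegral_comp
    (f := fun v => ∏ i, F i (v i)) (Finset.measurable_fun_prod _ fun i _ =>
      (hF i).comp (by fun_prop))
  have h3 := (PiLp.volume_preserving_ofLp ι).lintegral_comp
    (f := fun v => ∏ i, F i (v i)) (Finset.measurable_fun_prod _ fun i _ =>
      (hF i).comp (measurable_pi_apply i))
  rw [← h3, ← h2]
  simp_rw [b.repr_apply_apply]
  exact h1

/-- An orthonormal family that contains a basis of `U` extends to an orthonormal basis each of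
whose elements belongs to `U` or is orthogonal to it. -/
theorem exists_adapted_basis_of_orthonormal {n : ℕ} {κ : Type*}
    (U : Submodule ℝ (EuclideanSpace ℝ (Fin n))) (v : κ → EuclideanSpace ℝ (Fin n))
    (hv : Orthonormal ℝ v) (f : Fin (Module.finrank ℝ U) → κ)
    (hf : ∀ j, v (f j) = stdOrthonormalBasis ℝ U j) :
    ∃ (ι : Finset (EuclideanSpace ℝ (Fin n))) (b : OrthonormalBasis ι ℝ (EuclideanSpace ℝ (Fin n))),
      (∀ o, ∃ i, b i = v o) ∧ ∀ i, b i ∈ U ∨ b i ∈ Uᗮ := by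
  obtain ⟨ι, b, hι, hb⟩ := hv.toSubtypeRange.exists_orthonormalBasis_extension
  have hmem : ∀ o, v o ∈ ι := fun o => hι ⟨o, rfl⟩
  refine ⟨ι, b, fun o => ⟨⟨v o, hmem o⟩, by rw [hb]⟩, fun i => ?_⟩
  -- Either the element is one of the basis vectors of `U` in the family, or it is orthogonal to all
  -- of them and hence to `U`.
  by_cases h : ∃ j, v (f j) = b i
  · obtain ⟨j, hj⟩ := h
    rw [← hj, hf]
    exact .inl (stdOrthonormalBasis ℝ U j).2
  · right
    rw [Submodule.mem_orthogonal]
    intro x hx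
    have h1 : ∀ j, inner ℝ (stdOrthonormalBasis ℝ U j : EuclideanSpace ℝ (Fin n)) (b i) = 0 := by
      intro j
      have h2 : b ⟨_, hmem (f j)⟩ = v (f j) := by rw [hb]
      rw [← hf, ← h2]
      apply b.orthonormal.2
      rintro rfl
      exact h ⟨j, h2.symm⟩
    have h3 := (stdOrthonormalBasis ℝ U).sum_repr ⟨x, hx⟩
    have h4 : x = ∑ j, (stdOrthonormalBasis ℝ U).repr ⟨x, hx⟩ j •
        (stdOrthonormalBasis ℝ U j : EuclideanSpace ℝ (Fin n)) := by
      have := congrArg (fun z : U => (z : EuclideanSpace ℝ (Fin n))) h3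
      simpa using this.symm
    rw [h4, sum_inner]
    simp [inner_smul_left, h1]

theorem exists_adapted_basis {n : ℕ} (U : Submodule ℝ (EuclideanSpace ℝ (Fin n))) :
    ∃ (ι : Finset (EuclideanSpace ℝ (Fin n)))
      (b : OrthonormalBasis ι ℝ (EuclideanSpace ℝ (Fin n))), ∀ i, b i ∈ U ∨ b i ∈ Uᗮ := by
  have hv : Orthonormal ℝ fun i => (stdOrthonormalBasis ℝ U i : EuclideanSpace ℝ (Fin n)) :=
    (stdOrthonormalBasis ℝ U).orthonormal.comp_linearIsometry U.subtypeₗᵢ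
  obtain ⟨ι, b, -, h⟩ := exists_adapted_basis_of_orthonormal U _ hv id fun _ => rfl
  exact ⟨ι, b, h⟩

/-- An orthonormal basis adapted to a subspace and to a unit vector orthogonal to it. -/
theorem exists_adapted_basis_insert {n : ℕ} (U : Submodule ℝ (EuclideanSpace ℝ (Fin n)))
    (u : EuclideanSpace ℝ (Fin n)) (hu : u ∈ Uᗮ) (hu1 : ‖u‖ = 1) :
    ∃ (ι : Finset (EuclideanSpace ℝ (Fin n))) (b : OrthonormalBasis ι ℝ (EuclideanSpace ℝ (Fin n)))
      (i₀ : ι), b i₀ = u ∧ ∀ i, b i ∈ U ∨ b i ∈ Uᗮ := by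
  let c := stdOrthonormalBasis ℝ U
  let v : Option (Fin (Module.finrank ℝ U)) → EuclideanSpace ℝ (Fin n) :=
    fun o => o.elim u fun i => (c i : EuclideanSpace ℝ (Fin n))
  have hv : Orthonormal ℝ v := by
    constructor
    · rintro (_ | i)
      · exact hu1
      · exact c.orthonormal.1 i
    · rintro (_ | i) (_ | j) hij
      · exact absurd rfl hij
      · exact Submodule.inner_left_of_mem_orthogonal (c j).2 hu
      · exact Submodule.inner_right_of_mem_orthogonal (c i).2 hu
      · have := c.orthonormal.2 (i := i) (j := j) (by rintro rfl; exact hij rfl)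
        simpa [v] using this
  obtain ⟨ι, b, h1, h2⟩ := exists_adapted_basis_of_orthonormal U v hv some fun _ => rfl
  obtain ⟨i₀, h⟩ := h1 none
  exact ⟨ι, b, i₀, h, h2⟩

/-- At most `finrank U` elements of an orthonormal basis belong to `U`. -/
theorem card_mem_le_finrank {n : ℕ} {ι : Type*} [Fintype ι]
    (b : OrthonormalBasis ι ℝ (EuclideanSpace ℝ (Fin n)))
    (U : Submodule ℝ (EuclideanSpace ℝ (Fin n))) (I : Finset ι) (hI : ∀ i ∈ I, b i ∈ U) :
    I.card ≤ Module.finrank ℝ U := by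
  have h1 : LinearIndependent ℝ fun i : I => (⟨b i, hI i i.2⟩ : U) := by
    apply LinearIndependent.of_comp U.subtype
    exact b.orthonormal.linearIndependent.comp _ Subtype.val_injective
  simpa using h1.fintype_card_le_finrank
-- From eigenvalue assumptions to bounds of quadratic forms.
/-- The quadratic form of `B` lies between `a₁ |v|²` and `a₂ |v|²`. -/
def QuadBounds {ι : Type*} [Fintype ι] (B : Matrix ι ι ℝ) (a₁ a₂ : ℝ) : Prop :=
  ∀ v : ι → ℝ, a₁ * ∑ i, v i ^ 2 ≤ v ⬝ᵥ B.mulVec v ∧ v ⬝ᵥ B.mulVec v ≤ a₂ * ∑ i, v i ^ 2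

theorem quadBounds_of_eigenvalues {ι : Type*} [Fintype ι] [DecidableEq ι] {B : Matrix ι ι ℝ}
    (hB : B.IsHermitian) {a₁ a₂ : ℝ} (h : ∀ i, a₁ ≤ hB.eigenvalues i ∧ hB.eigenvalues i ≤ a₂) :
    QuadBounds B a₁ a₂ := by
  intro v
  let b := hB.eigenvectorBasis
  let x : EuclideanSpace ℝ ι := WithLp.toLp 2 v
  have h1 : ∀ i, inner ℝ (b i) (WithLp.toLp 2 (B.mulVec v) : EuclideanSpace ℝ ι) =
      hB.eigenvalues i * inner ℝ (b i) x := by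
    intro i
    have e := hB.mulVec_eigenvectorBasis i
    have hs : B.transpose = B := by
      rw [← Matrix.conjTranspose_eq_transpose_of_trivial]; exact hB
    rw [EuclideanSpace.inner_eq_star_dotProduct, EuclideanSpace.inner_eq_star_dotProduct]
    simp only [star_trivial, x]
    rw [dotProduct_comm, Matrix.dotProduct_mulVec, ← Matrix.mulVec_transpose, hs]
    change (B.mulVec (hB.eigenvectorBasis i)) ⬝ᵥ v = _
    rw [e, smul_dotProduct, smul_eq_mul, dotProduct_comm]
  have h2 : v ⬝ᵥ B.mulVec v = ∑ i, hB.eigenvalues i * inner ℝ (b i) x ^ 2 := by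
    have := b.sum_inner_mul_inner x (WithLp.toLp 2 (B.mulVec v))
    rw [EuclideanSpace.inner_eq_star_dotProduct] at this
    simp only [star_trivial, x] at this
    rw [dotProduct_comm, ← this]
    refine Finset.sum_congr rfl fun i _ => ?_
    rw [h1, real_inner_comm]
    ring
  have h3 : ∑ i, v i ^ 2 = ∑ i, inner ℝ (b i) x ^ 2 := by
    have := b.sum_sq_norm_inner_right x
    rw [EuclideanSpace.norm_sq_eq] at this
    simpa [x] using this.symm
  rw [h2, h3, Finset.mul_sum, Finset.mul_sum]
  exact ⟨Finset.sum_le_sum fun i _ => mul_le_mul_of_nonneg_right (h i).1 (sq_nonneg _),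
    Finset.sum_le_sum fun i _ => mul_le_mul_of_nonneg_right (h i).2 (sq_nonneg _)⟩

/-- Padding by zeros changes neither the quadratic form nor the norm, so no interlacing of
eigenvalues is needed. -/
theorem QuadBounds.modelSub {p : ℕ} {A : Matrix (Fin p) (Fin p) ℝ} {a₁ a₂ : ℝ}
    (h : QuadBounds A a₁ a₂) (k : Finset (Fin p)) : QuadBounds (modelSub A k) a₁ a₂ := by
  intro v
  let w : Fin p → ℝ := fun i => if hi : i ∈ k then v ⟨i, hi⟩ else 0
  have hsum : ∀ f : Fin p → ℝ, (∀ i ∉ k, f i = 0) → ∑ i, f i = ∑ i : k, f i := by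
    intro f hf
    rw [Finset.sum_coe_sort k f]
    exact (Finset.sum_subset (Finset.subset_univ k) fun i _ hi => hf i hi).symm
  have hw : ∀ i : k, w i = v i := fun i => by simp [w]
  have hw0 : ∀ i ∉ k, w i = 0 := fun i hi => by simp [w, hi]
  have e1 : ∑ i, w i ^ 2 = ∑ i, v i ^ 2 := by
    rw [hsum _ fun i hi => by simp [hw0 i hi]]
    simp [hw]
  have e2 : w ⬝ᵥ A.mulVec w = v ⬝ᵥ (_root_.modelSub A k).mulVec v := by
    simp only [dotProduct, Matrix.mulVec, _root_.modelSub, Matrix.submatrix_apply]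
    rw [hsum _ fun i hi => by simp [hw0 i hi]]
    refine Finset.sum_congr rfl fun i _ => ?_
    rw [hw, hsum _ fun i hi => by simp [hw0 i hi]]
    simp [hw]
  rw [← e1, ← e2]
  exact h w

/-- `n ε |v|² ≤ |X_k v|² ≤ n ε⁻¹ |v|²`. -/
def DesignBounds {n p : ℕ} (X : Matrix (Fin n) (Fin p) ℝ) (k : Finset (Fin p)) (ε : ℝ) : Prop :=
  ∀ v : k → ℝ, n * ε * ∑ i, v i ^ 2 ≤ ∑ i, (modelCols X k).mulVec v i ^ 2 ∧
    ∑ i, (modelCols X k).mulVec v i ^ 2 ≤ n * ε⁻¹ * ∑ i, v i ^ 2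

theorem designBounds_of_eigenBounds {n p : ℕ} {X : Matrix (Fin n) (Fin p) ℝ}
    {k : Finset (Fin p)} {ε : ℝ} (hn : 0 < n) (hk : k.card ≤ n) (h : EigenBounds X k ε) :
    DesignBounds X k ε := by
  have hq : QuadBounds (scaledGram X k) ε ε⁻¹ := by
    refine quadBounds_of_eigenvalues (scaledGram_isHermitian X k) fun i => h _ ?_
    -- `eigenvalues` is `eigenvalues₀` reindexed along this equivalence. As `|k| ≤ n`, the
    -- restriction to the first `min (n, |k|)` indices is no restriction.
    have := ((Fintype.equivOfCardEq (Fintype.card_fin (Fintype.card k))).symm i).2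
    rw [min_eq_right hk]
    simpa using this
  intro v
  have e : v ⬝ᵥ (scaledGram X k).mulVec v =
      (n : ℝ)⁻¹ * ∑ i, (modelCols X k).mulVec v i ^ 2 := by
    rw [scaledGram, Matrix.smul_mulVec, dotProduct_smul, smul_eq_mul, ← Matrix.mulVec_mulVec,
      Matrix.dotProduct_mulVec, Matrix.vecMul_transpose]
    simp [dotProduct, sq]
  have hn' : (0 : ℝ) < n := by exact_mod_cast hn
  obtain ⟨h1, h2⟩ := hq v
  rw [e] at h1 h2
  rw [inv_mul_eq_div] at h1 h2
  rw [le_div_iff₀ hn'] at h1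
  rw [div_le_iff₀ hn'] at h2
  constructor <;> linarith

theorem QuadBounds.posDef {ι : Type*} [Fintype ι] {B : Matrix ι ι ℝ} {a₁ a₂ : ℝ}
    (h : QuadBounds B a₁ a₂) (hB : B.IsHermitian) (ha : 0 < a₁) : B.PosDef := by
  refine Matrix.PosDef.of_dotProduct_mulVec_pos hB fun x hx => ?_
  have : 0 < ∑ i, x i ^ 2 := by
    obtain ⟨i, hi⟩ := Function.ne_iff.1 hx
    exact Finset.sum_pos' (fun i _ => sq_nonneg _) ⟨i, Finset.mem_univ _, by
      have : x i ≠ 0 := hi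
      positivity⟩
  rw [star_trivial]
  exact lt_of_lt_of_le (by positivity) (h x).1

/-! ### Product bounds for the pMOM prior. -/

/-- The unnormalized pMOM density at `τ = σ² = 1`, without determinant and power of `2 π`. -/
noncomputable def momentKernel {ι : Type*} [Fintype ι] (r : ℕ) (B : Matrix ι ι ℝ) (v : ι → ℝ) :
    ℝ :=
  exp (-(v ⬝ᵥ B.mulVec v) / 2) * ∏ i, v i ^ (2 * r)

theorem integrable_prod_pow_mul_exp {ι : Type*} [Fintype ι] (r : ℕ) {a : ℝ} (ha : 0 < a) :
    Integrable fun v : ι → ℝ => ∏ i, (v i ^ (2 * r) * exp (-v i ^ 2 / (2 * a))) :=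
  Integrable.fintype_prod (f := fun _ x => x ^ (2 * r) * exp (-x ^ 2 / (2 * a)))
    fun _ => integrable_pow_mul_exp r ha

theorem integral_prod_pow_mul_exp {ι : Type*} [Fintype ι] (r : ℕ) {a : ℝ} (ha : 0 < a) :
    ∫ v : ι → ℝ, ∏ i, (v i ^ (2 * r) * exp (-v i ^ 2 / (2 * a))) =
      (gaussMoment r * a ^ ((r : ℝ) + 1 / 2)) ^ Fintype.card ι := by
  rw [integral_fintype_prod_volume_eq_pow (fun x : ℝ => x ^ (2 * r) * exp (-x ^ 2 / (2 * a))),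
    integral_pow_mul_exp r ha]

theorem prod_pow_mul_exp {ι : Type*} [Fintype ι] (r : ℕ) (a : ℝ) (v : ι → ℝ) :
    ∏ i, (v i ^ (2 * r) * exp (-v i ^ 2 / (2 * a⁻¹))) =
      exp (-(a * ∑ i, v i ^ 2) / 2) * ∏ i, v i ^ (2 * r) := by
  rw [Finset.prod_mul_distrib, ← exp_sum, mul_comm]
  congr 2
  rw [Finset.mul_sum, neg_div, Finset.sum_div, ← Finset.sum_neg_distrib]
  refine Finset.sum_congr rfl fun i _ => ?_
  rw [div_mul_eq_div_div, div_inv_eq_mul]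
  ring

/-- Replacing the quadratic form by multiples of `|v|²` decouples the coordinates. All integrals
over coefficients then factor into one-variable ones. -/
theorem momentKernel_bounds {ι : Type*} [Fintype ι] (r : ℕ) {B : Matrix ι ι ℝ} {a₁ a₂ : ℝ}
    (h : QuadBounds B a₁ a₂) (v : ι → ℝ) :
    ∏ i, (v i ^ (2 * r) * exp (-v i ^ 2 / (2 * a₂⁻¹))) ≤ momentKernel r B v ∧
      momentKernel r B v ≤ ∏ i, (v i ^ (2 * r) * exp (-v i ^ 2 / (2 * a₁⁻¹))) := by
  have h0 : 0 ≤ ∏ i, v i ^ (2 * r) := Finset.prod_nonneg fun i _ => even_pow_nonneg _ _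
  rw [prod_pow_mul_exp, prod_pow_mul_exp, momentKernel]
  obtain ⟨h1, h2⟩ := h v
  constructor <;> gcongr

theorem integral_momentKernel_bounds {ι : Type*} [Fintype ι] (r : ℕ) {B : Matrix ι ι ℝ}
    {a₁ a₂ : ℝ} (ha₁ : 0 < a₁) (ha₂ : 0 < a₂) (h : QuadBounds B a₁ a₂) :
    (gaussMoment r * a₂⁻¹ ^ ((r : ℝ) + 1 / 2)) ^ Fintype.card ι ≤ ∫ v, momentKernel r B v ∧
      ∫ v, momentKernel r B v ≤ (gaussMoment r * a₁⁻¹ ^ ((r : ℝ) + 1 / 2)) ^ Fintype.card ι := by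
  have h0 : ∀ v, 0 ≤ momentKernel r B v := fun v =>
    mul_nonneg (exp_pos _).le (Finset.prod_nonneg fun i _ => even_pow_nonneg _ _)
  have hc : Continuous (momentKernel r B) := by
    unfold momentKernel dotProduct Matrix.mulVec dotProduct
    fun_prop
  have hi1 := integrable_prod_pow_mul_exp (ι := ι) r (inv_pos.2 ha₁)
  have hi : Integrable (momentKernel r B) := hi1.mono' hc.aestronglyMeasurable
    (.of_forall fun v => by
      rw [norm_of_nonneg (h0 v)]
      exact (momentKernel_bounds r h v).2)
  rw [← integral_prod_pow_mul_exp r (inv_pos.2 ha₁), ← integral_prod_pow_mul_exp r (inv_pos.2 ha₂)]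
  exact ⟨integral_mono (integrable_prod_pow_mul_exp r (inv_pos.2 ha₂)) hi fun v =>
    (momentKernel_bounds r h v).1, integral_mono hi hi1 fun v => (momentKernel_bounds r h v).2⟩

/-- The determinant and the powers of `2 π` occur in the density and in its normalizing integral
alike and cancel. -/
theorem pMOMDensity_eq {p : ℕ} (r : ℕ) {A : Matrix (Fin p) (Fin p) ℝ} {k : Finset (Fin p)}
    (hd : 0 < (modelSub A k).det) {τ s : ℝ} (hτ : 0 < τ) (hs : 0 < s) (β : k → ℝ) :
    pMOMDensity r A k τ s β = (∫ v, momentKernel r (modelSub A k) v)⁻¹ *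
      ((τ * s) ^ (-((r : ℝ) + 1 / 2))) ^ k.card * momentKernel r ((τ * s)⁻¹ • modelSub A k) β := by
  have h1 : ∀ v : k → ℝ, pMOMUnnormalized r A k 1 1 v =
      ((2 * π) ^ (-(k.card : ℝ) / 2) * √(modelSub A k).det) *
        momentKernel r (modelSub A k) v := by
    intro v
    simp only [pMOMUnnormalized, momentKernel, mul_one, one_rpow]
    ring
  have h2 : momentKernel r ((τ * s)⁻¹ • modelSub A k) β =
      exp (-(β ⬝ᵥ (modelSub A k).mulVec β) / (2 * τ * s)) * ∏ i, β i ^ (2 * r) := by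
    rw [momentKernel, Matrix.smul_mulVec, dotProduct_smul, smul_eq_mul]
    congr 2
    field_simp
  have h3 : (τ * s) ^ (-((r : ℝ) * (k.card : ℝ)) - (k.card : ℝ) / 2) =
      ((τ * s) ^ (-((r : ℝ) + 1 / 2))) ^ k.card := by
    rw [← rpow_natCast, ← rpow_mul (by positivity)]
    congr 1
    ring
  have hd' : 0 < √(modelSub A k).det := sqrt_pos.2 hd
  have hp : (0 : ℝ) < (2 * π) ^ (-(k.card : ℝ) / 2) := by positivity
  rw [pMOMDensity, pMOMConst]
  simp_rw [h1]
  rw [integral_const_mul, h2, pMOMUnnormalized, h3]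
  field_simp

theorem QuadBounds.smul {ι : Type*} [Fintype ι] {B : Matrix ι ι ℝ} {a₁ a₂ : ℝ}
    (h : QuadBounds B a₁ a₂) {c : ℝ} (hc : 0 ≤ c) : QuadBounds (c • B) (c * a₁) (c * a₂) := by
  intro v
  rw [Matrix.smul_mulVec, dotProduct_smul, smul_eq_mul, mul_assoc, mul_assoc]
  exact ⟨mul_le_mul_of_nonneg_left (h v).1 hc, mul_le_mul_of_nonneg_left (h v).2 hc⟩

/-- The pMOM density lies between two products of functions of one variable. -/
theorem pMOMDensity_bounds {p : ℕ} (r : ℕ) {A : Matrix (Fin p) (Fin p) ℝ} (hA : A.IsHermitian)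
    {a₁ a₂ : ℝ} (ha₁ : 0 < a₁) (ha₂ : 0 < a₂) (h : QuadBounds A a₁ a₂) (k : Finset (Fin p))
    {τ s : ℝ} (hτ : 0 < τ) (hs : 0 < s) (β : k → ℝ) :
    ∏ i, ((gaussMoment r)⁻¹ * a₁ ^ ((r : ℝ) + 1 / 2) * (τ * s) ^ (-((r : ℝ) + 1 / 2)) *
        (β i ^ (2 * r) * exp (-β i ^ 2 / (2 * (τ * s / a₂))))) ≤ pMOMDensity r A k τ s β ∧
      pMOMDensity r A k τ s β ≤
        ∏ i, ((gaussMoment r)⁻¹ * a₂ ^ ((r : ℝ) + 1 / 2) * (τ * s) ^ (-((r : ℝ) + 1 / 2)) *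
          (β i ^ (2 * r) * exp (-β i ^ 2 / (2 * (τ * s / a₁))))) := by
  have hM := gaussMoment_pos r
  have hk := h.modelSub k
  have hH : (modelSub A k).IsHermitian := hA.submatrix _
  have hd := (hk.posDef hH ha₁).det_pos
  rw [pMOMDensity_eq r hd hτ hs]
  obtain ⟨l, u⟩ := momentKernel_bounds r (hk.smul (c := (τ * s)⁻¹) (by positivity)) β
  obtain ⟨l', u'⟩ := integral_momentKernel_bounds r ha₁ ha₂ hk
  have e : ∀ a, ((τ * s)⁻¹ * a)⁻¹ = τ * s / a := fun a => by rw [mul_inv, inv_inv, div_eq_mul_inv]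
  have e' : ∀ a, 0 < a → (gaussMoment r)⁻¹ * a ^ ((r : ℝ) + 1 / 2) =
      (gaussMoment r * a⁻¹ ^ ((r : ℝ) + 1 / 2))⁻¹ := fun a ha => by
    rw [mul_inv, inv_rpow ha.le, inv_inv]
  rw [e] at l u
  rw [Fintype.card_coe] at l' u'
  have e2 : ∀ (c d : ℝ) (F : k → ℝ), ∏ i, (c * d * F i) = c ^ k.card * d ^ k.card * ∏ i, F i :=
    fun c d F => by
      rw [Finset.prod_mul_distrib, Finset.prod_const, mul_pow, Finset.card_univ, Fintype.card_coe]
  rw [e2, e2, e' _ ha₁, e' _ ha₂, inv_pow, inv_pow]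
  have h1 : 0 < (gaussMoment r * a₁⁻¹ ^ ((r : ℝ) + 1 / 2)) ^ k.card := by positivity
  have h2 : 0 < (gaussMoment r * a₂⁻¹ ^ ((r : ℝ) + 1 / 2)) ^ k.card := by positivity
  have h3 : 0 ≤ ∏ i, (β i ^ (2 * r) * exp (-β i ^ 2 / (2 * (τ * s / a₂)))) :=
    Finset.prod_nonneg fun i _ => mul_nonneg (even_pow_nonneg _ _) (exp_pos _).le
  have h4 : 0 ≤ ∏ i, (β i ^ (2 * r) * exp (-β i ^ 2 / (2 * (τ * s / a₁)))) :=
    Finset.prod_nonneg fun i _ => mul_nonneg (even_pow_nonneg _ _) (exp_pos _).le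
  have h5 : 0 < ∫ v, momentKernel r (modelSub A k) v := h2.trans_le l'
  have h6 : 0 < ((τ * s) ^ (-((r : ℝ) + 1 / 2))) ^ k.card := by positivity
  constructor
  · gcongr
  · gcongr
    exact h3.trans l
-- The marginal density as a mixture, and integrals against it.
theorem measurable_likelihood {n p : ℕ} (X : Matrix (Fin n) (Fin p) ℝ) (k : Finset (Fin p)) :
    Measurable fun z : (Fin n → ℝ) × ℝ × (k → ℝ) => likelihood X k z.2.2 z.2.1 z.1 := by
  unfold likelihood Matrix.mulVec dotProduct
  fun_prop

theorem measurable_pMOMDensity {p : ℕ} (r : ℕ) (A : Matrix (Fin p) (Fin p) ℝ)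
    (k : Finset (Fin p)) :
    Measurable fun z : ℝ × ℝ × (k → ℝ) => pMOMDensity r A k z.1 z.2.1 z.2.2 := by
  unfold pMOMDensity pMOMUnnormalized Matrix.mulVec dotProduct
  fun_prop

theorem measurable_invGammaDensity (a b : ℝ) : Measurable (invGammaDensity a b) := by
  unfold invGammaDensity
  fun_prop

theorem invGammaDensity_nonneg {a b x : ℝ} (ha : 0 < a) (hb : 0 < b) (hx : 0 < x) :
    0 ≤ invGammaDensity a b x := by
  have := Gamma_pos_of_pos ha
  unfold invGammaDensity
  positivity

theorem lintegral_invGammaDensity {a b : ℝ} (ha : 0 < a) (hb : 0 < b) :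
    ∫⁻ x in Set.Ioi (0 : ℝ), ENNReal.ofReal (invGammaDensity a b x) = 1 := by
  have hG := Gamma_pos_of_pos ha
  unfold invGammaDensity
  simp_rw [mul_assoc, ENNReal.ofReal_mul (show 0 ≤ b ^ a / Gamma a by positivity)]
  rw [lintegral_const_mul _ (by fun_prop), lintegral_rpow_mul_exp_neg_div ha hb,
    ← ENNReal.ofReal_mul (by positivity), rpow_neg hb.le]
  have : 0 < b ^ a := by positivity
  rw [show b ^ a / Gamma a * (Gamma a * (b ^ a)⁻¹) = 1 by field_simp, ENNReal.ofReal_one]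

/-- The measure `dτ ds dβ` on the parameters of a model. -/
noncomputable def paramMeasure {p : ℕ} (k : Finset (Fin p)) : Measure (ℝ × ℝ × (k → ℝ)) :=
  (volume.restrict (Set.Ioi 0)).prod ((volume.restrict (Set.Ioi 0)).prod volume)

instance {p : ℕ} (k : Finset (Fin p)) : SFinite (paramMeasure k) := by
  unfold paramMeasure
  infer_instance

/-- The joint density of response and parameters. -/
noncomputable def jointDensity {n p : ℕ} (r : ℕ) (α₁ α₂ : ℝ)
    (X : Matrix (Fin n) (Fin p) ℝ) (A : Matrix (Fin p) (Fin p) ℝ) (k : Finset (Fin p))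
    (y : Fin n → ℝ) (z : ℝ × ℝ × (k → ℝ)) : ENNReal :=
  ENNReal.ofReal (likelihood X k z.2.2 z.2.1 y * pMOMDensity r A k z.1 z.2.1 z.2.2 *
      invGammaDensity (1 / 2) ((n : ℝ) / 2) z.1 * invGammaDensity α₁ α₂ z.2.1)

theorem measurable_jointDensity {n p : ℕ} (r : ℕ) (α₁ α₂ : ℝ)
    (X : Matrix (Fin n) (Fin p) ℝ) (A : Matrix (Fin p) (Fin p) ℝ) (k : Finset (Fin p)) :
    Measurable (Function.uncurry (jointDensity r α₁ α₂ X A k)) := by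
  have h1 : Measurable fun w : (Fin n → ℝ) × ℝ × ℝ × (k → ℝ) =>
      likelihood X k w.2.2.2 w.2.2.1 w.1 :=
    (measurable_likelihood X k).comp (measurable_fst.prodMk (measurable_snd.comp measurable_snd))
  have h2 : Measurable fun w : (Fin n → ℝ) × ℝ × ℝ × (k → ℝ) =>
      pMOMDensity r A k w.2.1 w.2.2.1 w.2.2.2 :=
    (measurable_pMOMDensity r A k).comp measurable_snd
  have h3 : Measurable fun w : (Fin n → ℝ) × ℝ × ℝ × (k → ℝ) =>
      invGammaDensity (1 / 2) ((n : ℝ) / 2) w.2.1 :=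
    (measurable_invGammaDensity _ _).comp measurable_snd.fst
  have h4 : Measurable fun w : (Fin n → ℝ) × ℝ × ℝ × (k → ℝ) =>
      invGammaDensity α₁ α₂ w.2.2.1 :=
    (measurable_invGammaDensity _ _).comp measurable_snd.snd.fst
  exact (((h1.mul h2).mul h3).mul h4).ennreal_ofReal

theorem marginalDensity_eq {n p : ℕ} (r : ℕ) (α₁ α₂ : ℝ)
    (X : Matrix (Fin n) (Fin p) ℝ) (A : Matrix (Fin p) (Fin p) ℝ) (k : Finset (Fin p))
    (y : Fin n → ℝ) :
    marginalDensity r α₁ α₂ X A k y = ∫⁻ z, jointDensity r α₁ α₂ X A k y z ∂paramMeasure k := by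
  have hm : Measurable (jointDensity r α₁ α₂ X A k y) :=
    (measurable_jointDensity r α₁ α₂ X A k).of_uncurry_left
  rw [paramMeasure, lintegral_prod _ hm.aemeasurable]
  refine lintegral_congr fun τ => ?_
  rw [lintegral_prod]
  · rfl
  · exact (hm.comp measurable_prodMk_left).aemeasurable

theorem measurable_marginalDensity {n p : ℕ} (r : ℕ) (α₁ α₂ : ℝ)
    (X : Matrix (Fin n) (Fin p) ℝ) (A : Matrix (Fin p) (Fin p) ℝ) (k : Finset (Fin p)) :
    Measurable (marginalDensity r α₁ α₂ X A k) := by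
  rw [show marginalDensity r α₁ α₂ X A k = fun y => _ from
    funext (marginalDensity_eq r α₁ α₂ X A k)]
  exact (measurable_jointDensity r α₁ α₂ X A k).lintegral_prod_right'

theorem likelihood_nonneg {n p : ℕ} (X : Matrix (Fin n) (Fin p) ℝ) (k : Finset (Fin p))
    (β : k → ℝ) {s : ℝ} (hs : 0 < s) (y : Fin n → ℝ) : 0 ≤ likelihood X k β s y := by
  unfold likelihood
  positivity

theorem pMOMDensity_nonneg {p : ℕ} (r : ℕ) {A : Matrix (Fin p) (Fin p) ℝ} (hA : A.IsHermitian)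
    {a₁ a₂ : ℝ} (ha₁ : 0 < a₁) (ha₂ : 0 < a₂) (h : QuadBounds A a₁ a₂) (k : Finset (Fin p))
    {τ s : ℝ} (hτ : 0 < τ) (hs : 0 < s) (β : k → ℝ) : 0 ≤ pMOMDensity r A k τ s β := by
  have := gaussMoment_pos r
  refine le_trans (Finset.prod_nonneg fun i _ => ?_)
    (pMOMDensity_bounds r hA ha₁ ha₂ h k hτ hs β).1
  have := even_pow_nonneg (β i) r
  positivity

/-- Integrals of the marginal density against a weight are bounded by means of the integrals of
the likelihood. -/
theorem lintegral_marginalDensity_mul_le {n p : ℕ} (hn : 0 < n) (r : ℕ) {α₁ α₂ : ℝ} (hα₁ : 0 < α₁)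
    (hα₂ : 0 < α₂) (X : Matrix (Fin n) (Fin p) ℝ) {A : Matrix (Fin p) (Fin p) ℝ}
    (hA : A.IsHermitian) {a₁ a₂ : ℝ} (ha₁ : 0 < a₁) (ha₂ : 0 < a₂) (h : QuadBounds A a₁ a₂)
    (k : Finset (Fin p)) {w : (Fin n → ℝ) → ENNReal} (hw : Measurable w)
    (B : ℝ → (k → ℝ) → ENNReal) (hB : ∀ s, 0 < s → ∀ β,
      ∫⁻ y, ENNReal.ofReal (likelihood X k β s y) * w y ≤ B s β)
    (C : ℝ → ℝ → ENNReal) (hC : ∀ τ s, 0 < τ → 0 < s →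
      ∫⁻ β : k → ℝ, ENNReal.ofReal (pMOMDensity r A k τ s β) * B s β ≤ C τ s) :
    ∫⁻ y, marginalDensity r α₁ α₂ X A k y * w y ≤
      ∫⁻ τ in Set.Ioi (0 : ℝ), ENNReal.ofReal (invGammaDensity (1 / 2) ((n : ℝ) / 2) τ) *
        ∫⁻ s in Set.Ioi (0 : ℝ), ENNReal.ofReal (invGammaDensity α₁ α₂ s) * C τ s := by
  have hn' : (0 : ℝ) < n := by exact_mod_cast hn
  have hm := measurable_jointDensity r α₁ α₂ X A k
  have hmw : Measurable fun v : (Fin n → ℝ) × ℝ × ℝ × (k → ℝ) =>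
      jointDensity r α₁ α₂ X A k v.1 v.2 * w v.1 := hm.mul (hw.comp measurable_fst)
  have hm' : Measurable fun z => ∫⁻ y, jointDensity r α₁ α₂ X A k y z * w y :=
    Measurable.lintegral_prod_left' hmw
  calc _ = ∫⁻ y, ∫⁻ z, jointDensity r α₁ α₂ X A k y z * w y ∂paramMeasure k := by
        refine lintegral_congr fun y => ?_
        rw [marginalDensity_eq, lintegral_mul_const]
        exact hm.of_uncurry_left
    -- Tonelli: the response is integrated out first, at fixed parameters, where its law is a plain
    -- isotropic Gaussian.
    _ = ∫⁻ z, (∫⁻ y, jointDensity r α₁ α₂ X A k y z * w y) ∂paramMeasure k :=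
        lintegral_lintegral_swap hmw.aemeasurable
    _ = ∫⁻ τ in Set.Ioi (0 : ℝ), ∫⁻ s in Set.Ioi (0 : ℝ), ∫⁻ β : k → ℝ,
          ∫⁻ y, jointDensity r α₁ α₂ X A k y (τ, s, β) * w y := by
        rw [paramMeasure, lintegral_prod _ hm'.aemeasurable]
        refine lintegral_congr fun τ => ?_
        rw [lintegral_prod]
        exact (hm'.comp measurable_prodMk_left).aemeasurable
    _ ≤ _ := by
        refine setLIntegral_mono' measurableSet_Ioi fun τ (hτ : 0 < τ) => ?_
        rw [← lintegral_const_mul' _ _ ENNReal.ofReal_ne_top]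
        refine setLIntegral_mono' measurableSet_Ioi fun s (hs : 0 < s) => ?_
        rw [← mul_assoc, ← ENNReal.ofReal_mul
          (invGammaDensity_nonneg (by norm_num) (by positivity) hτ)]
        refine le_trans ?_ (mul_le_mul_right (hC τ s hτ hs) _)
        rw [← lintegral_const_mul' _ _ ENNReal.ofReal_ne_top]
        refine lintegral_mono fun β => ?_
        refine le_trans (le_of_eq ?_) (mul_le_mul_right (mul_le_mul_right (hB s hs β) _) _)
        rw [← lintegral_const_mul' _ _ ENNReal.ofReal_ne_top,
          ← lintegral_const_mul' _ _ ENNReal.ofReal_ne_top]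
        refine lintegral_congr fun y => ?_
        have e1 := invGammaDensity_nonneg (a := 1 / 2) (b := (n : ℝ) / 2) (by norm_num)
          (by positivity) hτ
        have e2 := invGammaDensity_nonneg hα₁ hα₂ hs
        have e3 := pMOMDensity_nonneg r hA ha₁ ha₂ h k hτ hs β
        have e4 := likelihood_nonneg X k β hs y
        rw [← mul_assoc, ← mul_assoc, ← ENNReal.ofReal_mul (by positivity),
          ← ENNReal.ofReal_mul (by positivity), jointDensity]
        congr 2
        ring

/-- A factor that bounds the mass of the pMOM density per covariate. -/
noncomputable def massBound (r : ℕ) (a₁ a₂ : ℝ) : ℝ := (a₂ / a₁) ^ ((r : ℝ) + 1 / 2)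

/-- The upper product bound suffices here: its loss of a constant factor per covariate is absorbed
by the complexity prior. -/
theorem lintegral_pMOMDensity_le {p : ℕ} (r : ℕ) {A : Matrix (Fin p) (Fin p) ℝ}
    (hA : A.IsHermitian) {a₁ a₂ : ℝ} (ha₁ : 0 < a₁) (ha₂ : 0 < a₂) (h : QuadBounds A a₁ a₂)
    (k : Finset (Fin p)) {τ s : ℝ} (hτ : 0 < τ) (hs : 0 < s) :
    ∫⁻ β : k → ℝ, ENNReal.ofReal (pMOMDensity r A k τ s β) ≤
      ENNReal.ofReal (massBound r a₁ a₂ ^ k.card) := by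
  have hM := gaussMoment_pos r
  set c := (gaussMoment r)⁻¹ * a₂ ^ ((r : ℝ) + 1 / 2) * (τ * s) ^ (-((r : ℝ) + 1 / 2)) with hc
  have hc0 : 0 ≤ c := by positivity
  calc _ ≤ ∫⁻ β : k → ℝ, ∏ i, (ENNReal.ofReal c * ENNReal.ofReal (β i ^ (2 * r) *
          exp (-β i ^ 2 / (2 * (τ * s / a₁))))) := by
        refine lintegral_mono fun β => ?_
        refine (ENNReal.ofReal_le_ofReal
          (pMOMDensity_bounds r hA ha₁ ha₂ h k hτ hs β).2).trans (le_of_eq ?_)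
        rw [ENNReal.ofReal_prod_of_nonneg]
        · exact Finset.prod_congr rfl fun i _ => ENNReal.ofReal_mul hc0
        · exact fun i _ => mul_nonneg hc0 (mul_nonneg (even_pow_nonneg _ _) (exp_pos _).le)
    _ = ENNReal.ofReal (massBound r a₁ a₂ ^ k.card) := by
        rw [lintegral_pi_prod (fun _ x => ENNReal.ofReal c * ENNReal.ofReal (x ^ (2 * r) *
          exp (-x ^ 2 / (2 * (τ * s / a₁))))) (fun _ => by fun_prop)]
        rw [Finset.prod_const, lintegral_const_mul _ (by fun_prop),
          lintegral_pow_mul_exp r (by positivity), ← ENNReal.ofReal_mul hc0,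
          ← ENNReal.ofReal_pow (by positivity), Finset.card_univ, Fintype.card_coe, massBound]
        congr 2
        rw [hc, div_rpow (by positivity) ha₁.le, div_rpow ha₂.le ha₁.le,
          rpow_neg (by positivity)]
        field_simp

/-- A bound uniform in coefficients and variance passes to the mixture. This is how the error of a
test under each member of the model becomes an error under the marginal law. -/
theorem lintegral_marginalDensity_mul_le_of_le {n p : ℕ} (hn : 0 < n) (r : ℕ) {α₁ α₂ : ℝ}
    (hα₁ : 0 < α₁) (hα₂ : 0 < α₂) (X : Matrix (Fin n) (Fin p) ℝ) {A : Matrix (Fin p) (Fin p) ℝ}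
    (hA : A.IsHermitian) {a₁ a₂ : ℝ} (ha₁ : 0 < a₁) (ha₂ : 0 < a₂) (h : QuadBounds A a₁ a₂)
    (k : Finset (Fin p)) {w : (Fin n → ℝ) → ENNReal} (hw : Measurable w) (δ : ENNReal)
    (hδ : ∀ s, 0 < s → ∀ β, ∫⁻ y, ENNReal.ofReal (likelihood X k β s y) * w y ≤ δ) :
    ∫⁻ y, marginalDensity r α₁ α₂ X A k y * w y ≤
      ENNReal.ofReal (massBound r a₁ a₂ ^ k.card) * δ := by
  refine (lintegral_marginalDensity_mul_le hn r hα₁ hα₂ X hA ha₁ ha₂ h k hw (fun _ _ => δ) hδ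
    (fun _ _ => ENNReal.ofReal (massBound r a₁ a₂ ^ k.card) * δ) fun τ s hτ hs => ?_).trans ?_
  · rw [lintegral_mul_const]
    · gcongr
      exact lintegral_pMOMDensity_le r hA ha₁ ha₂ h k hτ hs
    · exact ((measurable_pMOMDensity r A k).comp
        (measurable_const.prodMk (measurable_const.prodMk measurable_id))).ennreal_ofReal
  · have hn' : (0 : ℝ) < n := by exact_mod_cast hn
    have m1 := (measurable_invGammaDensity α₁ α₂).ennreal_ofReal
    have m2 := (measurable_invGammaDensity (1 / 2) ((n : ℝ) / 2)).ennreal_ofReal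
    rw [lintegral_mul_const _ m1, lintegral_mul_const _ m2,
      lintegral_invGammaDensity hα₁ hα₂, lintegral_invGammaDensity (by norm_num) (by positivity),
      one_mul, one_mul]
-- Isotropic normal densities in orthonormal coordinates, and Hölder's inequality.
/-- Density of the normal distribution `N(μ, s I_n)`. -/
noncomputable def isoDensity {n : ℕ} (μ : Fin n → ℝ) (s : ℝ) (y : Fin n → ℝ) : ℝ :=
  (2 * π * s) ^ (-(n : ℝ) / 2) * exp (-(∑ i, (y i - μ i) ^ 2) / (2 * s))

theorem likelihood_eq_isoDensity {n p : ℕ} (X : Matrix (Fin n) (Fin p) ℝ) (k : Finset (Fin p))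
    (β : k → ℝ) (s : ℝ) (y : Fin n → ℝ) :
    likelihood X k β s y = isoDensity ((modelCols X k).mulVec β) s y := rfl

theorem measurable_isoDensity {n : ℕ} (μ : Fin n → ℝ) (s : ℝ) : Measurable (isoDensity μ s) := by
  unfold isoDensity
  fun_prop

theorem isoDensity_pos {n : ℕ} (μ : Fin n → ℝ) {s : ℝ} (hs : 0 < s) (y : Fin n → ℝ) :
    0 < isoDensity μ s y := by
  unfold isoDensity
  positivity

/-- The normal density in one dimension with mean `m` and variance `s`. -/
noncomputable def normalDensity (m s x : ℝ) : ℝ := (√(2 * π * s))⁻¹ * exp (-(x - m) ^ 2 / (2 * s))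

theorem measurable_normalDensity (m s : ℝ) : Measurable (normalDensity m s) := by
  unfold normalDensity
  fun_prop

theorem normalDensity_nonneg (m s x : ℝ) : 0 ≤ normalDensity m s x := by
  unfold normalDensity
  positivity

theorem isoDensity_eq_prod_coord {n : ℕ} {ι : Type*} [Fintype ι]
    (b : OrthonormalBasis ι ℝ (EuclideanSpace ℝ (Fin n))) (μ : Fin n → ℝ) {s : ℝ} (hs : 0 < s)
    (y : Fin n → ℝ) :
    isoDensity μ s y = ∏ i, normalDensity (coord b μ i) s (coord b y i) := by
  have hc : Fintype.card ι = n := by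
    have := Module.finrank_eq_card_basis b.toBasis
    rw [finrank_euclideanSpace_fin] at this
    exact this.symm
  simp_rw [normalDensity, Finset.prod_mul_distrib, Finset.prod_const, Finset.card_univ, hc,
    ← exp_sum, isoDensity]
  congr 1
  · rw [sqrt_eq_rpow, ← rpow_neg (by positivity), ← rpow_natCast, ← rpow_mul (by positivity)]
    congr 1
    ring
  · congr 1
    have := sum_coord_sq b (y - μ)
    simp_rw [coord_sub, Pi.sub_apply] at this
    rw [← this, neg_div, Finset.sum_div, ← Finset.sum_neg_distrib]
    exact Finset.sum_congr rfl fun i _ => by ring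

theorem lintegral_isoDensity_mul_prod {n : ℕ} {ι : Type*} [Fintype ι]
    (b : OrthonormalBasis ι ℝ (EuclideanSpace ℝ (Fin n))) (μ : Fin n → ℝ) {s : ℝ} (hs : 0 < s)
    (G : ι → ℝ → ENNReal) (hG : ∀ i, Measurable (G i)) :
    ∫⁻ y, ENNReal.ofReal (isoDensity μ s y) * ∏ i, G i (coord b y i) =
      ∏ i, ∫⁻ x, ENNReal.ofReal (normalDensity (coord b μ i) s x) * G i x := by
  rw [← lintegral_prod_coord b (fun i x => ENNReal.ofReal (normalDensity (coord b μ i) s x) * G i x)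
    fun i => (measurable_normalDensity _ _).ennreal_ofReal.mul (hG i)]
  refine lintegral_congr fun y => ?_
  rw [isoDensity_eq_prod_coord b μ hs, ENNReal.ofReal_prod_of_nonneg
    fun i _ => normalDensity_nonneg _ _ _, Finset.prod_mul_distrib]

theorem lintegral_normalDensity (m : ℝ) {s : ℝ} (hs : 0 < s) :
    ∫⁻ x, ENNReal.ofReal (normalDensity m s x) = 1 := by
  have : 0 < √(2 * π * s) := by positivity
  simp_rw [normalDensity, ENNReal.ofReal_mul (inv_nonneg.2 this.le)]
  rw [lintegral_const_mul _ (by fun_prop), lintegral_exp_neg_sq hs,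
    ← ENNReal.ofReal_mul (by positivity), inv_mul_cancel₀ this.ne', ENNReal.ofReal_one]

/-- Convolution of two Gaussians: the variances add. -/
theorem lintegral_normalDensity_mul_exp_neg (m q : ℝ) {s B : ℝ} (hs : 0 < s) (hB : 0 < B) :
    ∫⁻ x, ENNReal.ofReal (normalDensity m s x) * ENNReal.ofReal (exp (-(x - q) ^ 2 / (2 * B))) =
      ENNReal.ofReal (√(B / (s + B)) * exp (-(m - q) ^ 2 / (2 * (s + B)))) := by
  have hs' : 0 < √(2 * π * s) := by positivity
  have e : ∀ x, ENNReal.ofReal (normalDensity m s x) *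
      ENNReal.ofReal (exp (-(x - q) ^ 2 / (2 * B))) = ENNReal.ofReal (√(2 * π * s))⁻¹ *
        ENNReal.ofReal (exp (-(x - m) ^ 2 / (2 * s)) * exp (-(x - q) ^ 2 / (2 * B))) := by
    intro x
    rw [normalDensity, ENNReal.ofReal_mul (by positivity), mul_assoc,
      ← ENNReal.ofReal_mul (exp_pos _).le]
  simp_rw [e]
  rw [lintegral_const_mul _ (by fun_prop), lintegral_exp_neg_sq_mul hs hB,
    ← ENNReal.ofReal_mul (by positivity), ← mul_assoc]
  congr 2
  rw [show 2 * π * (s * B / (s + B)) = 2 * π * s * (B / (s + B)) by ring,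
    sqrt_mul (x := 2 * π * s) (by positivity) (B / (s + B)), inv_mul_cancel_left₀ hs'.ne']

/-- The integral equals `(1 + γ/2)^(-1/2)`, and `exp (γ/4) ≤ (1 - γ/4)⁻¹ ≤ 1 + γ/2` for `γ ≤ 1`. The
bound does not involve `s`, which makes the test below uniform in the variance. -/
theorem lintegral_normalDensity_mul_exp_neg_le {s γ : ℝ} (hs : 0 < s) (hγ : 0 < γ) (hγ1 : γ ≤ 1) :
    ∫⁻ x, ENNReal.ofReal (normalDensity 0 s x) * ENNReal.ofReal (exp (-(γ * x ^ 2) / (4 * s))) ≤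
      ENNReal.ofReal (exp (-γ / 8)) := by
  have h := lintegral_normalDensity_mul_exp_neg 0 0 hs (B := 2 * s / γ) (by positivity)
  have e : ∀ x : ℝ, -(γ * x ^ 2) / (4 * s) = -(x - 0) ^ 2 / (2 * (2 * s / γ)) := by
    intro x
    field_simp
    ring
  simp_rw [e]
  rw [h]
  apply ENNReal.ofReal_le_ofReal
  rw [sub_zero, zero_pow two_ne_zero, neg_zero, zero_div, exp_zero, mul_one]
  apply sqrt_le_iff.2 ⟨(exp_pos _).le, ?_⟩
  rw [← exp_nat_mul]
  have h1 : exp (γ / 4) * (1 - γ / 4) ≤ 1 := by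
    have := one_sub_le_exp_neg (γ / 4)
    calc exp (γ / 4) * (1 - γ / 4) ≤ exp (γ / 4) * exp (-(γ / 4)) := by gcongr
      _ = 1 := by rw [← exp_add]; simp
  have h2 : 2 * s / γ / (s + 2 * s / γ) = (1 + γ / 2)⁻¹ := by
    field_simp
    ring
  rw [h2, show ((2 : ℕ) : ℝ) * (-γ / 8) = -(γ / 4) by push_cast; ring, exp_neg]
  gcongr
  nlinarith

/-- The integral equals `(1 - γ/2)^(-1/2)`, and `exp γ * (1 - γ/2) ≥ (1 + γ) * (1 - γ/2) ≥ 1` for `0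
≤ γ ≤ 1`. -/
theorem lintegral_normalDensity_mul_exp_le {s γ : ℝ} (hs : 0 < s) (hγ : 0 < γ) (hγ1 : γ ≤ 1) :
    ∫⁻ x, ENNReal.ofReal (normalDensity 0 s x) * ENNReal.ofReal (exp (γ * x ^ 2 / (4 * s))) ≤
      ENNReal.ofReal (exp (γ / 2)) := by
  have hd : 0 < 1 - γ / 2 := by linarith
  have hs' : 0 < √(2 * π * s) := by positivity
  have e : ∀ x, ENNReal.ofReal (normalDensity 0 s x) * ENNReal.ofReal (exp (γ * x ^ 2 / (4 * s))) =
      ENNReal.ofReal (√(2 * π * s))⁻¹ *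
        ENNReal.ofReal (exp (-(x - 0) ^ 2 / (2 * (s / (1 - γ / 2))))) := by
    intro x
    rw [normalDensity, ENNReal.ofReal_mul (by positivity), mul_assoc,
      ← ENNReal.ofReal_mul (exp_pos _).le, ← exp_add]
    congr 3
    field_simp
    ring
  simp_rw [e]
  rw [lintegral_const_mul _ (by fun_prop), lintegral_exp_neg_sq (by positivity),
    ← ENNReal.ofReal_mul (by positivity)]
  apply ENNReal.ofReal_le_ofReal
  rw [← mul_div_assoc, sqrt_div (by positivity), ← mul_div_assoc, inv_mul_cancel₀ hs'.ne',
    div_le_iff₀ (sqrt_pos.2 hd), ← sqrt_sq (exp_pos (γ / 2)).le, ← sqrt_mul (by positivity)]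
  rw [one_le_sqrt, ← exp_nat_mul]
  have := add_one_le_exp (((2 : ℕ) : ℝ) * (γ / 2))
  push_cast at *
  nlinarith

theorem isoDensity_eq_prod {n : ℕ} (μ : Fin n → ℝ) {s : ℝ} (hs : 0 < s) (y : Fin n → ℝ) :
    isoDensity μ s y = ∏ i, normalDensity (μ i) s (y i) := by
  rw [isoDensity_eq_prod_coord (EuclideanSpace.basisFun (Fin n) ℝ) μ hs]
  simp [coord, EuclideanSpace.inner_single_left]

theorem lintegral_isoDensity {n : ℕ} (μ : Fin n → ℝ) {s : ℝ} (hs : 0 < s) :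
    ∫⁻ y, ENNReal.ofReal (isoDensity μ s y) = 1 := by
  have := lintegral_isoDensity_mul_prod (EuclideanSpace.basisFun (Fin n) ℝ) μ hs (fun _ => 1)
    fun _ => measurable_one
  simpa [lintegral_normalDensity _ hs] using this

/-- Moments of order `s` of a density ratio, by **Hölder's inequality**. -/
theorem lintegral_mul_div_rpow_le {α : Type*} [MeasurableSpace α] {μ : Measure α}
    {f m w v : α → ENNReal} (hf : Measurable f) (hm : Measurable m) (hw : Measurable w)
    (hv : Measurable v) (hf0 : ∀ y, f y ≠ 0) (hft : ∀ y, f y ≠ ⊤) {s : ℝ} (hs0 : 0 < s)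
    (hs1 : s < 1) :
    ∫⁻ y, f y * (m y / f y) ^ s * (w y ^ s * v y ^ (1 - s)) ∂μ ≤
      (∫⁻ y, m y * w y ∂μ) ^ s * (∫⁻ y, f y * v y ∂μ) ^ (1 - s) := by
  -- The integrand is `(m w)^s (f v)^(1-s)`, because `f (m/f)^s = m^s f^(1-s)` where `f` is neither
  -- zero nor infinite.
  refine le_trans (le_of_eq ?_) (ENNReal.lintegral_mul_norm_pow_le (hm.mul hw).aemeasurable
    (hf.mul hv).aemeasurable hs0.le (sub_nonneg.2 hs1.le) (by ring))
  refine lintegral_congr fun y => ?_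
  rw [Pi.mul_apply, Pi.mul_apply, ENNReal.mul_rpow_of_nonneg _ _ hs0.le,
    ENNReal.mul_rpow_of_nonneg _ _ (sub_nonneg.2 hs1.le), ENNReal.div_rpow_of_nonneg _ _ hs0.le,
    ENNReal.rpow_sub _ _ (hf0 y) (hft y), ENNReal.rpow_one]
  simp only [div_eq_mul_inv]
  ring

/-- The column space of `X_k`. -/
noncomputable def colSpace {n p : ℕ} (X : Matrix (Fin n) (Fin p) ℝ) (k : Finset (Fin p)) :
    Submodule ℝ (EuclideanSpace ℝ (Fin n)) :=
  LinearMap.range ((WithLp.linearEquiv 2 ℝ (Fin n → ℝ)).symm.toLinearMap ∘ₗ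
    (modelCols X k).mulVecLin)

theorem mem_colSpace {n p : ℕ} (X : Matrix (Fin n) (Fin p) ℝ) (k : Finset (Fin p))
    (x : EuclideanSpace ℝ (Fin n)) :
    x ∈ colSpace X k ↔ ∃ v, WithLp.toLp 2 ((modelCols X k).mulVec v) = x := by
  simp [colSpace]

theorem finrank_colSpace_le {n p : ℕ} (X : Matrix (Fin n) (Fin p) ℝ) (k : Finset (Fin p)) :
    Module.finrank ℝ (colSpace X k) ≤ k.card :=
  (LinearMap.finrank_range_le _).trans (by simp)

theorem coord_mulVec_eq_zero {n p : ℕ} {ι : Type*} [Fintype ι] {X : Matrix (Fin n) (Fin p) ℝ}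
    {k : Finset (Fin p)} (b : OrthonormalBasis ι ℝ (EuclideanSpace ℝ (Fin n))) {i : ι}
    (h : b i ∈ (colSpace X k)ᗮ) (v : k → ℝ) : coord b ((modelCols X k).mulVec v) i = 0 :=
  Submodule.inner_left_of_mem_orthogonal ((mem_colSpace X k _).2 ⟨v, rfl⟩) h
-- Models that miss a true covariate: a scale-free test.
/-- An orthonormal basis with a distinguished element `i₀` along the part of `μ` that `X_k` does
not explain; `R` consists of the directions orthogonal to `X_k` and to that element. -/
theorem exists_residual_basis {n p : ℕ} (X : Matrix (Fin n) (Fin p) ℝ) (k : Finset (Fin p))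
    (μ : Fin n → ℝ) {D : ℝ} (hD : 0 < D)
    (h : ∀ v, D ≤ ∑ i, (μ i - (modelCols X k).mulVec v i) ^ 2) :
    ∃ (ι : Finset (EuclideanSpace ℝ (Fin n))) (b : OrthonormalBasis ι ℝ (EuclideanSpace ℝ (Fin n)))
      (i₀ : ι) (R : Finset ι), i₀ ∉ R ∧ n ≤ R.card + k.card + 1 ∧ R.card ≤ n ∧
      b i₀ ∈ (colSpace X k)ᗮ ∧ (∀ i ∈ R, b i ∈ (colSpace X k)ᗮ) ∧
      D ≤ coord b μ i₀ ^ 2 ∧ ∀ i ∈ R, coord b μ i = 0 := by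
  classical
  set U := colSpace X k with hU
  set x : EuclideanSpace ℝ (Fin n) := WithLp.toLp 2 μ with hx
  have hP : U.starProjection x ∈ U := Submodule.starProjection_apply_mem U x
  have hres : x - U.starProjection x ∈ Uᗮ := Submodule.sub_starProjection_mem_orthogonal x
  set z := x - U.starProjection x with hz
  obtain ⟨v, hv⟩ := (mem_colSpace X k _).1 hP
  have hnorm : D ≤ ‖z‖ ^ 2 := by
    rw [hz, ← hv, EuclideanSpace.norm_sq_eq]
    simpa [hx] using h v
  have hz0 : 0 < ‖z‖ := by
    rcases (norm_nonneg z).eq_or_lt with h0 | h0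
    · rw [← h0] at hnorm
      norm_num at hnorm
      linarith
    · exact h0
  have hu : ‖z‖⁻¹ • z ∈ Uᗮ := Submodule.smul_mem _ _ hres
  obtain ⟨ι, b, i₀, hi₀, hb⟩ := exists_adapted_basis_insert U (‖z‖⁻¹ • z) hu
    (by rw [norm_smul, norm_inv, norm_norm, inv_mul_cancel₀ hz0.ne'])
  have hzb : z = ‖z‖ • b i₀ := by rw [hi₀, smul_smul, mul_inv_cancel₀ hz0.ne', one_smul]
  have hcard : Fintype.card ι = n := by
    have := Module.finrank_eq_card_basis b.toBasis
    rw [finrank_euclideanSpace_fin] at this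
    exact this.symm
  have hxz : x = U.starProjection x + z := by rw [hz]; abel
  -- `μ` is its projection to `U` plus a multiple of `b i₀`, so its coordinates vanish in every
  -- other direction orthogonal to `U`. At most `|k| + 1` directions are left out.
  refine ⟨ι, b, i₀, Finset.univ.filter fun i => b i ∉ U ∧ i ≠ i₀, by simp, ?_, ?_, hi₀ ▸ hu, ?_, ?_,
    ?_⟩
  · have h1 := card_mem_le_finrank b U (Finset.univ.filter fun i => b i ∈ U) (by simp)
    have h2 := finrank_colSpace_le X k
    have h3 : (Finset.univ : Finset ι) ⊆ (Finset.univ.filter fun i => b i ∉ U ∧ i ≠ i₀) ∪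
        (Finset.univ.filter fun i => b i ∈ U) ∪ {i₀} := by
      intro i _
      simp only [Finset.mem_union, Finset.mem_filter, Finset.mem_univ, true_and,
        Finset.mem_singleton]
      tauto
    have h4 := (Finset.card_le_card h3).trans (Finset.card_union_le _ _)
    have h5 := Finset.card_union_le (Finset.univ.filter fun i => b i ∉ U ∧ i ≠ i₀)
      (Finset.univ.filter fun i => b i ∈ U)
    rw [Finset.card_univ, hcard, Finset.card_singleton] at h4
    rw [← hU] at h2
    omega
  · exact (Finset.card_le_univ _).trans hcard.le
  · intro i hi
    exact (hb i).resolve_left (Finset.mem_filter.1 hi).2.1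
  · have : coord b μ i₀ = ‖z‖ := by
      rw [coord, ← hx, hxz, inner_add_right,
        Submodule.inner_left_of_mem_orthogonal hP (hi₀ ▸ hu), zero_add]
      nth_rewrite 1 [hzb]
      rw [inner_smul_right, real_inner_self_eq_norm_sq, b.orthonormal.1]
      simp
    rwa [this]
  · intro i hi
    obtain ⟨-, h1, h2⟩ := Finset.mem_filter.1 hi
    rw [coord, ← hx, hxz, inner_add_right,
      Submodule.inner_left_of_mem_orthogonal hP ((hb i).resolve_left h1), zero_add, hzb,
      inner_smul_right, b.orthonormal.2 h2, mul_zero]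

/-- A product of one-variable integrals in which only the coordinates `i₀` and those in `R` carry a
weight. -/
theorem lintegral_isoDensity_mul_le {n : ℕ} {ι : Type*} [Fintype ι] [DecidableEq ι]
    (b : OrthonormalBasis ι ℝ (EuclideanSpace ℝ (Fin n))) (μ : Fin n → ℝ) {s : ℝ} (hs : 0 < s)
    {i₀ : ι} {R : Finset ι} (hi₀ : i₀ ∉ R) (g h : ℝ → ENNReal) (hg : Measurable g)
    (hh : Measurable h) {B C : ENNReal}
    (hB : ∫⁻ x, ENNReal.ofReal (normalDensity (coord b μ i₀) s x) * g x ≤ B)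
    (hC : ∀ i ∈ R, ∫⁻ x, ENNReal.ofReal (normalDensity (coord b μ i) s x) * h x ≤ C) :
    ∫⁻ y, ENNReal.ofReal (isoDensity μ s y) * (g (coord b y i₀) * ∏ i ∈ R, h (coord b y i)) ≤
      B * C ^ R.card := by
  let G : ι → ℝ → ENNReal := fun i => if i = i₀ then g else if i ∈ R then h else 1
  have hG : ∀ i, Measurable (G i) := by
    intro i
    simp only [G]
    split_ifs
    exacts [hg, hh, measurable_one]
  have e : ∀ a : ι → ENNReal, ∀ c : ι → ENNReal, ∏ i, (if i = i₀ then a i else if i ∈ R then c i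
      else 1) = a i₀ * ∏ i ∈ R, c i := by
    intro a c
    rw [← Finset.mul_prod_erase _ _ (Finset.mem_univ i₀), if_pos rfl]
    congr 1
    have hs : R ⊆ Finset.univ.erase i₀ := fun i hi =>
      Finset.mem_erase.2 ⟨fun h => hi₀ (h ▸ hi), Finset.mem_univ _⟩
    rw [← Finset.prod_subset hs]
    · refine Finset.prod_congr rfl fun i hi => ?_
      rw [if_neg (show i ≠ i₀ from fun h => hi₀ (h ▸ hi)), if_pos hi]
    · intro i hi hi'
      rw [if_neg (Finset.mem_erase.1 hi).1, if_neg hi']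
  calc _ = ∫⁻ y, ENNReal.ofReal (isoDensity μ s y) * ∏ i, G i (coord b y i) := by
        refine lintegral_congr fun y => ?_
        rw [← e (fun i => g (coord b y i)) fun i => h (coord b y i)]
        congr 1
        refine Finset.prod_congr rfl fun i _ => ?_
        simp only [G]
        split_ifs <;> rfl
    _ = ∏ i, ∫⁻ x, ENNReal.ofReal (normalDensity (coord b μ i) s x) * G i x :=
        lintegral_isoDensity_mul_prod b μ hs G hG
    _ ≤ ∏ i, (if i = i₀ then B else if i ∈ R then C else 1) := by
        refine Finset.prod_le_prod' fun i _ => ?_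
        simp only [G]
        split_ifs with h1 h2
        · rw [h1]
          exact hB
        · exact hC i h2
        · simp [lintegral_normalDensity _ hs]
    _ = _ := by rw [e (fun _ => B) fun _ => C, Finset.prod_const]

/-- Moments of order `s` of the ratio of the marginal density to the true density, for a model
whose columns are at squared distance at least `D` from the true mean. -/
theorem lintegral_ratio_rpow_le_of_dist {n p : ℕ} (r : ℕ) {α₁ α₂ : ℝ}
    (hα₁ : 0 < α₁) (hα₂ : 0 < α₂) (X : Matrix (Fin n) (Fin p) ℝ) {A : Matrix (Fin p) (Fin p) ℝ}
    (hA : A.IsHermitian) {a₁ a₂ : ℝ} (ha₁ : 0 < a₁) (ha₂ : 0 < a₂) (hq : QuadBounds A a₁ a₂)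
    (k : Finset (Fin p)) (hk : 2 * (k.card + 1) ≤ n) (μ : Fin n → ℝ) {s₀ : ℝ} (hs₀ : 0 < s₀)
    {D γ : ℝ} (hγ : 0 < γ) (hγ1 : γ ≤ 1) (hγD : γ * n ≤ D / (6 * s₀))
    (hD : ∀ v, D ≤ ∑ i, (μ i - (modelCols X k).mulVec v i) ^ 2) {θ : ℝ} (hθ0 : 0 < θ)
    (hθ1 : θ < 1) :
    ∫⁻ y, ENNReal.ofReal (isoDensity μ s₀ y) *
        (marginalDensity r α₁ α₂ X A k y / ENNReal.ofReal (isoDensity μ s₀ y)) ^ θ ≤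
      ENNReal.ofReal (massBound r a₁ a₂ ^ k.card) ^ θ *
        (ENNReal.ofReal (exp (1 / 2 - γ * n / 16)) ^ θ +
          ENNReal.ofReal (exp (-(γ * n / 2))) ^ (1 - θ)) := by
  classical
  have hn : 0 < n := by omega
  have hn' : (0 : ℝ) < n := by exact_mod_cast hn
  have hD0 : 0 < D := by
    by_contra hD0
    have : D / (6 * s₀) ≤ 0 := div_nonpos_of_nonpos_of_nonneg (not_lt.1 hD0) (by positivity)
    have : 0 < γ * n := by positivity
    linarith
  obtain ⟨ι, b, i₀, R, hi₀, hRn, hRle, hbi₀, hbR, hDi₀, hR0⟩ := exists_residual_basis X k μ hD0 hD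
  have hRhalf : (n : ℝ) / 2 ≤ R.card := by
    have : n ≤ 2 * R.card := by omega
    have : (n : ℝ) ≤ 2 * R.card := by exact_mod_cast this
    linarith
  have hRle' : (R.card : ℝ) ≤ n := by exact_mod_cast hRle
  -- Acceptance region of "the direction `b i₀` carries signal". It is invariant under scaling of
  -- the response, so the unknown variance of the model does not matter.
  let Φ : Set (Fin n → ℝ) := {y | γ * ∑ i ∈ R, coord b y i ^ 2 ≤ coord b y i₀ ^ 2}
  have hΦ : MeasurableSet Φ := measurableSet_le
    ((Finset.measurable_fun_sum _ fun i _ => (measurable_coord b i).pow_const 2).const_mul γ)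
    ((measurable_coord b i₀).pow_const 2)
  set f : (Fin n → ℝ) → ENNReal := fun y => ENNReal.ofReal (isoDensity μ s₀ y) with hf
  have hfm : Measurable f := (measurable_isoDensity μ s₀).ennreal_ofReal
  have hf0 : ∀ y, f y ≠ 0 := fun y => (ENNReal.ofReal_pos.2 (isoDensity_pos μ hs₀ y)).ne'
  have hft : ∀ y, f y ≠ ⊤ := fun y => ENNReal.ofReal_ne_top
  have hf1 : ∫⁻ y, f y = 1 := lintegral_isoDensity μ hs₀
  set m := marginalDensity r α₁ α₂ X A k with hm
  have hmm : Measurable m := measurable_marginalDensity r α₁ α₂ X A k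
  -- Under every member of the model, the coordinates `i₀` and `R` are centred normal variables with
  -- common variance `s`. Chernoff's bound with exponent `(y_{i₀}² - γ ∑ y_i²) / (4 s)` costs
  -- `e^(1/2)` for `i₀` and gains `γ/8` for each of the at least `n/2` directions in `R`.
  have key1 : ∫⁻ y, m y * Φ.indicator 1 y ≤ ENNReal.ofReal (massBound r a₁ a₂ ^ k.card) *
      ENNReal.ofReal (exp (1 / 2 - γ * n / 16)) := by
    refine lintegral_marginalDensity_mul_le_of_le hn r hα₁ hα₂ X hA ha₁ ha₂ hq k
      (measurable_one.indicator hΦ) _ fun s hs β => ?_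
    calc _ ≤ ∫⁻ y, ENNReal.ofReal (isoDensity ((modelCols X k).mulVec β) s y) *
          (ENNReal.ofReal (exp (1 * coord b y i₀ ^ 2 / (4 * s))) *
            ∏ i ∈ R, ENNReal.ofReal (exp (-(γ * coord b y i ^ 2) / (4 * s)))) := by
          refine lintegral_mono fun y => ?_
          rw [likelihood_eq_isoDensity]
          refine mul_le_mul_right (Set.indicator_apply_le' (fun hy => ?_) fun _ => zero_le) _
          rw [← ENNReal.ofReal_prod_of_nonneg fun i _ => (exp_pos _).le, ← exp_sum,
            ← ENNReal.ofReal_mul (exp_pos _).le, ← exp_add, Pi.one_apply, ENNReal.one_le_ofReal,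
            one_le_exp_iff, ← Finset.sum_div, ← add_div, Finset.sum_neg_distrib, ← Finset.mul_sum]
          have : γ * ∑ i ∈ R, coord b y i ^ 2 ≤ coord b y i₀ ^ 2 := hy
          exact div_nonneg (by linarith) (by positivity)
      _ ≤ ENNReal.ofReal (exp (1 / 2)) * ENNReal.ofReal (exp (-γ / 8)) ^ R.card := by
          refine lintegral_isoDensity_mul_le b _ hs hi₀
            (fun x => ENNReal.ofReal (exp (1 * x ^ 2 / (4 * s))))
            (fun x => ENNReal.ofReal (exp (-(γ * x ^ 2) / (4 * s)))) (by fun_prop) (by fun_prop)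
            ?_ fun i hi => ?_
          · rw [coord_mulVec_eq_zero b hbi₀]
            exact lintegral_normalDensity_mul_exp_le hs one_pos le_rfl
          · rw [coord_mulVec_eq_zero b (hbR i hi)]
            exact lintegral_normalDensity_mul_exp_neg_le hs hγ hγ1
      _ ≤ _ := by
          rw [← ENNReal.ofReal_pow (exp_pos _).le, ← exp_nat_mul,
            ← ENNReal.ofReal_mul (exp_pos _).le, ← exp_add]
          apply ENNReal.ofReal_le_ofReal
          apply exp_le_exp.2
          nlinarith
  -- Chernoff's bound under the truth. The coordinate `i₀` has squared mean at least `D`, and adding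
  -- the variance `2 s₀` of the weight to `s₀` gives the gain `D / (6 s₀) ≥ γ n`. The directions in
  -- `R` cost at most `γ n / 2` together.
  have key2 : ∫⁻ y, f y * Φᶜ.indicator 1 y ≤ ENNReal.ofReal (exp (-(γ * n / 2))) := by
    calc _ ≤ ∫⁻ y, ENNReal.ofReal (isoDensity μ s₀ y) *
          (ENNReal.ofReal (exp (-(coord b y i₀ - 0) ^ 2 / (2 * (2 * s₀)))) *
            ∏ i ∈ R, ENNReal.ofReal (exp (γ * coord b y i ^ 2 / (4 * s₀)))) := by
          refine lintegral_mono fun y => ?_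
          refine mul_le_mul_right (Set.indicator_apply_le' (fun hy => ?_) fun _ => zero_le) _
          rw [← ENNReal.ofReal_prod_of_nonneg fun i _ => (exp_pos _).le, ← exp_sum,
            ← ENNReal.ofReal_mul (exp_pos _).le, ← exp_add, Pi.one_apply, ENNReal.one_le_ofReal,
            one_le_exp_iff, ← Finset.sum_div, ← Finset.mul_sum, sub_zero]
          have : coord b y i₀ ^ 2 < γ * ∑ i ∈ R, coord b y i ^ 2 := not_le.1 hy
          rw [← mul_assoc, show (2 : ℝ) * 2 = 4 by norm_num, ← add_div]
          exact div_nonneg (by linarith) (by positivity)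
      _ ≤ ENNReal.ofReal (exp (-D / (6 * s₀))) * ENNReal.ofReal (exp (γ / 2)) ^ R.card := by
          refine lintegral_isoDensity_mul_le b _ hs₀ hi₀
            (fun x => ENNReal.ofReal (exp (-(x - 0) ^ 2 / (2 * (2 * s₀)))))
            (fun x => ENNReal.ofReal (exp (γ * x ^ 2 / (4 * s₀)))) (by fun_prop) (by fun_prop)
            ?_ fun i hi => ?_
          · rw [lintegral_normalDensity_mul_exp_neg _ _ hs₀ (by positivity)]
            apply ENNReal.ofReal_le_ofReal
            have h1 : √(2 * s₀ / (s₀ + 2 * s₀)) ≤ 1 := by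
              rw [sqrt_le_one]
              rw [div_le_one (by positivity)]
              linarith
            have h2 : exp (-(coord b μ i₀ - 0) ^ 2 / (2 * (s₀ + 2 * s₀))) ≤
                exp (-D / (6 * s₀)) := by
              rw [sub_zero, show 2 * (s₀ + 2 * s₀) = 6 * s₀ by ring]
              gcongr
            calc _ ≤ 1 * exp (-D / (6 * s₀)) := by gcongr
              _ = _ := one_mul _
          · rw [hR0 i hi]
            exact lintegral_normalDensity_mul_exp_le hs₀ hγ hγ1
      _ ≤ _ := by
          rw [← ENNReal.ofReal_pow (exp_pos _).le, ← exp_nat_mul,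
            ← ENNReal.ofReal_mul (exp_pos _).le, ← exp_add]
          apply ENNReal.ofReal_le_ofReal
          apply exp_le_exp.2
          rw [neg_div]
          nlinarith
  have key3 : ∫⁻ y, m y * 1 ≤ ENNReal.ofReal (massBound r a₁ a₂ ^ k.card) := by
    have := lintegral_marginalDensity_mul_le_of_le hn r hα₁ hα₂ X hA ha₁ ha₂ hq k
      (w := fun _ => 1) measurable_const 1 fun s hs β => ?_
    · simpa using this
    · have := lintegral_isoDensity_mul_prod b ((modelCols X k).mulVec β) hs (fun _ => 1)
        fun _ => measurable_one
      simp only [likelihood_eq_isoDensity]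
      simpa [lintegral_normalDensity _ hs] using this.le
  have h1θ : 0 < 1 - θ := by linarith
  calc ∫⁻ y, f y * (m y / f y) ^ θ
      = ∫⁻ y, (f y * (m y / f y) ^ θ * ((Φ.indicator 1 y) ^ θ * (1 : ENNReal) ^ (1 - θ)) +
        f y * (m y / f y) ^ θ * ((1 : ENNReal) ^ θ * (Φᶜ.indicator 1 y) ^ (1 - θ))) := by
        -- The indicator goes into the factor of the model on `Φ` and into that of the truth on its
        -- complement. An indicator survives the powers unchanged since `θ` and `1 - θ` are both
        -- positive.
        refine lintegral_congr fun y => ?_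
        by_cases hy : y ∈ Φ
        · simp [hy, ENNReal.zero_rpow_of_pos h1θ]
        · simp [hy, ENNReal.zero_rpow_of_pos hθ0]
    _ = (∫⁻ y, f y * (m y / f y) ^ θ * ((Φ.indicator 1 y) ^ θ * (1 : ENNReal) ^ (1 - θ))) +
        ∫⁻ y, f y * (m y / f y) ^ θ * ((1 : ENNReal) ^ θ * (Φᶜ.indicator 1 y) ^ (1 - θ)) := by
        refine lintegral_add_left ?_ _
        have : Measurable (Φ.indicator (1 : (Fin n → ℝ) → ENNReal)) :=
          measurable_one.indicator hΦ
        fun_prop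
    _ ≤ (∫⁻ y, m y * Φ.indicator 1 y) ^ θ * (∫⁻ y, f y * 1) ^ (1 - θ) +
        (∫⁻ y, m y * 1) ^ θ * (∫⁻ y, f y * Φᶜ.indicator 1 y) ^ (1 - θ) :=
        add_le_add (lintegral_mul_div_rpow_le hfm hmm (measurable_one.indicator hΦ)
          measurable_const hf0 hft hθ0 hθ1)
          (lintegral_mul_div_rpow_le hfm hmm measurable_const (measurable_one.indicator hΦ.compl)
            hf0 hft hθ0 hθ1)
    _ ≤ (ENNReal.ofReal (massBound r a₁ a₂ ^ k.card) *
          ENNReal.ofReal (exp (1 / 2 - γ * n / 16))) ^ θ * 1 ^ (1 - θ) +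
        ENNReal.ofReal (massBound r a₁ a₂ ^ k.card) ^ θ *
          ENNReal.ofReal (exp (-(γ * n / 2))) ^ (1 - θ) := by
        simp only [mul_one] at key3 ⊢
        rw [hf1]
        gcongr
    _ = _ := by
        rw [ENNReal.one_rpow, mul_one, ENNReal.mul_rpow_of_nonneg _ _ hθ0.le, mul_add]
-- Models that contain the true one: Gaussian tilts and the moment prior.
theorem lintegral_normalDensity_mul_exp_sub_le (m : ℝ) {s : ℝ} (hs : 0 < s) :
    ∫⁻ x, ENNReal.ofReal (normalDensity m s x) *
      ENNReal.ofReal (exp ((x - m) ^ 2 / (4 * s))) ≤ ENNReal.ofReal (exp (1 / 2)) := by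
  have h := lintegral_normalDensity_mul_exp_le hs one_pos le_rfl
  rw [← lintegral_sub_right_eq_self _ m] at h
  simpa [normalDensity] using h

/-- Sum of the squared differences of the coordinates of `y` and `μ` that belong to `I`. -/
noncomputable def coordDist {n : ℕ} {ι : Type*} [Fintype ι]
    (b : OrthonormalBasis ι ℝ (EuclideanSpace ℝ (Fin n))) (I : Finset ι) (μ y : Fin n → ℝ) : ℝ :=
  ∑ i ∈ I, (coord b y i - coord b μ i) ^ 2

theorem measurable_coordDist {n : ℕ} {ι : Type*} [Fintype ι]
    (b : OrthonormalBasis ι ℝ (EuclideanSpace ℝ (Fin n))) (I : Finset ι) (μ : Fin n → ℝ) :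
    Measurable (coordDist b I μ) :=
  Finset.measurable_fun_sum _ fun i _ => ((measurable_coord b i).sub_const _).pow_const 2

/-- Only the coordinates in `I` are tilted, so the price is `e^(1/2)` per element of `I`, whatever
the dimension `n`. -/
theorem lintegral_isoDensity_mul_exp_coordDist_le {n : ℕ} {ι : Type*} [Fintype ι]
    (b : OrthonormalBasis ι ℝ (EuclideanSpace ℝ (Fin n))) (I : Finset ι) (μ : Fin n → ℝ) {s : ℝ}
    (hs : 0 < s) :
    ∫⁻ y, ENNReal.ofReal (isoDensity μ s y) *
      ENNReal.ofReal (exp (coordDist b I μ y / (4 * s))) ≤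
        ENNReal.ofReal (exp (1 / 2)) ^ I.card := by
  classical
  have h := lintegral_isoDensity_mul_prod b μ hs (fun i x =>
    if i ∈ I then ENNReal.ofReal (exp ((x - coord b μ i) ^ 2 / (4 * s))) else 1) fun i => by
      split_ifs <;> fun_prop
  simp_rw [Finset.prod_ite_mem, Finset.univ_inter] at h
  have e : ∀ y, ENNReal.ofReal (exp (coordDist b I μ y / (4 * s))) =
      ∏ i ∈ I, ENNReal.ofReal (exp ((coord b y i - coord b μ i) ^ 2 / (4 * s))) := fun y => by
    rw [coordDist, Finset.sum_div, exp_sum, ENNReal.ofReal_prod_of_nonneg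
      fun i _ => (exp_pos _).le]
  simp_rw [e]
  rw [h]
  calc _ ≤ ∏ i, (if i ∈ I then ENNReal.ofReal (exp (1 / 2)) else 1) := by
        refine Finset.prod_le_prod' fun i _ => ?_
        split_ifs
        · exact lintegral_normalDensity_mul_exp_sub_le _ hs
        · simp [lintegral_normalDensity _ hs]
    _ = _ := by rw [Finset.prod_ite_mem, Finset.univ_inter, Finset.prod_const]

theorem lintegral_isoDensity_mul_exp_neg_coordDist_le {n : ℕ} {ι : Type*} [Fintype ι]
    (b : OrthonormalBasis ι ℝ (EuclideanSpace ℝ (Fin n))) (I : Finset ι) (μ ν : Fin n → ℝ)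
    {s B : ℝ} (hs : 0 < s) (hB : 0 < B) :
    ∫⁻ y, ENNReal.ofReal (isoDensity ν s y) *
      ENNReal.ofReal (exp (-coordDist b I μ y / (2 * B))) ≤
        ENNReal.ofReal (exp (-coordDist b I μ ν / (2 * (s + B)))) := by
  classical
  have h := lintegral_isoDensity_mul_prod b ν hs (fun i x =>
    if i ∈ I then ENNReal.ofReal (exp (-(x - coord b μ i) ^ 2 / (2 * B))) else 1) fun i => by
      split_ifs <;> fun_prop
  have e : ∀ (c : ℝ) (z : Fin n → ℝ), ENNReal.ofReal (exp (-coordDist b I μ z / c)) =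
      ∏ i, if i ∈ I then ENNReal.ofReal (exp (-(coord b z i - coord b μ i) ^ 2 / c)) else 1 := by
    intro c z
    rw [Finset.prod_ite_mem, Finset.univ_inter, ← ENNReal.ofReal_prod_of_nonneg
      fun i _ => (exp_pos _).le, ← exp_sum, coordDist, ← Finset.sum_div, Finset.sum_neg_distrib]
  simp_rw [e]
  rw [h]
  refine Finset.prod_le_prod' fun i _ => ?_
  split_ifs
  · rw [lintegral_normalDensity_mul_exp_neg _ _ hs hB]
    apply ENNReal.ofReal_le_ofReal
    have h1 : √(B / (s + B)) ≤ 1 := by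
      rw [sqrt_le_one, div_le_one (by positivity)]
      linarith
    exact mul_le_of_le_one_left (exp_pos _).le h1
  · simp [lintegral_normalDensity _ hs]

/-- Giving up half of the exponential turns the density into `2^a` times the inverse-gamma density
of scale `b/2`. This is what remains after powers of `1/x` have been traded for `exp (b/2/x)`. -/
theorem lintegral_invGammaDensity_mul_exp {a b : ℝ} (ha : 0 < a) (hb : 0 < b) :
    ∫⁻ x in Set.Ioi (0 : ℝ), ENNReal.ofReal (invGammaDensity a b x) *
      ENNReal.ofReal (exp (b / 2 / x)) = ENNReal.ofReal (2 ^ a) := by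
  have hG := Gamma_pos_of_pos ha
  have hb2 : 0 < b / 2 := by positivity
  have e : ∀ x ∈ Set.Ioi (0 : ℝ), ENNReal.ofReal (invGammaDensity a b x) *
      ENNReal.ofReal (exp (b / 2 / x)) =
      ENNReal.ofReal (2 ^ a) * ENNReal.ofReal (invGammaDensity a (b / 2) x) := by
    intro x hx
    have hx : 0 < x := hx
    rw [← ENNReal.ofReal_mul (invGammaDensity_nonneg ha hb hx),
      ← ENNReal.ofReal_mul (by positivity)]
    congr 1
    unfold invGammaDensity
    rw [mul_assoc, ← exp_add, show -b / x + b / 2 / x = -(b / 2) / x by field_simp; ring,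
      div_rpow hb.le zero_le_two]
    field_simp
  rw [setLIntegral_congr_fun measurableSet_Ioi e,
    lintegral_const_mul _ (measurable_invGammaDensity _ _).ennreal_ofReal,
    lintegral_invGammaDensity ha hb2, mul_one]

/-- The integral over the coefficients of the pMOM density against a Gaussian weight centred at
the true coefficients `b₀`, of which at most `T` are nonzero. -/
theorem lintegral_pMOMDensity_mul_exp_le {p : ℕ} (r : ℕ) {A : Matrix (Fin p) (Fin p) ℝ}
    (hA : A.IsHermitian) {a₁ a₂ : ℝ} (ha₁ : 0 < a₁) (ha₂ : 0 < a₂) (h : QuadBounds A a₁ a₂)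
    (k : Finset (Fin p)) (b₀ : k → ℝ) {M : ℝ} (hM : ∀ i, |b₀ i| ≤ M)
    {τ s S N : ℝ} (hτ : 0 < τ) (hs : 0 < s) (hS : 0 < S) (hN : 1 ≤ N) :
    ∫⁻ β : k → ℝ, ENNReal.ofReal (pMOMDensity r A k τ s β) *
        ENNReal.ofReal (exp (-(N * ∑ i, (β i - b₀ i) ^ 2) / (2 * S))) ≤
      ENNReal.ofReal ((((gaussMoment r)⁻¹ * a₂ ^ ((r : ℝ) + 1 / 2) *
        (4 ^ r * (M ^ (2 * r) * √(2 * π) + gaussMoment r))) *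
          ((τ * s) ^ (-((r : ℝ) + 1 / 2)) * (1 + S) ^ ((r : ℝ) + 1 / 2))) ^ k.card *
        ((N ^ (-((r : ℝ) + 1 / 2))) ^ (Finset.univ.filter fun i => b₀ i = 0).card *
          (N ^ (-(1 / 2) : ℝ)) ^ (Finset.univ.filter fun i => b₀ i ≠ 0).card)) := by
  classical
  have hG := gaussMoment_pos r
  have hN0 : 0 < N := by linarith
  set ρ : ℝ := (r : ℝ) + 1 / 2 with hρ
  have hρ0 : 0 < ρ := by positivity
  set c := (gaussMoment r)⁻¹ * a₂ ^ ρ * (τ * s) ^ (-ρ) with hc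
  have hc0 : 0 < c := by positivity
  set C₁ := 4 ^ r * (M ^ (2 * r) * √(2 * π) + gaussMoment r) with hC₁
  have hM2 : 0 ≤ M ^ (2 * r) := even_pow_nonneg _ _
  have hAv : 0 < S / N := by positivity
  have hSρ : S ^ ρ ≤ (1 + S) ^ ρ := by gcongr; linarith
  have hSN : (S / N) ^ ρ = S ^ ρ * N ^ (-ρ) := by
    rw [div_rpow hS.le hN0.le, rpow_neg hN0.le, div_eq_mul_inv]
  have h4 : (1 : ℝ) ≤ 4 ^ r := one_le_pow₀ (by norm_num)
  have hGC : gaussMoment r ≤ C₁ := by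
    have : gaussMoment r ≤ M ^ (2 * r) * √(2 * π) + gaussMoment r := by
      have : 0 ≤ M ^ (2 * r) * √(2 * π) := by positivity
      linarith
    calc gaussMoment r ≤ 1 * (M ^ (2 * r) * √(2 * π) + gaussMoment r) := by linarith
      _ ≤ C₁ := by rw [hC₁]; gcongr
  have one : ∀ i, ∫⁻ x, ENNReal.ofReal c *
      ENNReal.ofReal (x ^ (2 * r) * exp (-(x - b₀ i) ^ 2 / (2 * (S / N)))) ≤
        ENNReal.ofReal (c * C₁ * (1 + S) ^ ρ *
          if b₀ i = 0 then N ^ (-ρ) else N ^ (-(1 / 2) : ℝ)) := by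
    intro i
    rw [lintegral_const_mul _ (by fun_prop)]
    -- A zero coefficient meets `x^(2r)` centred at its zero and gains `N^(-r)` beyond the Gaussian
    -- width. A nonzero one has only the width `N^(-1/2)`.
    split_ifs with hi
    · simp only [hi, sub_zero]
      rw [lintegral_pow_mul_exp r hAv, ← ENNReal.ofReal_mul hc0.le, ← hρ, hSN]
      apply ENNReal.ofReal_le_ofReal
      rw [mul_assoc c, mul_assoc c, mul_assoc C₁]
      gcongr
    · refine (mul_le_mul_right (lintegral_pow_mul_exp_sub_le r hAv (b₀ i)) _).trans ?_
      rw [← ENNReal.ofReal_mul hc0.le, ← hρ, hSN]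
      apply ENNReal.ofReal_le_ofReal
      have e1 : (b₀ i) ^ (2 * r) ≤ M ^ (2 * r) := by
        rw [← (even_two_mul r).pow_abs]
        gcongr
        exact hM i
      have e2 : √(2 * π * (S / N)) ≤ √(2 * π) * ((1 + S) ^ ρ * N ^ (-(1 / 2) : ℝ)) := by
        rw [sqrt_mul (x := 2 * π) (by positivity), sqrt_eq_rpow (S / N), div_rpow hS.le hN0.le,
          rpow_neg hN0.le, div_eq_mul_inv]
        gcongr
        calc S ^ (1 / 2 : ℝ) ≤ (1 + S) ^ (1 / 2 : ℝ) := by gcongr; linarith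
          _ ≤ (1 + S) ^ ρ := by
            apply rpow_le_rpow_of_exponent_le (by linarith)
            rw [hρ]
            have : (0 : ℝ) ≤ r := by positivity
            linarith
      have e3 : N ^ (-ρ) ≤ N ^ (-(1 / 2) : ℝ) := by
        apply rpow_le_rpow_of_exponent_le hN
        rw [hρ]
        have : (0 : ℝ) ≤ r := by positivity
        linarith
      calc c * (4 ^ r * (b₀ i ^ (2 * r) * √(2 * π * (S / N)) +
            gaussMoment r * (S ^ ρ * N ^ (-ρ))))
          ≤ c * (4 ^ r * (M ^ (2 * r) * (√(2 * π) * ((1 + S) ^ ρ * N ^ (-(1 / 2) : ℝ))) +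
            gaussMoment r * ((1 + S) ^ ρ * N ^ (-(1 / 2) : ℝ)))) := by gcongr
        _ = _ := by rw [hC₁]; ring
  calc _ ≤ ∫⁻ β : k → ℝ, ∏ i, (ENNReal.ofReal c *
        ENNReal.ofReal (β i ^ (2 * r) * exp (-(β i - b₀ i) ^ 2 / (2 * (S / N))))) := by
        refine lintegral_mono fun β => ?_
        rw [← ENNReal.ofReal_mul (pMOMDensity_nonneg r hA ha₁ ha₂ h k hτ hs β)]
        simp_rw [← ENNReal.ofReal_mul hc0.le]
        rw [← ENNReal.ofReal_prod_of_nonneg fun i _ =>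
          mul_nonneg hc0.le (mul_nonneg (even_pow_nonneg _ _) (exp_pos _).le)]
        apply ENNReal.ofReal_le_ofReal
        have e1 : exp (-(N * ∑ i, (β i - b₀ i) ^ 2) / (2 * S)) =
            ∏ i, exp (-(β i - b₀ i) ^ 2 / (2 * (S / N))) := by
          rw [← exp_sum]
          congr 1
          rw [← Finset.sum_div, Finset.sum_neg_distrib]
          field_simp
        rw [e1]
        refine (mul_le_mul_of_nonneg_right (pMOMDensity_bounds r hA ha₁ ha₂ h k hτ hs β).2
          (Finset.prod_nonneg fun i _ => (exp_pos _).le)).trans ?_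
        rw [← Finset.prod_mul_distrib]
        refine Finset.prod_le_prod (fun i _ => ?_) fun i _ => ?_
        · have := even_pow_nonneg (β i) r
          positivity
        · rw [← hρ, ← hc, mul_assoc c]
          -- The Gaussian factor of the prior is discarded; the localization comes from the weight
          -- centred at `b₀`.
          have e2 : exp (-β i ^ 2 / (2 * (τ * s / a₁))) ≤ 1 := by
            rw [exp_le_one_iff, neg_div]
            exact neg_nonpos.2 (by positivity)
          have := even_pow_nonneg (β i) r
          gcongr
          exact mul_le_of_le_one_right this e2
    _ = ∏ i, ∫⁻ x, ENNReal.ofReal c *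
        ENNReal.ofReal (x ^ (2 * r) * exp (-(x - b₀ i) ^ 2 / (2 * (S / N)))) :=
        lintegral_pi_prod (fun i x => ENNReal.ofReal c *
          ENNReal.ofReal (x ^ (2 * r) * exp (-(x - b₀ i) ^ 2 / (2 * (S / N))))) fun i => by fun_prop
    _ ≤ ∏ i : k, ENNReal.ofReal (c * C₁ * (1 + S) ^ ρ *
          if b₀ i = 0 then N ^ (-ρ) else N ^ (-(1 / 2) : ℝ)) :=
        Finset.prod_le_prod' fun i _ => one i
    _ = _ := by
        rw [← ENNReal.ofReal_prod_of_nonneg]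
        · congr 1
          rw [Finset.prod_mul_distrib, Finset.prod_const, Finset.prod_ite, Finset.prod_const,
            Finset.prod_const, Finset.card_univ, Fintype.card_coe, hc]
          congr 2
          ring
        · intro i _
          split_ifs <;> positivity
/-- Integral of the marginal density against a Gaussian weight centred at a mean `X_k b₀` in the
model. -/
theorem lintegral_marginalDensity_mul_exp_le {n p : ℕ} (hn : 0 < n) (r : ℕ) {α₁ α₂ : ℝ}
    (hα₁ : 0 < α₁) (hα₂ : 0 < α₂) {X : Matrix (Fin n) (Fin p) ℝ} {A : Matrix (Fin p) (Fin p) ℝ}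
    (hA : A.IsHermitian) {a₁ a₂ : ℝ} (ha₁ : 0 < a₁) (ha₂ : 0 < a₂) (hq : QuadBounds A a₁ a₂)
    {k : Finset (Fin p)} {ε : ℝ} (hX : DesignBounds X k ε) (hε : 1 ≤ n * ε) (b₀ : k → ℝ)
    {M : ℝ} (hM : ∀ i, |b₀ i| ≤ M) {B : ℝ} (hB : 0 < B) {ι : Type*} [Fintype ι]
    (b : OrthonormalBasis ι ℝ (EuclideanSpace ℝ (Fin n))) (I : Finset ι)
    (hI : ∀ i ∉ I, b i ∈ (colSpace X k)ᗮ) {m : ℝ} (hm : m = ((r : ℝ) + 1 / 2) * k.card) :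
    ∫⁻ y, marginalDensity r α₁ α₂ X A k y *
        ENNReal.ofReal (exp (-coordDist b I ((modelCols X k).mulVec b₀) y / (2 * B))) ≤
      ENNReal.ofReal ((((gaussMoment r)⁻¹ * a₂ ^ ((r : ℝ) + 1 / 2) *
        (4 ^ r * (M ^ (2 * r) * √(2 * π) + gaussMoment r))) * (1 + B) ^ ((r : ℝ) + 1 / 2)) ^
          k.card *
        (((n * ε) ^ (-((r : ℝ) + 1 / 2))) ^ (Finset.univ.filter fun i => b₀ i = 0).card *
          ((n * ε) ^ (-(1 / 2) : ℝ)) ^ (Finset.univ.filter fun i => b₀ i ≠ 0).card) *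
        ((4 / n) ^ m * m ^ m) * ((2 / α₂) ^ m * m ^ m * exp (α₂ / 2)) *
          (2 ^ (1 / 2 : ℝ) * 2 ^ α₁)) := by
  classical
  have hG := gaussMoment_pos r
  have hn' : (0 : ℝ) < n := by exact_mod_cast hn
  have hN0 : 0 < n * ε := by linarith
  set ρ : ℝ := (r : ℝ) + 1 / 2 with hρ
  have hρ0 : 0 < ρ := by positivity
  have hm0 : 0 ≤ m := by rw [hm]; positivity
  set K₁ := (gaussMoment r)⁻¹ * a₂ ^ ρ * (4 ^ r * (M ^ (2 * r) * √(2 * π) + gaussMoment r)) with hK₁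
  have hM2 : 0 ≤ M ^ (2 * r) := even_pow_nonneg _ _
  have hK₁0 : 0 ≤ K₁ := by positivity
  set ν := ((n * ε) ^ (-ρ)) ^ (Finset.univ.filter fun i => b₀ i = 0).card *
    ((n * ε) ^ (-(1 / 2) : ℝ)) ^ (Finset.univ.filter fun i => b₀ i ≠ 0).card with hν
  have hν0 : 0 ≤ ν := by positivity
  have hmm0 : 0 ≤ m ^ m := by positivity
  set E₁ := (4 / n : ℝ) ^ m * m ^ m with hE₁
  set E₂ := (2 / α₂) ^ m * m ^ m * exp (α₂ / 2) with hE₂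
  have hE₁0 : 0 ≤ E₁ := by positivity
  have hE₂0 : 0 ≤ E₂ := by positivity
  have hpow : ∀ x : ℝ, 0 ≤ x → (x ^ ρ) ^ k.card = x ^ m := fun x hx => by
    rw [← rpow_natCast, ← rpow_mul hx, hm]
  -- The scale `n/2` of the prior on `τ` enters here: a power `m` of `1/τ` costs `(4/n)^m m^m` and
  -- half of the exponent of the inverse-gamma density.
  have hτb : ∀ τ : ℝ, 0 < τ → (τ⁻¹ ^ ρ) ^ k.card ≤ E₁ * exp (n / 2 / 2 / τ) := by
    intro τ hτ
    have h1 := rpow_le_rpow_self_mul_exp (x := n / 2 / 2 / τ) (by positivity) hm0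
    calc (τ⁻¹ ^ ρ) ^ k.card = (4 / n * (n / 2 / 2 / τ)) ^ m := by
          rw [hpow _ (by positivity)]
          congr 1
          field_simp
          norm_num
      _ = (4 / n : ℝ) ^ m * (n / 2 / 2 / τ) ^ m := mul_rpow (by positivity) (by positivity)
      _ ≤ (4 / n : ℝ) ^ m * (m ^ m * exp (n / 2 / 2 / τ)) := by gcongr
      _ = _ := by rw [hE₁]; ring
  have hsb : ∀ s : ℝ, 0 < s → ((1 + 1 / s) ^ ρ) ^ k.card ≤ E₂ * exp (α₂ / 2 / s) := by
    intro s hs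
    have h1 := rpow_le_rpow_self_mul_exp (x := α₂ / 2 * (1 + 1 / s)) (by positivity) hm0
    calc ((1 + 1 / s) ^ ρ) ^ k.card = (2 / α₂ * (α₂ / 2 * (1 + 1 / s))) ^ m := by
          rw [hpow _ (by positivity)]
          congr 1
          field_simp
      _ = (2 / α₂) ^ m * (α₂ / 2 * (1 + 1 / s)) ^ m := mul_rpow (by positivity) (by positivity)
      _ ≤ (2 / α₂) ^ m * (m ^ m * exp (α₂ / 2 * (1 + 1 / s))) := by gcongr
      _ = (2 / α₂) ^ m * (m ^ m * (exp (α₂ / 2) * exp (α₂ / 2 / s))) := by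
          rw [← exp_add]
          congr 3
          ring
      _ = _ := by rw [hE₂]; ring
  have hB1 : ∀ s, 0 < s → ∀ β : k → ℝ,
      ∫⁻ y, ENNReal.ofReal (likelihood X k β s y) *
        ENNReal.ofReal (exp (-coordDist b I ((modelCols X k).mulVec b₀) y / (2 * B))) ≤
      ENNReal.ofReal (exp (-(n * ε * ∑ i, (β i - b₀ i) ^ 2) / (2 * (s + B)))) := by
    intro s hs β
    simp_rw [likelihood_eq_isoDensity]
    refine (lintegral_isoDensity_mul_exp_neg_coordDist_le b I _ _ hs hB).trans ?_
    apply ENNReal.ofReal_le_ofReal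
    -- `X_k (β - b₀)` has no coordinates outside `I`, so the distance measured in `I` is the whole
    -- norm, to which the design bound applies.
    have h1 : n * ε * ∑ i, (β i - b₀ i) ^ 2 ≤
        coordDist b I ((modelCols X k).mulVec b₀) ((modelCols X k).mulVec β) := by
      have h2 := (hX (β - b₀)).1
      rw [← sum_coord_sq b] at h2
      refine h2.trans (le_of_eq ?_)
      rw [coordDist]
      simp_rw [← coord_sub, ← Matrix.mulVec_sub]
      refine (Finset.sum_subset (Finset.subset_univ I) fun i _ hi => ?_).symm
      rw [coord_mulVec_eq_zero b (hI i hi), zero_pow two_ne_zero]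
    gcongr
  refine (lintegral_marginalDensity_mul_le hn r hα₁ hα₂ X hA ha₁ ha₂ hq k
    (measurable_coordDist b I _ |>.neg.div_const _ |>.exp.ennreal_ofReal)
    (fun s β => ENNReal.ofReal (exp (-(n * ε * ∑ i, (β i - b₀ i) ^ 2) / (2 * (s + B))))) hB1
    (fun τ s => ENNReal.ofReal ((K₁ * (1 + B) ^ ρ) ^ k.card * ν * E₁ * E₂) *
      (ENNReal.ofReal (exp (n / 2 / 2 / τ)) * ENNReal.ofReal (exp (α₂ / 2 / s)))) ?_).trans ?_
  · intro τ s hτ hs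
    refine (lintegral_pMOMDensity_mul_exp_le r hA ha₁ ha₂ hq k b₀ hM hτ hs
      (by positivity) hε).trans ?_
    rw [← hρ, ← hK₁, ← hν, ← ENNReal.ofReal_mul (exp_pos _).le,
      ← ENNReal.ofReal_mul (by positivity)]
    clear_value ν K₁ E₁ E₂
    apply ENNReal.ofReal_le_ofReal
    -- Separates `τ` from `s`; the growth in `s` of the variance `s + B` is cancelled by the prior
    -- scale, leaving a bounded function for large `s`.
    have h1 : (τ * s) ^ (-ρ) * (1 + (s + B)) ^ ρ ≤ (1 + B) ^ ρ * τ⁻¹ ^ ρ * (1 + 1 / s) ^ ρ := by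
      rw [rpow_neg (by positivity), ← inv_rpow (by positivity), ← mul_rpow (by positivity)
        (by positivity), ← mul_rpow (by positivity) (by positivity), ← mul_rpow (by positivity)
        (by positivity)]
      apply rpow_le_rpow (by positivity) _ hρ0.le
      have : (1 + B) * τ⁻¹ * (1 + 1 / s) - (τ * s)⁻¹ * (1 + (s + B)) = B * τ⁻¹ := by
        field_simp
        ring
      have : 0 < B * τ⁻¹ := by positivity
      linarith
    calc (K₁ * ((τ * s) ^ (-ρ) * (1 + (s + B)) ^ ρ)) ^ k.card * ν
        ≤ (K₁ * ((1 + B) ^ ρ * τ⁻¹ ^ ρ * (1 + 1 / s) ^ ρ)) ^ k.card * ν := by gcongr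
      _ = (K₁ * (1 + B) ^ ρ) ^ k.card * ν * (τ⁻¹ ^ ρ) ^ k.card * ((1 + 1 / s) ^ ρ) ^ k.card := by
          rw [← mul_assoc, ← mul_assoc, mul_pow, mul_pow]
          ring
      _ ≤ (K₁ * (1 + B) ^ ρ) ^ k.card * ν * (E₁ * exp (n / 2 / 2 / τ)) *
            (E₂ * exp (α₂ / 2 / s)) := by
          have := hτb τ hτ
          have := hsb s hs
          gcongr
      _ = _ := by ring
  · have m1 := (measurable_invGammaDensity α₁ α₂).ennreal_ofReal
    have m2 := (measurable_invGammaDensity (1 / 2) ((n : ℝ) / 2)).ennreal_ofReal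
    have e1 := lintegral_invGammaDensity_mul_exp hα₁ hα₂
    have e2 := lintegral_invGammaDensity_mul_exp (a := 1 / 2) (b := (n : ℝ) / 2) (by norm_num)
      (by positivity)
    refine le_of_eq ?_
    set c := ENNReal.ofReal ((K₁ * (1 + B) ^ ρ) ^ k.card * ν * E₁ * E₂) with hc
    calc _ = ∫⁻ τ in Set.Ioi (0 : ℝ), (c * ENNReal.ofReal (2 ^ α₁)) *
          (ENNReal.ofReal (invGammaDensity (1 / 2) ((n : ℝ) / 2) τ) *
            ENNReal.ofReal (exp (n / 2 / 2 / τ))) := by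
          refine lintegral_congr fun τ => ?_
          rw [← e1, ← lintegral_const_mul' _ _ ENNReal.ofReal_ne_top,
            ← lintegral_const_mul' _ _ (by finiteness : c ≠ ⊤),
            ← lintegral_mul_const _ (by fun_prop)]
          refine lintegral_congr fun s => ?_
          ring
      _ = _ := by
          rw [lintegral_const_mul _ (by fun_prop), e2, hc, ← ENNReal.ofReal_mul (by positivity),
            ← ENNReal.ofReal_mul (by positivity)]
          congr 1
          ring

/-- Moments of order `θ` of the ratio of the marginal density to the true density, for a model
that contains the true one. -/
theorem exists_lintegral_ratio_rpow_le_of_mem (r : ℕ) {α₁ α₂ : ℝ} (hα₁ : 0 < α₁) (hα₂ : 0 < α₂)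
    {a₁ a₂ : ℝ} (ha₁ : 0 < a₁) (ha₂ : 0 < a₂) (M : ℝ) {s₀ : ℝ} (hs₀ : 0 < s₀) {θ : ℝ}
    (hθ0 : 0 < θ) (hθ1 : θ < 1) :
    ∃ C : ℝ, 1 ≤ C ∧ ∀ {n p : ℕ} (_ : 0 < n) {X : Matrix (Fin n) (Fin p) ℝ}
      {A : Matrix (Fin p) (Fin p) ℝ} (_ : A.IsHermitian) (_ : QuadBounds A a₁ a₂)
      {k : Finset (Fin p)} {ε : ℝ} (_ : DesignBounds X k ε) (_ : 1 ≤ n * ε) (b₀ : k → ℝ)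
      (_ : ∀ i, |b₀ i| ≤ M),
      ∫⁻ y, ENNReal.ofReal (isoDensity ((modelCols X k).mulVec b₀) s₀ y) *
        (marginalDensity r α₁ α₂ X A k y /
          ENNReal.ofReal (isoDensity ((modelCols X k).mulVec b₀) s₀ y)) ^ θ ≤
      ENNReal.ofReal (C ^ (k.card + 1) * (((k.card : ℝ) ^ (2 * ((r : ℝ) + 1 / 2))) ^ k.card *
        ((n : ℝ) ^ (-((r : ℝ) + 1 / 2))) ^ k.card) *
        (((n * ε) ^ (-((r : ℝ) + 1 / 2))) ^ (Finset.univ.filter fun i => b₀ i = 0).card *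
          ((n * ε) ^ (-(1 / 2) : ℝ)) ^ (Finset.univ.filter fun i => b₀ i ≠ 0).card)) ^ θ := by
  classical
  have hG := gaussMoment_pos r
  set ρ : ℝ := (r : ℝ) + 1 / 2 with hρ
  have hρ0 : 0 < ρ := by positivity
  -- With `B = s₀ / lam` the tilts `exp (-dist/(2B))` to the power `θ` and `exp (dist/(4 s₀))` to
  -- the power `1 - θ` cancel exactly, so Hölder's inequality applies to the untilted moment.
  set lam : ℝ := (1 - θ) / (2 * θ) with hlam
  have h1θ : 0 < 1 - θ := by linarith
  have hlam0 : 0 < lam := by positivity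
  set B := s₀ / lam with hB
  have hB0 : 0 < B := by positivity
  have hM2 : 0 ≤ M ^ (2 * r) := even_pow_nonneg _ _
  set K := (gaussMoment r)⁻¹ * a₂ ^ ρ * (4 ^ r * (M ^ (2 * r) * √(2 * π) + gaussMoment r)) *
    (1 + B) ^ ρ with hK
  have hK0 : 0 ≤ K := by positivity
  set C₀ := (2 : ℝ) ^ (1 / 2 : ℝ) * 2 ^ α₁ * exp (α₂ / 2) with hC₀
  set C₁ := K * 4 ^ ρ * (2 / α₂) ^ ρ * ρ ^ (2 * ρ) * exp lam with hC₁
  refine ⟨max 1 (max C₀ C₁), le_max_left _ _, ?_⟩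
  intro n p hn X A hA hq k ε hX hε b₀ hM
  set C := max 1 (max C₀ C₁) with hC
  have hn' : (0 : ℝ) < n := by exact_mod_cast hn
  have hN0 : 0 < n * ε := by linarith
  obtain ⟨ι, b, hb⟩ := exists_adapted_basis (colSpace X k)
  set I : Finset ι := Finset.univ.filter fun i => b i ∈ colSpace X k with hIdef
  have hI : ∀ i ∉ I, b i ∈ (colSpace X k)ᗮ := fun i hi =>
    (hb i).resolve_left fun h => hi (by simp [hIdef, h])
  have hIc : I.card ≤ k.card :=
    (card_mem_le_finrank b (colSpace X k) I (by simp [hIdef])).trans (finrank_colSpace_le X k)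
  set μ := (modelCols X k).mulVec b₀ with hμ
  have hw : Measurable fun y => ENNReal.ofReal (exp (-coordDist b I μ y / (2 * B))) :=
    (measurable_coordDist b I _ |>.neg.div_const _ |>.exp.ennreal_ofReal)
  have hv : Measurable fun y => ENNReal.ofReal (exp (coordDist b I μ y / (4 * s₀))) :=
    (measurable_coordDist b I _ |>.div_const _ |>.exp.ennreal_ofReal)
  have hH := lintegral_mul_div_rpow_le (μ := volume)
    (f := fun y => ENNReal.ofReal (isoDensity μ s₀ y)) (m := marginalDensity r α₁ α₂ X A k)
    (measurable_isoDensity μ s₀).ennreal_ofReal (measurable_marginalDensity r α₁ α₂ X A k) hw hv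
    (fun y => (ENNReal.ofReal_pos.2 (isoDensity_pos μ hs₀ y)).ne')
    (fun y => ENNReal.ofReal_ne_top) hθ0 hθ1
  have h1 : ∀ y, ENNReal.ofReal (exp (-coordDist b I μ y / (2 * B))) ^ θ *
      ENNReal.ofReal (exp (coordDist b I μ y / (4 * s₀))) ^ (1 - θ) = 1 := by
    intro y
    rw [ENNReal.ofReal_rpow_of_pos (exp_pos _), ENNReal.ofReal_rpow_of_pos (exp_pos _),
      ← ENNReal.ofReal_mul (by positivity), ← exp_mul, ← exp_mul, ← exp_add]
    have h0 : -coordDist b I μ y / (2 * B) * θ + coordDist b I μ y / (4 * s₀) * (1 - θ) = 0 := by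
      rw [hB, hlam]
      field_simp
      ring
    rw [h0, exp_zero, ENNReal.ofReal_one]
  simp_rw [h1, mul_one] at hH
  refine hH.trans ?_
  have h2 := lintegral_marginalDensity_mul_exp_le hn r hα₁ hα₂ hA ha₁ ha₂ hq hX hε b₀ hM hB0 b I
    hI rfl
  have h3 := lintegral_isoDensity_mul_exp_coordDist_le b I μ hs₀
  have h4 : ENNReal.ofReal (exp (1 / 2)) ^ I.card ≤ ENNReal.ofReal (exp (k.card / 2)) := by
    rw [← ENNReal.ofReal_pow (exp_pos _).le, ← exp_nat_mul]
    apply ENNReal.ofReal_le_ofReal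
    apply exp_le_exp.2
    have : (I.card : ℝ) ≤ k.card := by exact_mod_cast hIc
    linarith
  refine (mul_le_mul' (ENNReal.rpow_le_rpow h2 hθ0.le)
    (ENNReal.rpow_le_rpow (h3.trans h4) h1θ.le)).trans ?_
  rw [← hρ]
  set ν := ((n * ε) ^ (-ρ)) ^ (Finset.univ.filter fun i => b₀ i = 0).card *
    ((n * ε) ^ (-(1 / 2) : ℝ)) ^ (Finset.univ.filter fun i => b₀ i ≠ 0).card with hν
  have hν0 : 0 ≤ ν := by positivity
  have h5 : ENNReal.ofReal (exp (k.card / 2)) ^ (1 - θ) =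
      ENNReal.ofReal (exp lam ^ k.card) ^ θ := by
    rw [ENNReal.ofReal_rpow_of_pos (exp_pos _), ENNReal.ofReal_rpow_of_pos (by positivity),
      ← exp_nat_mul, ← exp_mul, ← exp_mul, hlam]
    congr 2
    field_simp
  rw [h5, ← ENNReal.mul_rpow_of_nonneg _ _ hθ0.le, ← ENNReal.ofReal_mul (by positivity)]
  refine ENNReal.rpow_le_rpow (ENNReal.ofReal_le_ofReal ?_) hθ0.le
  have g0 : C₀ ≤ C := (le_max_left _ _).trans (le_max_right _ _)
  have g1 : C₁ ≤ C := (le_max_right _ _).trans (le_max_right _ _)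
  have g2 : 0 ≤ C₁ := by positivity
  have g3 : 0 ≤ C₀ := by positivity
  have g4 : 0 ≤ C := g3.trans g0
  rw [← hK]
  clear_value ν C C₁ C₀ K ρ
  have hpow : ∀ x : ℝ, 0 ≤ x → x ^ (ρ * k.card) = (x ^ ρ) ^ k.card := fun x hx => by
    rw [← rpow_natCast, ← rpow_mul hx]
  have e1 : (4 / n : ℝ) ^ (ρ * k.card) = (4 ^ ρ) ^ k.card * ((n : ℝ) ^ (-ρ)) ^ k.card := by
    rw [hpow _ (by positivity), div_rpow (by norm_num) hn'.le, rpow_neg hn'.le, div_eq_mul_inv,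
      mul_pow]
  have e2 : (2 / α₂) ^ (ρ * k.card) = ((2 / α₂) ^ ρ) ^ k.card := hpow _ (by positivity)
  have e3 : (ρ * k.card) ^ (ρ * k.card) * (ρ * k.card) ^ (ρ * k.card) =
      (ρ ^ (2 * ρ)) ^ k.card * ((k.card : ℝ) ^ (2 * ρ)) ^ k.card := by
    rw [hpow _ (by positivity), mul_rpow hρ0.le (by positivity), mul_pow, two_mul ρ,
      rpow_add hρ0, rpow_add_of_nonneg (by positivity) hρ0.le hρ0.le, mul_pow, mul_pow]
    ring
  calc _ = (C₀ * C₁ ^ k.card) * (((k.card : ℝ) ^ (2 * ρ)) ^ k.card *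
        ((n : ℝ) ^ (-ρ)) ^ k.card) * ν := by
        rw [e1, e2, hC₀, hC₁, mul_pow, mul_pow, mul_pow, mul_pow]
        linear_combination (K ^ k.card * ν * ((4 ^ ρ) ^ k.card * ((n : ℝ) ^ (-ρ)) ^ k.card) *
          ((2 / α₂) ^ ρ) ^ k.card * exp (α₂ / 2) * (2 ^ (1 / 2 : ℝ) * 2 ^ α₁) *
            exp lam ^ k.card) * e3
    _ ≤ (C * C ^ k.card) * (((k.card : ℝ) ^ (2 * ρ)) ^ k.card *
        ((n : ℝ) ^ (-ρ)) ^ k.card) * ν := by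
        gcongr
    _ = _ := by rw [pow_succ' C]
-- Lower bound for the marginal density of the true model.
theorem mul_measure_le_setLIntegral {α : Type*} [MeasurableSpace α] {μ : Measure α} {S S' : Set α}
    (hS : MeasurableSet S) (h : S ⊆ S') {f : α → ENNReal} {c : ENNReal} (hc : ∀ x ∈ S, c ≤ f x) :
    c * μ S ≤ ∫⁻ x in S', f x ∂μ := by
  rw [← setLIntegral_const]
  exact (setLIntegral_mono' hS hc).trans (lintegral_mono_set h)

/-- The cross term between the residual and `X_k (β - b₀)` is nonnegative by the sign condition, so
the sum of squares grows by at most `|X_k (β - b₀)|²`. The bound therefore holds for every response,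
however atypical. -/
theorem likelihood_ge {n p : ℕ} (hn : 0 < n) {X : Matrix (Fin n) (Fin p) ℝ} {k : Finset (Fin p)}
    {ε : ℝ} (hε : 0 < ε) (hX : DesignBounds X k ε) (b₀ β : k → ℝ) {s₀ s : ℝ} (hs₀ : 0 < s₀)
    (hs : s₀ ≤ s) (hs' : s ≤ s₀ * (1 + 1 / n)) (y : Fin n → ℝ)
    (hβ : ∀ i, |β i - b₀ i| ≤ √(ε / n))
    (hsign : ∀ i, 0 ≤ (β i - b₀ i) *
      ((y - (modelCols X k).mulVec b₀) ⬝ᵥ fun l => modelCols X k l i)) :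
    exp (-(1 / 2) - k.card / (2 * s₀)) * isoDensity ((modelCols X k).mulVec b₀) s₀ y ≤
      likelihood X k β s y := by
  have hn' : (0 : ℝ) < n := by exact_mod_cast hn
  have hs0 : 0 < s := hs₀.trans_le hs
  set e : Fin n → ℝ := y - (modelCols X k).mulVec b₀ with he
  set v : Fin n → ℝ := (modelCols X k).mulVec (β - b₀) with hv
  -- The side `√(ε/n)` is chosen to cancel the factor `n ε⁻¹` of the design bound.
  have h1 : ∑ l, v l ^ 2 ≤ k.card := by
    refine (hX (β - b₀)).2.trans ?_
    have : ∑ i, (β - b₀) i ^ 2 ≤ ∑ _i : k, ε / n := by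
      refine Finset.sum_le_sum fun i _ => ?_
      rw [Pi.sub_apply, ← sq_abs, ← sq_sqrt (show 0 ≤ ε / n by positivity)]
      gcongr
      exact hβ i
    rw [Finset.sum_const, Finset.card_univ, Fintype.card_coe, nsmul_eq_mul] at this
    calc n * ε⁻¹ * ∑ i, (β - b₀) i ^ 2 ≤ n * ε⁻¹ * (k.card * (ε / n)) := by gcongr
      _ = k.card := by field_simp
  have h2 : 0 ≤ ∑ l, e l * v l := by
    have : ∑ l, e l * v l = ∑ i, (β i - b₀ i) * (e ⬝ᵥ fun l => modelCols X k l i) := by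
      simp only [hv, Matrix.mulVec, dotProduct, Finset.mul_sum]
      rw [Finset.sum_comm]
      refine Finset.sum_congr rfl fun i _ => Finset.sum_congr rfl fun l _ => ?_
      rw [Pi.sub_apply]
      ring
    rw [this]
    exact Finset.sum_nonneg fun i _ => hsign i
  have h3 : ∑ l, (y l - (modelCols X k).mulVec β l) ^ 2 ≤ ∑ l, e l ^ 2 + k.card := by
    have : ∀ l, (y l - (modelCols X k).mulVec β l) ^ 2 = e l ^ 2 - 2 * (e l * v l) + v l ^ 2 := by
      intro l
      simp only [he, hv, Matrix.mulVec_sub, Pi.sub_apply]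
      ring
    simp_rw [this, Finset.sum_add_distrib, Finset.sum_sub_distrib, ← Finset.mul_sum]
    linarith
  -- A relative change `1/n` of the variance alters the normalizing power `-n/2` by at most the
  -- constant `e^(-1/2)`.
  have h4 : (2 * π * s₀) ^ (-(n : ℝ) / 2) * exp (-(1 / 2)) ≤ (2 * π * s) ^ (-(n : ℝ) / 2) := by
    have h5 : s ≤ s₀ * exp (1 / n) := hs'.trans (by
      have := add_one_le_exp (1 / (n : ℝ))
      gcongr
      linarith)
    calc (2 * π * s₀) ^ (-(n : ℝ) / 2) * exp (-(1 / 2)) =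
          (2 * π * (s₀ * exp (1 / n))) ^ (-(n : ℝ) / 2) := by
          rw [← mul_assoc, mul_rpow (by positivity) (exp_pos _).le, ← exp_mul]
          congr 2
          field_simp
      _ ≤ _ := by
          apply rpow_le_rpow_of_nonpos (by positivity) (by gcongr)
          rw [neg_div]
          exact neg_nonpos.2 (by positivity)
  have h6 : exp (-(k.card / (2 * s₀))) * exp (-(∑ l, e l ^ 2) / (2 * s₀)) ≤
      exp (-(∑ l, (y l - (modelCols X k).mulVec β l) ^ 2) / (2 * s)) := by
    rw [← exp_add]
    apply exp_le_exp.2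
    have h7 : (∑ l, (y l - (modelCols X k).mulVec β l) ^ 2) / (2 * s) ≤
        (∑ l, e l ^ 2 + k.card) / (2 * s₀) := by gcongr
    rw [neg_div, neg_div]
    rw [add_div] at h7
    linarith
  calc _ = ((2 * π * s₀) ^ (-(n : ℝ) / 2) * exp (-(1 / 2))) *
        (exp (-(k.card / (2 * s₀))) * exp (-(∑ l, e l ^ 2) / (2 * s₀))) := by
        rw [sub_eq_add_neg, exp_add, isoDensity]
        simp only [he, Pi.sub_apply]
        ring
    _ ≤ _ := by
        unfold likelihood
        gcongr

/-- A lower bound of the marginal density of the true model by the true density. -/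
theorem exists_le_marginalDensity (r : ℕ) {α₁ α₂ : ℝ} (hα₁ : 0 < α₁) (hα₂ : 0 < α₂)
    {a₁ a₂ : ℝ} (ha₁ : 0 < a₁) (ha₂ : 0 < a₂) {M bm : ℝ} (hbm : 0 < bm) {s₀ : ℝ} (hs₀ : 0 < s₀)
    (T : ℕ) :
    ∃ c : ℝ, 0 < c ∧ ∀ {n p : ℕ} (_ : 0 < n) {X : Matrix (Fin n) (Fin p) ℝ}
      {A : Matrix (Fin p) (Fin p) ℝ} (_ : A.IsHermitian) (_ : QuadBounds A a₁ a₂)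
      {k : Finset (Fin p)} {ε : ℝ} (_ : 0 < ε) (_ : DesignBounds X k ε) (b₀ : k → ℝ)
      (_ : ∀ i, bm ≤ |b₀ i|) (_ : ∀ i, |b₀ i| ≤ M) (_ : 2 * √(ε / n) ≤ bm) (_ : k.card = T)
      (y : Fin n → ℝ),
      ENNReal.ofReal (c * ((n : ℝ) ^ (-((r : ℝ) + 1 / 2)) * √(ε / n)) ^ T / n) *
        ENNReal.ofReal (isoDensity ((modelCols X k).mulVec b₀) s₀ y) ≤
          marginalDensity r α₁ α₂ X A k y := by
  classical
  have hG := gaussMoment_pos r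
  have hΓ := Gamma_pos_of_pos hα₁
  have hΓ' := Gamma_pos_of_pos (show (0 : ℝ) < 1 / 2 by norm_num)
  set ρ : ℝ := (r : ℝ) + 1 / 2 with hρ
  have hρ0 : 0 < ρ := by positivity
  set K₁ := (gaussMoment r)⁻¹ * a₁ ^ ρ with hK₁
  have hK₁0 : 0 < K₁ := by positivity
  set E₁ := exp (-(1 / 2) - T / (2 * s₀)) with hE₁
  set E₂ := (bm / 2) ^ (2 * r) * exp (-((M + bm) ^ 2 * a₂ / (2 * s₀))) with hE₂
  set E₃ := exp (-(1 / 2)) / (4 * Gamma (1 / 2)) with hE₃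
  set E₄ := α₂ ^ α₁ / Gamma α₁ * (2 * s₀) ^ (-(α₁ + 1)) * exp (-α₂ / s₀) with hE₄
  have hE₁0 : 0 < E₁ := exp_pos _
  have hE₂0 : 0 < E₂ := by positivity
  have hE₃0 : 0 < E₃ := by positivity
  have hE₄0 : 0 < E₄ := by positivity
  refine ⟨E₁ * (K₁ * (4 * s₀) ^ (-ρ) * E₂) ^ T * E₃ * E₄ * s₀, by positivity, ?_⟩
  intro n p hn X A hA hq k ε hε hX b₀ hb hM hδ hT y
  have hn' : (0 : ℝ) < n := by exact_mod_cast hn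
  have hn1 : (1 : ℝ) ≤ n := by exact_mod_cast hn
  set δ := √(ε / n) with hδd
  have hδ0 : 0 < δ := by positivity
  set e : Fin n → ℝ := y - (modelCols X k).mulVec b₀ with he
  set f := isoDensity ((modelCols X k).mulVec b₀) s₀ y with hf
  have hf0 : 0 < f := isoDensity_pos _ hs₀ y
  -- One-sided intervals at `b₀ i`, on the side given by the correlation of the residual with the
  -- column. The box depends on `y`, but its volume does not.
  let J : k → Set ℝ := fun i => if 0 ≤ e ⬝ᵥ fun l => modelCols X k l i
    then Set.Icc (b₀ i) (b₀ i + δ) else Set.Icc (b₀ i - δ) (b₀ i)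
  have hJv : ∀ i, volume (J i) = ENNReal.ofReal δ := by
    intro i
    simp only [J]
    split_ifs <;> simp
  have hJm : MeasurableSet (Set.univ.pi J) := by
    refine MeasurableSet.univ_pi fun i => ?_
    simp only [J]
    split_ifs <;> exact measurableSet_Icc
  have hJ1 : ∀ i, ∀ x ∈ J i, |x - b₀ i| ≤ δ := by
    intro i x hx
    simp only [J] at hx
    rw [abs_le]
    split_ifs at hx <;> constructor <;> linarith [hx.1, hx.2]
  have hJ2 : ∀ i, ∀ x ∈ J i, 0 ≤ (x - b₀ i) * (e ⬝ᵥ fun l => modelCols X k l i) := by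
    intro i x hx
    simp only [J] at hx
    split_ifs at hx with h
    · exact mul_nonneg (by linarith [hx.1]) h
    · exact mul_nonneg_of_nonpos_of_nonpos (by linarith [hx.2]) (not_le.1 h).le
  set V := E₁ * f * (K₁ * ((4 * s₀) ^ (-ρ) * (n : ℝ) ^ (-ρ)) * E₂) ^ T * (E₃ / n) * E₄ with hV
  -- For `τ` between `n` and `2n` the prior density of `τ` is of order `1/n`, which the length `n`
  -- of the window compensates. The window of `s` has length `s₀ / n`, the origin of the `1/n` in
  -- the bound.
  have hpt : ∀ τ ∈ Set.Icc (n : ℝ) (2 * n), ∀ s ∈ Set.Icc s₀ (s₀ * (1 + 1 / n)),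
      ∀ β ∈ Set.univ.pi J, ENNReal.ofReal V ≤ ENNReal.ofReal (likelihood X k β s y *
        pMOMDensity r A k τ s β * invGammaDensity (1 / 2) ((n : ℝ) / 2) τ *
          invGammaDensity α₁ α₂ s) := by
    intro τ hτ s hs β hβ
    have hτ0 : 0 < τ := hn'.trans_le hτ.1
    have hs0 : 0 < s := hs₀.trans_le hs.1
    have hs2 : s ≤ 2 * s₀ := by
      refine hs.2.trans ?_
      have : 1 / (n : ℝ) ≤ 1 := by rw [div_le_one hn']; exact hn1
      nlinarith
    have l1 := likelihood_ge hn hε hX b₀ β hs₀ hs.1 hs.2 y (fun i => hJ1 i _ (hβ i trivial))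
      fun i => hJ2 i _ (hβ i trivial)
    rw [hT, ← hE₁, ← hf] at l1
    have l2 : (K₁ * ((4 * s₀) ^ (-ρ) * (n : ℝ) ^ (-ρ)) * E₂) ^ T ≤ pMOMDensity r A k τ s β := by
      refine le_trans ?_ (pMOMDensity_bounds r hA ha₁ ha₂ hq k hτ0 hs0 β).1
      rw [← hρ, ← hK₁, ← hT, ← Fintype.card_coe k, ← Finset.card_univ, ← Finset.prod_const]
      refine Finset.prod_le_prod (fun i _ => by positivity) fun i _ => ?_
      have g1 : (4 * s₀) ^ (-ρ) * (n : ℝ) ^ (-ρ) ≤ (τ * s) ^ (-ρ) := by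
        rw [← mul_rpow (by positivity) hn'.le]
        apply rpow_le_rpow_of_nonpos (by positivity) _ (by linarith)
        calc τ * s ≤ (2 * n) * (2 * s₀) := by gcongr; exact hτ.2
          _ = _ := by ring
      have g2 := hJ1 i _ (hβ i trivial)
      have g3 : bm / 2 ≤ |β i| := by
        have := abs_sub_abs_le_abs_sub (b₀ i) (β i)
        rw [abs_sub_comm] at this
        linarith [hb i]
      have g4 : |β i| ≤ M + bm := by
        have := abs_sub_abs_le_abs_sub (β i) (b₀ i)
        linarith [hM i]
      have g5 : (bm / 2) ^ (2 * r) ≤ β i ^ (2 * r) := by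
        rw [← (even_two_mul r).pow_abs (β i)]
        gcongr
      have g6 : exp (-((M + bm) ^ 2 * a₂ / (2 * s₀))) ≤ exp (-β i ^ 2 / (2 * (τ * s / a₂))) := by
        apply exp_le_exp.2
        rw [neg_div]
        apply neg_le_neg
        have g7 : β i ^ 2 ≤ (M + bm) ^ 2 := by
          rw [← sq_abs]
          gcongr
        have g8 : s₀ ≤ τ * s := by nlinarith [hs.1, hτ.1]
        calc β i ^ 2 / (2 * (τ * s / a₂)) = β i ^ 2 * a₂ / (2 * (τ * s)) := by field_simp
          _ ≤ (M + bm) ^ 2 * a₂ / (2 * s₀) := by gcongr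
      have : 0 ≤ β i ^ (2 * r) := even_pow_nonneg _ _
      rw [hE₂]
      gcongr
    have l3 : E₃ / n ≤ invGammaDensity (1 / 2) ((n : ℝ) / 2) τ := by
      have g1 : (2 * n : ℝ) ^ (-(3 / 2) : ℝ) ≤ τ ^ (-(1 / 2 + 1) : ℝ) := by
        rw [show (-(1 / 2 + 1) : ℝ) = -(3 / 2) by norm_num]
        exact rpow_le_rpow_of_nonpos hτ0 hτ.2 (by norm_num)
      have g2 : exp (-(1 / 2)) ≤ exp (-((n : ℝ) / 2) / τ) := by
        apply exp_le_exp.2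
        rw [neg_div]
        apply neg_le_neg
        rw [div_le_iff₀ hτ0]
        linarith [hτ.1]
      have g3 : E₃ / n = ((n : ℝ) / 2) ^ (1 / 2 : ℝ) / Gamma (1 / 2) *
          (2 * n : ℝ) ^ (-(3 / 2) : ℝ) * exp (-(1 / 2)) := by
        have : ((n : ℝ) / 2) ^ (1 / 2 : ℝ) * (2 * n : ℝ) ^ (-(3 / 2) : ℝ) = 1 / (4 * n) := by
          have e1 : (n : ℝ) ^ (1 / 2 : ℝ) * (n : ℝ) ^ (-(3 / 2) : ℝ) = (n : ℝ)⁻¹ := by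
            rw [← rpow_add hn', ← rpow_neg_one]
            norm_num
          have e2 : (2 : ℝ) ^ (-(1 / 2) : ℝ) * (2 : ℝ) ^ (-(3 / 2) : ℝ) = 1 / 4 := by
            rw [← rpow_add two_pos]
            norm_num
          rw [div_rpow hn'.le zero_le_two, mul_rpow zero_le_two hn'.le, div_eq_mul_inv,
            ← rpow_neg zero_le_two]
          calc _ = (2 : ℝ) ^ (-(1 / 2) : ℝ) * (2 : ℝ) ^ (-(3 / 2) : ℝ) *
                ((n : ℝ) ^ (1 / 2 : ℝ) * (n : ℝ) ^ (-(3 / 2) : ℝ)) := by ring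
            _ = _ := by rw [e1, e2]; field_simp
        calc E₃ / n = 1 / (4 * n) * exp (-(1 / 2)) / Gamma (1 / 2) := by rw [hE₃]; field_simp
          _ = _ := by rw [← this]; ring
      rw [g3, invGammaDensity]
      gcongr
    have l4 : E₄ ≤ invGammaDensity α₁ α₂ s := by
      rw [hE₄, invGammaDensity]
      have g1 : (2 * s₀) ^ (-(α₁ + 1)) ≤ s ^ (-(α₁ + 1)) :=
        rpow_le_rpow_of_nonpos hs0 hs2 (by linarith)
      have g2 : exp (-α₂ / s₀) ≤ exp (-α₂ / s) := by
        apply exp_le_exp.2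
        rw [neg_div, neg_div]
        apply neg_le_neg
        have := hs.1
        gcongr
      gcongr
    apply ENNReal.ofReal_le_ofReal
    rw [hV]
    have h0 : 0 ≤ (K₁ * ((4 * s₀) ^ (-ρ) * (n : ℝ) ^ (-ρ)) * E₂) ^ T := by positivity
    have h1 := h0.trans l2
    have h2 : 0 ≤ likelihood X k β s y := likelihood_nonneg X k β hs0 y
    have h3 := invGammaDensity_nonneg (a := 1 / 2) (b := (n : ℝ) / 2) (by norm_num)
      (by positivity) hτ0
    gcongr
  have m1 : ∀ τ ∈ Set.Icc (n : ℝ) (2 * n), ENNReal.ofReal V * ENNReal.ofReal δ ^ T *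
      ENNReal.ofReal (s₀ / n) ≤ ∫⁻ s in Set.Ioi (0 : ℝ), ∫⁻ β : k → ℝ,
        ENNReal.ofReal (likelihood X k β s y * pMOMDensity r A k τ s β *
          invGammaDensity (1 / 2) ((n : ℝ) / 2) τ * invGammaDensity α₁ α₂ s) := by
    intro τ hτ
    have hvol : volume (Set.Icc s₀ (s₀ * (1 + 1 / n))) = ENNReal.ofReal (s₀ / n) := by
      rw [Real.volume_Icc]
      congr 1
      ring
    rw [← hvol]
    refine mul_measure_le_setLIntegral measurableSet_Icc
      (fun x hx => hs₀.trans_le hx.1) fun s hs => ?_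
    have hvol' : volume (Set.univ.pi J) = ENNReal.ofReal δ ^ T := by
      rw [volume_pi_pi]
      simp [hJv, hT]
    rw [← hvol', ← setLIntegral_univ]
    exact mul_measure_le_setLIntegral hJm (Set.subset_univ _) fun β hβ => hpt τ hτ s hs β hβ
  have m2 : ENNReal.ofReal V * ENNReal.ofReal δ ^ T * ENNReal.ofReal (s₀ / n) *
      ENNReal.ofReal n ≤ marginalDensity r α₁ α₂ X A k y := by
    have hvol : volume (Set.Icc (n : ℝ) (2 * n)) = ENNReal.ofReal n := by
      rw [Real.volume_Icc]
      congr 1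
      ring
    rw [← hvol]
    exact mul_measure_le_setLIntegral measurableSet_Icc
      (fun x hx => hn'.trans_le hx.1) m1
  refine le_trans (le_of_eq ?_) m2
  have hV0 : 0 < V := by positivity
  rw [← ENNReal.ofReal_mul (by positivity), ← ENNReal.ofReal_pow hδ0.le,
    ← ENNReal.ofReal_mul hV0.le, ← ENNReal.ofReal_mul (by positivity),
    ← ENNReal.ofReal_mul (by positivity)]
  congr 1
  rw [hV]
  field_simp
  simp only [mul_pow]
  ring
-- From fractional moments to the posterior probability.
theorem pi_withDensity {ι : Type*} [Fintype ι] (f : ι → ℝ → ENNReal) (hf : ∀ i, Measurable (f i))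
    [∀ i, SigmaFinite ((volume : Measure ℝ).withDensity (f i))] :
    Measure.pi (fun i => (volume : Measure ℝ).withDensity (f i)) =
      (volume : Measure (ι → ℝ)).withDensity fun x => ∏ i, f i (x i) := by
  refine (Measure.pi_eq fun s hs => ?_)
  rw [withDensity_apply _ (MeasurableSet.univ_pi hs), ← lintegral_indicator
    (MeasurableSet.univ_pi hs)]
  calc _ = ∫⁻ x : ι → ℝ, ∏ i, (s i).indicator (f i) (x i) := by
        refine lintegral_congr fun x => ?_
        by_cases hx : x ∈ Set.univ.pi s
        · rw [Set.indicator_of_mem hx]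
          exact Finset.prod_congr rfl fun i _ => (Set.indicator_of_mem (hx i trivial) _).symm
        · rw [Set.indicator_of_notMem hx]
          simp only [Set.mem_pi, Set.mem_univ, true_implies, not_forall] at hx
          obtain ⟨i, hi⟩ := hx
          exact (Finset.prod_eq_zero (Finset.mem_univ i) (Set.indicator_of_notMem hi _)).symm
    _ = _ := by
        rw [lintegral_pi_prod _ fun i => (hf i).indicator (hs i)]
        refine Finset.prod_congr rfl fun i _ => ?_
        rw [withDensity_apply _ (hs i), lintegral_indicator (hs i)]

/-- Expectations of functions of a vector with independent normal entries around `μ`. -/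
theorem lintegral_add_noise {Ω : Type*} [MeasurableSpace Ω] {P : Measure Ω}
    [IsProbabilityMeasure P] {n : ℕ} {σ₀ : NNReal} (hσ₀ : 0 < σ₀) {e : Fin n → Ω → ℝ}
    (he_law : ∀ i, HasLaw (e i) (gaussianReal 0 (σ₀ ^ 2)) P) (he_indep : iIndepFun e P)
    (μ : Fin n → ℝ) {F : (Fin n → ℝ) → ENNReal} (hF : Measurable F) :
    ∫⁻ ω, F (fun i => μ i + e i ω) ∂P =
      ∫⁻ y, ENNReal.ofReal (isoDensity μ ((σ₀ : ℝ) ^ 2) y) * F y := by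
  have hv : σ₀ ^ 2 ≠ 0 := (pow_pos hσ₀ 2).ne'
  have hs : (0 : ℝ) < (σ₀ : ℝ) ^ 2 := by positivity
  have hm : ∀ i, AEMeasurable (e i) P := fun i => (he_law i).aemeasurable
  have hlaw := (iIndepFun_iff_map_fun_eq_pi_map hm).1 he_indep
  simp_rw [fun i => (he_law i).map_eq, gaussianReal_of_var_ne_zero 0 hv] at hlaw
  have hsf : SigmaFinite ((volume : Measure ℝ).withDensity (gaussianPDF 0 (σ₀ ^ 2))) := by
    rw [← gaussianReal_of_var_ne_zero 0 hv]; infer_instance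
  rw [pi_withDensity (fun _ : Fin n => gaussianPDF 0 (σ₀ ^ 2))
    fun _ => measurable_gaussianPDF _ _] at hlaw
  have hF' : Measurable fun x : Fin n → ℝ => F (fun i => μ i + x i) :=
    hF.comp (measurable_pi_lambda _ fun i => (measurable_pi_apply i).const_add _)
  have hd : ∀ x : Fin n → ℝ, ∏ i, gaussianPDF 0 (σ₀ ^ 2) (x i) =
      ENNReal.ofReal (isoDensity μ ((σ₀ : ℝ) ^ 2) (μ + x)) := by
    intro x
    rw [isoDensity_eq_prod μ hs,
      ENNReal.ofReal_prod_of_nonneg fun i _ => normalDensity_nonneg _ _ _]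
    refine Finset.prod_congr rfl fun i _ => ?_
    rw [gaussianPDF, gaussianPDFReal, normalDensity]
    simp
  have h1 : ∫⁻ ω, F (fun i => μ i + e i ω) ∂P =
      ∫⁻ x, F (fun i => μ i + x i) ∂(Measure.map (fun ω i => e i ω) P) :=
    (lintegral_map' hF'.aemeasurable (aemeasurable_pi_lambda _ hm)).symm
  rw [h1, hlaw, lintegral_withDensity_eq_lintegral_mul₀ _ hF'.aemeasurable]
  · simp_rw [Pi.mul_apply, hd]
    exact lintegral_add_left_eq_self
      (fun y => ENNReal.ofReal (isoDensity μ ((σ₀ : ℝ) ^ 2) y) * F y) μ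
  · exact (Finset.measurable_fun_prod _ fun i _ =>
      (measurable_gaussianPDF _ _).comp (measurable_pi_apply i)).aemeasurable

/-- The total mass of the marginal density is bounded by that of the product bound of the prior. -/
theorem ae_marginalDensity_lt_top {n p : ℕ} (hn : 0 < n) (r : ℕ) {α₁ α₂ : ℝ}
    (hα₁ : 0 < α₁) (hα₂ : 0 < α₂) (X : Matrix (Fin n) (Fin p) ℝ) {A : Matrix (Fin p) (Fin p) ℝ}
    (hA : A.IsHermitian) {a₁ a₂ : ℝ} (ha₁ : 0 < a₁) (ha₂ : 0 < a₂) (h : QuadBounds A a₁ a₂)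
    (k : Finset (Fin p)) : ∀ᵐ y, marginalDensity r α₁ α₂ X A k y < ⊤ := by
  have h1 := lintegral_marginalDensity_mul_le_of_le hn r hα₁ hα₂ X hA ha₁ ha₂ h k
    (w := fun _ => 1) measurable_const 1 fun s hs β => by
      simp only [likelihood_eq_isoDensity, mul_one, lintegral_isoDensity _ hs, le_refl]
  simp only [mul_one] at h1
  exact ae_lt_top (measurable_marginalDensity r α₁ α₂ X A k)
    (h1.trans_lt ENNReal.ofReal_lt_top).ne

theorem sum_rpow_le {ι : Type*} (s : Finset ι) (f : ι → ENNReal) {θ : ℝ} (hθ0 : 0 < θ)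
    (hθ1 : θ ≤ 1) : (∑ i ∈ s, f i) ^ θ ≤ ∑ i ∈ s, f i ^ θ :=
  Finset.le_sum_of_subadditive (fun x : ENNReal => x ^ θ) (ENNReal.zero_rpow_of_pos hθ0).le
    (fun a b => ENNReal.rpow_add_le_add_rpow a b hθ0.le hθ1) s f

/-- The distance is `b / (a + b)`, at most `b / a`. Here `a` is the contribution of the true model
to the denominator of the posterior and `b` that of all others. -/
theorem edist_toReal_div_add_one_lt {a b : ENNReal} (ha : a ≠ 0) (ha' : a ≠ ⊤) {δ : ENNReal}
    (hδ : δ ≠ ⊤) (h : b < δ * a) : edist (a / (a + b)).toReal 1 < δ := by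
  have hb : b ≠ ⊤ := (h.trans_le le_top).ne
  lift a to NNReal using ha'
  lift b to NNReal using hb
  lift δ to NNReal using hδ
  have ha0 : 0 < a := pos_iff_ne_zero.2 (by exact_mod_cast ha)
  have h' : b < δ * a := by exact_mod_cast h
  have hab : a + b ≠ 0 := by positivity
  rw [← ENNReal.coe_add, ← ENNReal.coe_div hab, ENNReal.coe_toReal, edist_dist, Real.dist_eq,
    ENNReal.ofReal_lt_iff_lt_toReal (abs_nonneg _) ENNReal.coe_ne_top, ENNReal.coe_toReal]
  have h2 : (b : ℝ) < δ * a := by exact_mod_cast h'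
  have h3 : (0 : ℝ) < a := by exact_mod_cast ha0
  have h4 : (0 : ℝ) ≤ b := b.2
  have h5 : (0 : ℝ) ≤ δ := δ.2
  push_cast
  rw [show (a : ℝ) / (a + b) - 1 = -(b / (a + b)) by field_simp; ring, abs_neg,
    abs_of_nonneg (by positivity), div_lt_iff₀ (by positivity)]
  nlinarith

/-- Deviations of the posterior probability of the true model from `1`, by moments of order `θ`
of the ratios of the marginal densities to the true density. -/
theorem measure_posterior_le {Ω : Type*} [MeasurableSpace Ω] {P : Measure Ω}
    [IsProbabilityMeasure P] {n p : ℕ} (hn : 0 < n) {σ₀ : NNReal} (hσ₀ : 0 < σ₀)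
    {e : Fin n → Ω → ℝ} (he_law : ∀ i, HasLaw (e i) (gaussianReal 0 (σ₀ ^ 2)) P)
    (he_indep : iIndepFun e P) (r : ℕ) {α₁ α₂ : ℝ} (hα₁ : 0 < α₁) (hα₂ : 0 < α₂) (c₁ c₂ : ℝ) (q : ℕ)
    (X : Matrix (Fin n) (Fin p) ℝ) {A : Matrix (Fin p) (Fin p) ℝ}
    (hA : A.IsHermitian) {a₁ a₂ : ℝ} (ha₁ : 0 < a₁) (ha₂ : 0 < a₂) (hq : QuadBounds A a₁ a₂)
    (t : Finset (Fin p)) (ht : 0 < complexityPrior c₁ c₂ q t) (β₀ : ℕ → ℝ) {μ : Fin n → ℝ}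
    (hμ : X.mulVec (fun j : Fin p => β₀ j) = μ) {L : ℝ} (hL : 0 < L)
    (hLm : ∀ y, ENNReal.ofReal L * ENNReal.ofReal (isoDensity μ ((σ₀ : ℝ) ^ 2) y) ≤
      marginalDensity r α₁ α₂ X A t y) {θ : ℝ} (hθ0 : 0 < θ) (hθ1 : θ < 1) {δ : ENNReal}
    (hδ0 : δ ≠ 0) (hδ : δ ≠ ⊤) :
    P {ω | δ ≤ edist (_root_.posterior r α₁ α₂ c₁ c₂ q X A t (response X β₀ fun i => e i ω)) 1} ≤
      (δ ^ θ)⁻¹ * ∑ k ∈ Finset.univ.erase t,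
        (ENNReal.ofReal (complexityPrior c₁ c₂ q k) /
          (ENNReal.ofReal (complexityPrior c₁ c₂ q t) * ENNReal.ofReal L)) ^ θ *
        ∫⁻ y, ENNReal.ofReal (isoDensity μ ((σ₀ : ℝ) ^ 2) y) *
          (marginalDensity r α₁ α₂ X A k y /
            ENNReal.ofReal (isoDensity μ ((σ₀ : ℝ) ^ 2) y)) ^ θ := by
  have hs : (0 : ℝ) < (σ₀ : ℝ) ^ 2 := by positivity
  set f : (Fin n → ℝ) → ENNReal := fun y => ENNReal.ofReal (isoDensity μ ((σ₀ : ℝ) ^ 2) y) with hf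
  have hfm : Measurable f := (measurable_isoDensity μ _).ennreal_ofReal
  have hf0 : ∀ y, f y ≠ 0 := fun y => (ENNReal.ofReal_pos.2 (isoDensity_pos μ hs y)).ne'
  have hft : ∀ y, f y ≠ ⊤ := fun y => ENNReal.ofReal_ne_top
  set m := fun k => marginalDensity r α₁ α₂ X A k with hm
  have hmm : ∀ k, Measurable (m k) := measurable_marginalDensity r α₁ α₂ X A
  set w : Finset (Fin p) → ENNReal := fun k => ENNReal.ofReal (complexityPrior c₁ c₂ q k) with hw
  have hwt0 : w t ≠ 0 := (ENNReal.ofReal_pos.2 ht).ne'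
  have hwt : w t ≠ ⊤ := ENNReal.ofReal_ne_top
  have hL0 : ENNReal.ofReal L ≠ 0 := (ENNReal.ofReal_pos.2 hL).ne'
  have hcd : w t * ENNReal.ofReal L ≠ 0 := mul_ne_zero hwt0 hL0
  have hcd' : w t * ENNReal.ofReal L ≠ ⊤ := ENNReal.mul_ne_top hwt ENNReal.ofReal_ne_top
  set c : Finset (Fin p) → ENNReal := fun k => w k / (w t * ENNReal.ofReal L) with hc
  set S : (Fin n → ℝ) → ENNReal := fun y => ∑ k ∈ Finset.univ.erase t, c k * (m k y / f y) with hS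
  have hSm : Measurable S :=
    Finset.measurable_fun_sum _ fun k _ => ((hmm k).div hfm).const_mul _
  -- Responses at which `m t` is infinite are included because the ratio defining the posterior is
  -- uninformative there; they form a null set.
  let E : Set (Fin n → ℝ) := {y | m t y = ⊤} ∪ {y | δ ≤ S y}
  have hE : MeasurableSet E := (hmm t (measurableSet_singleton ⊤)).union
    (measurableSet_le measurable_const hSm)
  have hresp : ∀ ω, response X β₀ (fun i => e i ω) = fun i => μ i + e i ω := by
    intro ω
    funext i
    rw [response, hμ]
  have hsub : {ω | δ ≤ edist (_root_.posterior r α₁ α₂ c₁ c₂ q X A t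
      (response X β₀ fun i => e i ω)) 1} ⊆
      {ω | (fun i => μ i + e i ω) ∈ E} := by
    intro ω hω
    rw [Set.mem_ofPred_eq, hresp] at hω
    set y : Fin n → ℝ := fun i => μ i + e i ω
    by_contra hy
    simp only [E, Set.mem_ofPred_eq, Set.mem_union, not_or, not_le] at hy
    obtain ⟨hy1, hy2⟩ := hy
    refine absurd hω (not_le.2 ?_)
    unfold _root_.posterior
    rw [← Finset.add_sum_erase _ _ (Finset.mem_univ t)]
    have hmt : m t y ≠ 0 := fun h0 =>
      mul_ne_zero hL0 (hf0 y) (le_antisymm ((hLm y).trans h0.le) bot_le)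
    refine edist_toReal_div_add_one_lt (mul_ne_zero hwt0 hmt) (ENNReal.mul_ne_top hwt hy1) hδ ?_
    have h1 : ∑ k ∈ Finset.univ.erase t, w k * m k y = S y * (w t * ENNReal.ofReal L * f y) := by
      rw [hS, Finset.sum_mul]
      refine Finset.sum_congr rfl fun k _ => ?_
      calc w k * m k y = (w k / (w t * ENNReal.ofReal L) * (w t * ENNReal.ofReal L)) *
            (m k y / f y * f y) := by
            rw [ENNReal.div_mul_cancel hcd hcd', ENNReal.div_mul_cancel (hf0 y) (hft y)]
        _ = _ := by rw [hc]; ring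
    calc ∑ k ∈ Finset.univ.erase t, w k * m k y = S y * (w t * ENNReal.ofReal L * f y) := h1
      _ < δ * (w t * ENNReal.ofReal L * f y) :=
          (ENNReal.mul_lt_mul_iff_left (mul_ne_zero hcd (hf0 y))
            (ENNReal.mul_ne_top hcd' (hft y))).2 hy2
      _ ≤ δ * (w t * m t y) := by
          rw [mul_assoc]
          gcongr
          exact hLm y
  have hPE : P {ω | (fun i => μ i + e i ω) ∈ E} ≤ ∫⁻ y, f y * E.indicator 1 y := by
    rw [← lintegral_add_noise hσ₀ he_law he_indep μ (measurable_one.indicator hE)]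
    have hae : AEMeasurable (fun ω => fun i => μ i + e i ω) P :=
      aemeasurable_pi_lambda _ fun i => (he_law i).aemeasurable.const_add _
    exact (lintegral_indicator_one₀ (hae.nullMeasurableSet_preimage hE)).ge
  refine (measure_mono hsub).trans (hPE.trans ?_)
  have hδθ0 : δ ^ θ ≠ 0 := by simp [hδ0, hδ]
  have hδθ : δ ^ θ ≠ ⊤ := ENNReal.rpow_ne_top_of_nonneg hθ0.le hδ
  calc ∫⁻ y, f y * E.indicator 1 y ≤ ∫⁻ y, (δ ^ θ)⁻¹ *
        ∑ k ∈ Finset.univ.erase t, c k ^ θ * (f y * (m k y / f y) ^ θ) := by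
        refine lintegral_mono_ae ?_
        filter_upwards [ae_marginalDensity_lt_top hn r hα₁ hα₂ X hA ha₁ ha₂ hq t] with y hy
        by_cases hyE : y ∈ E
        · have hy2 : δ ≤ S y := hyE.resolve_left hy.ne
          rw [Set.indicator_of_mem hyE, Pi.one_apply, mul_one]
          have h1 : δ ^ θ ≤ ∑ k ∈ Finset.univ.erase t, (c k * (m k y / f y)) ^ θ :=
            (ENNReal.rpow_le_rpow hy2 hθ0.le).trans (sum_rpow_le _ _ hθ0 hθ1.le)
          calc f y = (δ ^ θ)⁻¹ * (f y * δ ^ θ) := by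
                rw [mul_comm, mul_assoc, ENNReal.mul_inv_cancel hδθ0 hδθ, mul_one]
            _ ≤ (δ ^ θ)⁻¹ * (f y * ∑ k ∈ Finset.univ.erase t, (c k * (m k y / f y)) ^ θ) := by
                gcongr
            _ = _ := by
                rw [Finset.mul_sum]
                congr 1
                refine Finset.sum_congr rfl fun k _ => ?_
                rw [ENNReal.mul_rpow_of_nonneg _ _ hθ0.le]
                ring
        · rw [Set.indicator_of_notMem hyE, mul_zero]
          exact bot_le
    _ = _ := by
        have hk : ∀ k, Measurable fun y => f y * (m k y / f y) ^ θ := fun k =>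
          hfm.mul (((hmm k).div hfm).pow_const θ)
        rw [lintegral_const_mul _ (Finset.measurable_fun_sum _ fun k _ => (hk k).const_mul _),
          lintegral_finsetSum _ fun k _ => (hk k).const_mul _]
        congr 1
        refine Finset.sum_congr rfl fun k _ => ?_
        rw [lintegral_const_mul _ (hk k)]
-- Separation of wrong models, and summation against the complexity prior.
theorem mulVec_eq_modelCols_mulVec {n p : ℕ} (X : Matrix (Fin n) (Fin p) ℝ) (k : Finset (Fin p))
    (b : Fin p → ℝ) (hb : ∀ j ∉ k, b j = 0) :
    X.mulVec b = (modelCols X k).mulVec fun i : k => b i := by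
  funext i
  rw [Matrix.mulVec, Matrix.mulVec, dotProduct, dotProduct]
  simp only [modelCols, Matrix.submatrix_apply, id]
  rw [Finset.sum_coe_sort k fun j => X i j * b j]
  exact (Finset.sum_subset (Finset.subset_univ k) fun j _ hj => by rw [hb j hj, mul_zero]).symm

/-- A model that misses a true covariate stays away from the true mean. -/
theorem le_sum_sub_modelCols_mulVec_sq {n p : ℕ} {X : Matrix (Fin n) (Fin p) ℝ}
    {k t : Finset (Fin p)} {ε : ℝ} (hε : 0 < ε) (h : DesignBounds X (k ∪ t) ε) {b : Fin p → ℝ}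
    (hb : ∀ j ∉ t, b j = 0) {bm : ℝ} (hbm : 0 < bm) (hb' : ∀ j ∈ t, bm ≤ |b j|) (hkt : ¬ t ⊆ k)
    (v : k → ℝ) :
    n * ε * bm ^ 2 ≤ ∑ i, (X.mulVec b i - (modelCols X k).mulVec v i) ^ 2 := by
  classical
  obtain ⟨j, hjt, hjk⟩ := Finset.not_subset.1 hkt
  set V : Fin p → ℝ := fun j => if hj : j ∈ k then v ⟨j, hj⟩ else 0 with hV
  have hVk : (modelCols X k).mulVec v = X.mulVec V := by
    rw [mulVec_eq_modelCols_mulVec X k V fun j hj => by simp [hV, hj]]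
    congr 1
    funext i
    simp [hV]
  have hd : ∀ i, X.mulVec b i - (modelCols X k).mulVec v i =
      (modelCols X (k ∪ t)).mulVec (fun i : (k ∪ t : Finset (Fin p)) => (b - V) i) i := by
    intro i
    rw [hVk, ← mulVec_eq_modelCols_mulVec X (k ∪ t) (b - V), Matrix.mulVec_sub, Pi.sub_apply]
    intro j hj
    rw [Finset.mem_union, not_or] at hj
    simp [hV, hj.1, hb j hj.2]
  simp_rw [hd]
  refine le_trans ?_ (h _).1
  refine mul_le_mul_of_nonneg_left ?_ (by positivity)
  have hj : j ∈ k ∪ t := Finset.mem_union_right _ hjt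
  -- The missed covariate `j` alone suffices: its coefficient in the difference is the true one,
  -- whatever `v` is.
  refine le_trans ?_ (Finset.single_le_sum
    (f := fun i : (k ∪ t : Finset (Fin p)) => ((b - V) i) ^ 2)
    (fun i _ => sq_nonneg _) (Finset.mem_univ ⟨j, hj⟩))
  have : (b - V) j = b j := by simp [hV, hjk]
  simp only [this]
  rw [← sq_abs (b j)]
  exact pow_le_pow_left₀ hbm.le (hb' j hjt) 2

theorem complexityWeight_eq {p : ℕ} {c₁ : ℝ} (hc₁ : 0 < c₁) (c₂ : ℝ) {q : ℕ} {k : Finset (Fin p)}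
    (hk : k.card ≤ q) : complexityWeight c₁ c₂ q k = (c₁⁻¹ * (p : ℝ) ^ (-c₂)) ^ k.card := by
  rw [complexityWeight, if_pos hk, mul_pow, rpow_neg hc₁.le, rpow_natCast, inv_pow, ← neg_mul,
    rpow_mul (Nat.cast_nonneg p), rpow_natCast]

theorem complexityWeight_nonneg {p : ℕ} {c₁ : ℝ} (hc₁ : 0 < c₁) (c₂ : ℝ) (q : ℕ)
    (k : Finset (Fin p)) : 0 ≤ complexityWeight c₁ c₂ q k := by
  unfold complexityWeight
  split_ifs <;> positivity

theorem sum_complexityWeight_pos {p : ℕ} {c₁ : ℝ} (hc₁ : 0 < c₁) (c₂ : ℝ) (q : ℕ) :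
    0 < ∑ l : Finset (Fin p), complexityWeight c₁ c₂ q l :=
  Finset.sum_pos' (fun l _ => complexityWeight_nonneg hc₁ c₂ q l)
    ⟨∅, Finset.mem_univ _, by simp [complexityWeight]⟩

theorem complexityPrior_div {p : ℕ} (hp : 0 < p) {c₁ : ℝ} (hc₁ : 0 < c₁) (c₂ : ℝ) {q : ℕ}
    {k t : Finset (Fin p)} (hk : k.card ≤ q) (ht : t.card ≤ q) {L : ℝ} (hL : 0 < L) :
    ENNReal.ofReal (complexityPrior c₁ c₂ q k) /
        (ENNReal.ofReal (complexityPrior c₁ c₂ q t) * ENNReal.ofReal L) =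
      ENNReal.ofReal ((c₁⁻¹ * (p : ℝ) ^ (-c₂)) ^ k.card /
        ((c₁⁻¹ * (p : ℝ) ^ (-c₂)) ^ t.card * L)) := by
  have hZ := sum_complexityWeight_pos (p := p) hc₁ c₂ q
  have hp' : (0 : ℝ) < p := by exact_mod_cast hp
  have hx : 0 < c₁⁻¹ * (p : ℝ) ^ (-c₂) := by positivity
  rw [complexityPrior, complexityPrior, complexityWeight_eq hc₁ c₂ hk,
    complexityWeight_eq hc₁ c₂ ht, ← ENNReal.ofReal_mul (by positivity),
    ← ENNReal.ofReal_div_of_pos (by positivity)]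
  congr 1
  field_simp

/-- The binomial theorem and `(1 + z)^p ≤ exp (p z)`. Removing the empty set makes the bound small
when `p z` is small. -/
theorem sum_pow_card_nonempty_le {p : ℕ} {z : ℝ} (hz : 0 ≤ z) :
    ∑ k ∈ (Finset.univ : Finset (Finset (Fin p))).erase ∅, z ^ k.card ≤ exp (p * z) - 1 := by
  have h1 : ∑ k : Finset (Fin p), z ^ k.card = (z + 1) ^ p := by
    have := Fintype.sum_pow_mul_eq_add_pow (Fin p) z 1
    simpa using this
  have h2 := Finset.add_sum_erase (Finset.univ : Finset (Finset (Fin p))) (fun k => z ^ k.card)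
    (Finset.mem_univ ∅)
  simp only [Finset.card_empty, pow_zero] at h2
  have h3 : (z + 1) ^ p ≤ exp (p * z) := by
    rw [exp_nat_mul]
    exact pow_le_pow_left₀ (by positivity) (add_one_le_exp z) p
  linarith

theorem sum_pow_card_le {p : ℕ} {z : ℝ} (hz : 0 ≤ z) :
    ∑ k : Finset (Fin p), z ^ k.card ≤ exp (p * z) := by
  have h2 := Finset.add_sum_erase (Finset.univ : Finset (Finset (Fin p))) (fun k => z ^ k.card)
    (Finset.mem_univ ∅)
  simp only [Finset.card_empty, pow_zero] at h2
  linarith [sum_pow_card_nonempty_le (p := p) hz]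

/-- A strict superset of `t` is determined by the nonempty set of its superfluous covariates. -/
theorem sum_pow_card_sdiff_le {p : ℕ} {z : ℝ} (hz : 0 ≤ z) (t : Finset (Fin p)) :
    ∑ k ∈ (Finset.univ.erase t).filter (t ⊆ ·), z ^ (k \ t).card ≤ exp (p * z) - 1 := by
  classical
  refine le_trans ?_ (sum_pow_card_nonempty_le (p := p) hz)
  have hinj : Set.InjOn (fun k : Finset (Fin p) => k \ t)
      ((Finset.univ.erase t).filter (t ⊆ ·) : Finset (Finset (Fin p))) := by
    intro a ha b hb hab
    simp only [Finset.coe_filter, Set.mem_ofPred_eq] at ha hb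
    rw [← Finset.sdiff_union_of_subset ha.2, ← Finset.sdiff_union_of_subset hb.2]
    exact congrArg (· ∪ t) hab
  rw [← Finset.sum_image (f := fun s : Finset (Fin p) => z ^ s.card) hinj]
  refine Finset.sum_le_sum_of_subset_of_nonneg ?_ fun _ _ _ => pow_nonneg hz _
  intro s hs
  obtain ⟨k, hk, rfl⟩ := Finset.mem_image.1 hs
  rw [Finset.mem_filter, Finset.mem_erase] at hk
  refine Finset.mem_erase.2 ⟨fun h0 => hk.1.1 ?_, Finset.mem_univ _⟩
  exact Finset.Subset.antisymm (Finset.sdiff_eq_empty_iff_subset.1 h0) hk.2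

/-- Summation of moment bounds `I k` over all models other than `t`. -/
theorem sum_prior_mul_le {p : ℕ} {c₁ : ℝ} (hc₁ : 0 < c₁) (c₂ : ℝ) {q : ℕ} {t : Finset (Fin p)}
    (ht : t.card ≤ q) {L : ℝ} (hL : 0 < L) {θ : ℝ} (hθ0 : 0 < θ) (I : Finset (Fin p) → ENNReal)
    {η : ℝ} (hη : 0 ≤ η)
    (hsup : ∀ k, t ⊂ k → k.card ≤ q → I k ≤ ENNReal.ofReal (L * η ^ (k \ t).card) ^ θ)
    {K : ℝ} (hK : 0 ≤ K) (H : ENNReal)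
    (hns : ∀ k, ¬ t ⊆ k → k.card ≤ q → I k ≤ ENNReal.ofReal (K ^ k.card) ^ θ * H) :
    ∑ k ∈ Finset.univ.erase t, (ENNReal.ofReal (complexityPrior c₁ c₂ q k) /
        (ENNReal.ofReal (complexityPrior c₁ c₂ q t) * ENNReal.ofReal L)) ^ θ * I k ≤
      ENNReal.ofReal (exp (p * (c₁⁻¹ * (p : ℝ) ^ (-c₂) * η) ^ θ) - 1) +
        ENNReal.ofReal (exp (p * (c₁⁻¹ * (p : ℝ) ^ (-c₂) * K) ^ θ)) *
          (ENNReal.ofReal (((c₁⁻¹ * (p : ℝ) ^ (-c₂)) ^ t.card * L)⁻¹) ^ θ * H) := by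
  classical
  rcases Nat.eq_zero_or_pos p with rfl | hp
  · have : (Finset.univ : Finset (Finset (Fin 0))).erase t = ∅ := by
      rw [Finset.eq_empty_iff_forall_notMem]
      intro k hk
      exact (Finset.mem_erase.1 hk).1 (Subsingleton.elim _ _)
    rw [this, Finset.sum_empty]
    exact bot_le
  set x : ℝ := c₁⁻¹ * (p : ℝ) ^ (-c₂) with hx
  have hp' : (0 : ℝ) < p := by exact_mod_cast hp
  have hx0 : 0 < x := by positivity
  clear_value x
  rw [← Finset.sum_filter_add_sum_filter_not (Finset.univ.erase t) (t ⊆ ·)]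
  have hzero : ∀ k : Finset (Fin p), ¬ k.card ≤ q →
      (ENNReal.ofReal (complexityPrior c₁ c₂ q k) /
        (ENNReal.ofReal (complexityPrior c₁ c₂ q t) * ENNReal.ofReal L)) ^ θ * I k = 0 := by
    intro k hk
    simp [complexityPrior, complexityWeight, hk, hθ0]
  refine add_le_add ?_ ?_
  · refine le_trans ?_ (ENNReal.ofReal_le_ofReal (sum_pow_card_sdiff_le (p := p)
      (z := (x * η) ^ θ) (by positivity) t))
    rw [ENNReal.ofReal_sum_of_nonneg fun _ _ => by positivity]
    refine Finset.sum_le_sum fun k hk => ?_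
    by_cases hkq : k.card ≤ q
    · rw [Finset.mem_filter, Finset.mem_erase] at hk
      have hss : t ⊂ k := ⟨hk.2, fun h => hk.1.1 (Finset.Subset.antisymm h hk.2)⟩
      have hcard : k.card = (k \ t).card + t.card := by
        rw [Finset.card_sdiff_add_card_eq_card hk.2]
      rw [complexityPrior_div hp hc₁ c₂ hkq ht hL, ← hx]
      -- The factors `x ^ |t|` and `L` cancel, leaving a power of `(x η)^θ` with the number of
      -- superfluous covariates as exponent.
      refine (mul_le_mul_right (hsup k hss hkq) _).trans (le_of_eq ?_)
      rw [← ENNReal.mul_rpow_of_nonneg _ _ hθ0.le, ← ENNReal.ofReal_mul (by positivity),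
        ENNReal.ofReal_rpow_of_nonneg (by positivity) hθ0.le, rpow_pow_comm (by positivity)]
      congr 2
      rw [hcard, pow_add, mul_pow]
      field_simp
    · rw [hzero k hkq]
      exact bot_le
  · refine le_trans ?_ (mul_le_mul_left (ENNReal.ofReal_le_ofReal (sum_pow_card_le (p := p)
      (z := (x * K) ^ θ) (by positivity))) _)
    rw [ENNReal.ofReal_sum_of_nonneg fun _ _ => by positivity, Finset.sum_mul]
    refine le_trans ?_ (Finset.sum_le_sum_of_subset (Finset.subset_univ
      ((Finset.univ.erase t).filter (¬ t ⊆ ·))))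
    refine Finset.sum_le_sum fun k hk => ?_
    by_cases hkq : k.card ≤ q
    · rw [Finset.mem_filter] at hk
      rw [complexityPrior_div hp hc₁ c₂ hkq ht hL, ← hx]
      refine (mul_le_mul_right (hns k hk.2 hkq) _).trans (le_of_eq ?_)
      rw [← mul_assoc, ← mul_assoc, ← ENNReal.mul_rpow_of_nonneg _ _ hθ0.le,
        rpow_pow_comm (by positivity),
        ← ENNReal.ofReal_rpow_of_nonneg (by positivity) hθ0.le,
        ← ENNReal.mul_rpow_of_nonneg _ _ hθ0.le, ← ENNReal.ofReal_mul (by positivity),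
        ← ENNReal.ofReal_mul (by positivity)]
      congr 3
      rw [mul_pow]
      field_simp
    · rw [hzero k hkq]
      exact bot_le

/-- The moment bound of a model with `j` superfluous covariates, relative to the lower bound of
the true marginal density. -/
theorem superset_bound_le {r : ℕ} (hr : 1 ≤ r) {C c : ℝ} (hC : 1 ≤ C) (hc : 0 < c) {T j q n : ℕ}
    (hj : 1 ≤ j) (hjq : T + j ≤ q) (hqn : q ≤ n) {ε : ℝ} (hε : 0 < ε) (hε1 : ε ≤ 1) :
    C ^ (T + j + 1) * ((((T + j : ℕ) : ℝ) ^ (2 * ((r : ℝ) + 1 / 2))) ^ (T + j) *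
        ((n : ℝ) ^ (-((r : ℝ) + 1 / 2))) ^ (T + j)) *
        (((n * ε) ^ (-((r : ℝ) + 1 / 2))) ^ j * ((n * ε) ^ (-(1 / 2) : ℝ)) ^ T) ≤
      c * ((n : ℝ) ^ (-((r : ℝ) + 1 / 2)) * √(ε / n)) ^ T / n *
        (max 1 c⁻¹ * C ^ (T + 2) * 2 ^ (T + 1) *
          (2 ^ (T + 1)) ^ (2 * ((r : ℝ) + 1 / 2) * T) * ((q : ℝ) / n) ^ 2 *
          (ε⁻¹ ^ ((r : ℝ) + 1 / 2) * ε⁻¹ ^ T)) ^ j := by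
  set ρ : ℝ := (r : ℝ) + 1 / 2 with hρ
  have hρ1 : 3 ≤ 2 * ρ := by
    have : (1 : ℝ) ≤ r := by exact_mod_cast hr
    rw [hρ]; linarith
  have hn : 0 < n := by omega
  have hn' : (0 : ℝ) < n := by exact_mod_cast hn
  set k : ℕ := T + j with hk
  have hk0 : (0 : ℝ) < k := by exact_mod_cast (show 0 < k by omega)
  have hkn : (k : ℝ) ≤ n := by exact_mod_cast hjq.trans hqn
  have hkq : (k : ℝ) ≤ q := by exact_mod_cast hjq
  have hkj : k ≤ (T + 1) * j := by
    rw [hk, add_mul, one_mul]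
    gcongr
    exact Nat.le_mul_of_pos_right T hj
  have hε' : 1 ≤ ε⁻¹ := (one_le_inv₀ hε).2 hε1
  -- Makes the `T` true covariates contribute the same power of `n` to the upper and the lower
  -- bound; only powers of `1/ε` remain.
  have hu : (n * ε) ^ (-(1 / 2) : ℝ) = ε⁻¹ * √(ε / n) := by
    rw [rpow_neg (by positivity), ← sqrt_eq_rpow, sqrt_mul hn'.le, sqrt_div hε.le]
    have h1 : √ε * √ε = ε := mul_self_sqrt hε.le
    have h2 : 0 < √ε := sqrt_pos.2 hε
    have h3 : 0 < √(n : ℝ) := sqrt_pos.2 hn'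
    field_simp
    nlinarith
  have hb : ((n : ℝ) * ε) ^ (-ρ) = (n : ℝ) ^ (-ρ) * ε⁻¹ ^ ρ := by
    rw [mul_rpow hn'.le hε.le, rpow_neg hε.le, inv_rpow hε.le]
  set b : ℝ := (n : ℝ) ^ (-ρ) with hbdef
  have hb0 : 0 < b := by positivity
  set u : ℝ := √(ε / n) with hudef
  have hu0 : 0 < u := sqrt_pos.2 (by positivity)
  set a : ℝ := (k : ℝ) ^ (2 * ρ) with ha
  have ha0 : 0 < a := by positivity
  set E : ℝ := ε⁻¹ ^ ρ with hE
  have hE0 : 0 < E := by positivity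
  -- One `b` per superfluous covariate comes from `τ`, the other from the moment factor. As `r ≥ 1`,
  -- the exponent `2 ρ` is at least `3`.
  have hab : a * b * b ≤ ((k : ℝ) / n) ^ 3 := by
    have h1 : a * b * b = ((k : ℝ) / n) ^ (2 * ρ) := by
      rw [mul_assoc, hbdef, ← rpow_add hn', ha, div_rpow hk0.le hn'.le,
        show -ρ + -ρ = -(2 * ρ) by ring, rpow_neg hn'.le]
      rfl
    rw [h1, ← rpow_natCast]
    exact rpow_le_rpow_of_exponent_ge (by positivity) ((div_le_one hn').2 hkn)
      (by exact_mod_cast hρ1)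
  have h2k : (k : ℝ) ≤ (2 ^ (T + 1)) ^ j := by
    rw [← pow_mul]
    have h1 : k ≤ 2 ^ ((T + 1) * j) := (Nat.lt_two_pow_self.le).trans
      (Nat.pow_le_pow_right two_pos hkj)
    exact_mod_cast h1
  -- Powers of `k` with a fixed exponent are absorbed into a constant per superfluous covariate,
  -- using `k ≤ (T + 1) j` and `x ≤ 2^x`.
  have haT : a ^ T ≤ ((2 ^ (T + 1)) ^ (2 * ρ * T)) ^ j := by
    rw [ha, ← rpow_natCast, ← rpow_mul hk0.le, rpow_pow_comm (by positivity)]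
    exact rpow_le_rpow hk0.le h2k (by positivity)
  -- The third factor `k/n` pays for the `1/n` lost in the lower bound, which is possible since `j ≥
  -- 1`. The other two are left as `(q/n)^2`.
  have habj : (a * b * b) ^ j * n ≤ (((q : ℝ) / n) ^ 2) ^ j * (2 ^ (T + 1)) ^ j := by
    calc (a * b * b) ^ j * n ≤ (((k : ℝ) / n) ^ 3) ^ j * n := by gcongr
      _ = (((k : ℝ) / n) ^ 2) ^ j * (((k : ℝ) / n) ^ j * n) := by
          rw [show ((k : ℝ) / n) ^ 3 = ((k : ℝ) / n) ^ 2 * (k / n) by ring, mul_pow, mul_assoc]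
      _ ≤ (((q : ℝ) / n) ^ 2) ^ j * (2 ^ (T + 1)) ^ j := by
          gcongr
          refine le_trans ?_ h2k
          have h1 : ((k : ℝ) / n) ^ j ≤ k / n :=
            pow_le_of_le_one (by positivity) ((div_le_one hn').2 hkn) (by omega)
          calc ((k : ℝ) / n) ^ j * n ≤ k / n * n := by gcongr
            _ = k := by field_simp
  have hCk : C ^ (k + 1) ≤ (C ^ (T + 2)) ^ j := by
    rw [← pow_mul]
    refine pow_le_pow_right₀ hC ?_
    calc k + 1 ≤ (T + 1) * j + j := by omega
      _ = (T + 2) * j := by ring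
  have hcj : c⁻¹ ≤ (max 1 c⁻¹) ^ j :=
    (le_max_right _ _).trans (le_self_pow₀ (le_max_left _ _) (by omega))
  have hεT : ε⁻¹ ^ T ≤ (ε⁻¹ ^ T) ^ j := le_self_pow₀ (one_le_pow₀ hε') (by omega)
  rw [hb, hu]
  calc C ^ (k + 1) * (a ^ k * b ^ k) * ((b * E) ^ j * (ε⁻¹ * u) ^ T)
      = c * (b * u) ^ T / n * (c⁻¹ * C ^ (k + 1) * a ^ T * ((a * b * b) ^ j * n) *
          (E ^ j * ε⁻¹ ^ T)) := by
        rw [hk]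
        simp only [mul_pow, pow_add]
        field_simp
    _ ≤ c * (b * u) ^ T / n * ((max 1 c⁻¹) ^ j * (C ^ (T + 2)) ^ j *
          ((2 ^ (T + 1)) ^ (2 * ρ * T)) ^ j * ((((q : ℝ) / n) ^ 2) ^ j * (2 ^ (T + 1)) ^ j) *
          (E ^ j * (ε⁻¹ ^ T) ^ j)) := by
        gcongr
    _ = _ := by
        rw [← mul_pow, ← mul_pow, ← mul_pow, ← mul_pow, ← mul_pow, ← mul_pow]
        congr 2
        ring
-- The finite-sample bound.
theorem mem_modelOf {t : Finset ℕ} {p : ℕ} {j : Fin p} : j ∈ modelOf t p ↔ (j : ℕ) ∈ t := by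
  simp [modelOf]

theorem card_modelOf {t : Finset ℕ} {p : ℕ} (h : ∀ i ∈ t, i < p) :
    (modelOf t p).card = t.card := by
  refine Finset.card_bij (fun j _ => (j : ℕ)) (fun j hj => mem_modelOf.1 hj)
    (fun a _ b _ hab => Fin.ext hab) fun i hi => ⟨⟨i, h i hi⟩, mem_modelOf.2 hi, rfl⟩

theorem card_filter_coe {ι : Type*} (k : Finset ι) (Q : ι → Prop) [DecidablePred Q] :
    (Finset.univ.filter fun i : k => Q i).card = (k.filter Q).card := by
  rw [Finset.card_filter, Finset.card_filter]
  exact Finset.sum_coe_sort k fun i => if Q i then 1 else 0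

theorem exists_abs_bounds {t : Finset ℕ} {β₀ : ℕ → ℝ} (hβ₀ : ∀ i, β₀ i ≠ 0 ↔ i ∈ t) :
    ∃ bm M : ℝ, 0 < bm ∧ 0 ≤ M ∧ (∀ i ∈ t, bm ≤ |β₀ i|) ∧ ∀ i, |β₀ i| ≤ M := by
  have hM : ∀ i ∈ t, |β₀ i| ≤ ∑ j ∈ t, |β₀ j| := fun i hi =>
    Finset.single_le_sum (f := fun j => |β₀ j|) (fun j _ => abs_nonneg _) hi
  have hM0 : 0 ≤ ∑ j ∈ t, |β₀ j| := Finset.sum_nonneg fun j _ => abs_nonneg _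
  have hb : ∃ bm : ℝ, 0 < bm ∧ ∀ i ∈ t, bm ≤ |β₀ i| := by
    rcases t.eq_empty_or_nonempty with rfl | hne
    · exact ⟨1, one_pos, by simp⟩
    · obtain ⟨i, hi, h⟩ := t.exists_min_image (fun i => |β₀ i|) hne
      exact ⟨|β₀ i|, abs_pos.2 ((hβ₀ i).2 hi), h⟩
  obtain ⟨bm, hbm, hb⟩ := hb
  refine ⟨bm, _, hbm, hM0, hb, fun i => ?_⟩
  by_cases hi : i ∈ t
  · exact hM i hi
  · rw [not_not.1 fun h => hi ((hβ₀ i).1 h), abs_zero]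
    exact hM0

/-- Finite-sample bound for the deviation of the posterior probability of the true model
from `1`. -/
theorem exists_measure_posterior_le {Ω : Type*} [MeasurableSpace Ω] {P : Measure Ω}
    [IsProbabilityMeasure P] {r : ℕ} (hr : 1 ≤ r) {α₁ α₂ : ℝ} (hα₁ : 0 < α₁) (hα₂ : 0 < α₂)
    {c₁ : ℝ} (hc₁ : 0 < c₁) (c₂ : ℝ) {t : Finset ℕ} {β₀ : ℕ → ℝ} (hβ₀ : ∀ i, β₀ i ≠ 0 ↔ i ∈ t)
    {σ₀ : NNReal} (hσ₀ : 0 < σ₀) {a₁ a₂ : ℝ} (ha₁ : 0 < a₁) (ha₂ : 0 < a₂) {θ : ℝ} (hθ0 : 0 < θ)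
    (hθ1 : θ < 1) :
    ∃ bm D c γ₀ : ℝ, 0 < bm ∧ 0 < D ∧ 0 < c ∧ 0 < γ₀ ∧ ∀ {n p q : ℕ} (_ : 0 < n)
      (_ : ∀ i ∈ t, i < p) {X : Matrix (Fin n) (Fin p) ℝ} {A : Matrix (Fin p) (Fin p) ℝ}
      (_ : A.IsHermitian) (_ : QuadBounds A a₁ a₂) {e : Fin n → Ω → ℝ}
      (_ : ∀ i, HasLaw (e i) (gaussianReal 0 (σ₀ ^ 2)) P) (_ : iIndepFun e P) (_ : t.card ≤ q)
      (_ : 2 * (q + t.card + 1) ≤ n) {ε : ℝ} (_ : 0 < ε) (_ : ε < 1)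
      (_ : ∀ k : Finset (Fin p), k.card ≤ q + t.card → DesignBounds X k ε) (_ : 1 ≤ n * ε)
      (_ : 2 * √(ε / n) ≤ bm) {δ : ENNReal} (_ : δ ≠ 0) (_ : δ ≠ ⊤),
      P {ω | δ ≤ edist (_root_.posterior r α₁ α₂ c₁ c₂ q X A (modelOf t p)
          (response X β₀ fun i => e i ω)) 1} ≤
        (δ ^ θ)⁻¹ * (ENNReal.ofReal (exp (p * (c₁⁻¹ * (p : ℝ) ^ (-c₂) *
            (D * ((q : ℝ) / n) ^ 2 * (ε⁻¹ ^ ((r : ℝ) + 1 / 2) * ε⁻¹ ^ t.card))) ^ θ) - 1) +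
          ENNReal.ofReal (exp (p * (c₁⁻¹ * (p : ℝ) ^ (-c₂) * massBound r a₁ a₂) ^ θ)) *
            (ENNReal.ofReal (((c₁⁻¹ * (p : ℝ) ^ (-c₂)) ^ t.card *
                (c * ((n : ℝ) ^ (-((r : ℝ) + 1 / 2)) * √(ε / n)) ^ t.card / n))⁻¹) ^ θ *
              (ENNReal.ofReal (exp (1 / 2 - ε * γ₀ * n / 16)) ^ θ +
                ENNReal.ofReal (exp (-(ε * γ₀ * n / 2))) ^ (1 - θ)))) := by
  classical
  obtain ⟨bm, M, hbm, hM0, hb, hM⟩ := exists_abs_bounds hβ₀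
  have hs : (0 : ℝ) < (σ₀ : ℝ) ^ 2 := by positivity
  obtain ⟨C, hC, hU⟩ := exists_lintegral_ratio_rpow_le_of_mem r hα₁ hα₂ ha₁ ha₂ M hs hθ0 hθ1
  obtain ⟨c, hc, hLow⟩ := exists_le_marginalDensity r hα₁ hα₂ ha₁ ha₂ (M := M) hbm hs t.card
  refine ⟨bm, max 1 c⁻¹ * C ^ (t.card + 2) * 2 ^ (t.card + 1) *
    (2 ^ (t.card + 1)) ^ (2 * ((r : ℝ) + 1 / 2) * t.card), c, min 1 (bm ^ 2 / (6 * (σ₀ : ℝ) ^ 2)),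
    hbm, by positivity, hc, by positivity, ?_⟩
  intro n p q hn htp X A hA hqA e he_law he_indep htq hqn ε hε hε1 hX hnε hεbm δ hδ0 hδ
  have hn' : (0 : ℝ) < n := by exact_mod_cast hn
  set T := modelOf t p with hT
  have hTc : T.card = t.card := card_modelOf htp
  set b : Fin p → ℝ := fun j => β₀ j with hbdef
  have hb0 : ∀ j ∉ T, b j = 0 := fun j hj =>
    not_not.1 fun h => hj (mem_modelOf.2 ((hβ₀ j).1 h))
  have hbT : ∀ j ∈ T, bm ≤ |b j| := fun j hj => hb j (mem_modelOf.1 hj)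
  set L : ℝ := c * ((n : ℝ) ^ (-((r : ℝ) + 1 / 2)) * √(ε / n)) ^ t.card / n with hL
  have hu : 0 < √(ε / n) := sqrt_pos.2 (by positivity)
  have hL0 : 0 < L := by positivity
  have hTw : 0 < complexityPrior c₁ c₂ q T := by
    refine div_pos ?_ (sum_complexityWeight_pos hc₁ c₂ q)
    rw [complexityWeight_eq hc₁ c₂ (hTc.trans_le htq)]
    rcases Nat.eq_zero_or_pos T.card with h0 | h0
    · simp [h0]
    · have hp : 0 < p := by
        obtain ⟨j, -⟩ := Finset.card_pos.1 h0
        exact j.pos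
      have hp' : (0 : ℝ) < p := by exact_mod_cast hp
      positivity
  have hμ : ∀ k, T ⊆ k → X.mulVec b = (modelCols X k).mulVec fun i : k => b i := fun k hk =>
    mulVec_eq_modelCols_mulVec X k b fun j hj => hb0 j fun h => hj (hk h)
  have hLm : ∀ y, ENNReal.ofReal L * ENNReal.ofReal (isoDensity (X.mulVec b) ((σ₀ : ℝ) ^ 2) y) ≤
      marginalDensity r α₁ α₂ X A T y := by
    intro y
    rw [hμ T (Finset.Subset.refl T)]
    exact hLow hn hA hqA hε (hX T (by omega)) _ (fun i => hbT i i.2) (fun i => hM i) hεbm hTc y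
  refine (measure_posterior_le hn hσ₀ he_law he_indep r hα₁ hα₂ c₁ c₂ q X hA ha₁ ha₂ hqA T hTw β₀
    rfl hL0 hLm hθ0 hθ1 hδ0 hδ).trans ?_
  gcongr
  have hmain := sum_prior_mul_le hc₁ c₂ (hTc.trans_le htq) hL0 hθ0
    (fun k => ∫⁻ y, ENNReal.ofReal (isoDensity (X.mulVec b) ((σ₀ : ℝ) ^ 2) y) *
      (marginalDensity r α₁ α₂ X A k y /
        ENNReal.ofReal (isoDensity (X.mulVec b) ((σ₀ : ℝ) ^ 2) y)) ^ θ)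
    (η := max 1 c⁻¹ * C ^ (t.card + 2) * 2 ^ (t.card + 1) *
      (2 ^ (t.card + 1)) ^ (2 * ((r : ℝ) + 1 / 2) * t.card) * ((q : ℝ) / n) ^ 2 *
      (ε⁻¹ ^ ((r : ℝ) + 1 / 2) * ε⁻¹ ^ t.card)) (by positivity) ?_
    (K := massBound r a₁ a₂) (by unfold massBound; positivity)
    (ENNReal.ofReal (exp (1 / 2 - ε * min 1 (bm ^ 2 / (6 * (σ₀ : ℝ) ^ 2)) * n / 16)) ^ θ +
      ENNReal.ofReal (exp (-(ε * min 1 (bm ^ 2 / (6 * (σ₀ : ℝ) ^ 2)) * n / 2))) ^ (1 - θ)) ?_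
  · rw [hTc] at hmain
    exact hmain
  · intro k hk hkq
    have hcard : k.card = t.card + (k \ T).card := by
      rw [← hTc, add_comm, Finset.card_sdiff_add_card_eq_card hk.1]
    have hpos : 1 ≤ (k \ T).card := Finset.card_pos.2 (Finset.sdiff_nonempty.2 hk.2)
    have h0 : (Finset.univ.filter fun i : k => b i = 0).card = (k \ T).card := by
      rw [card_filter_coe k fun j => b j = 0]
      congr 1
      ext j
      rw [Finset.mem_filter, Finset.mem_sdiff, hT, mem_modelOf, ← hβ₀, not_not]
    have h1 : (Finset.univ.filter fun i : k => b i ≠ 0).card = t.card := by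
      rw [card_filter_coe k fun j => b j ≠ 0, ← hTc]
      congr 1
      ext j
      rw [Finset.mem_filter, hβ₀, ← mem_modelOf (p := p)]
      exact ⟨fun h => h.2, fun h => ⟨hk.1 h, h⟩⟩
    have := hU hn hA hqA (hX k (by omega)) hnε (fun i : k => b i) fun i => hM i
    simp only [hμ k hk.1]
    refine this.trans ?_
    rw [h0, h1, hcard]
    refine ENNReal.rpow_le_rpow (ENNReal.ofReal_le_ofReal ?_) hθ0.le
    exact superset_bound_le (T := t.card) (j := (k \ T).card) (q := q) (n := n) hr hC hc hpos
      (hcard ▸ hkq) (by omega) hε hε1.le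
  · intro k hk hkq
    refine lintegral_ratio_rpow_le_of_dist r hα₁ hα₂ X hA ha₁ ha₂ hqA k (by omega) _ hs
      (D := n * ε * bm ^ 2) (by positivity) ?_ ?_ ?_ hθ0 hθ1
    · exact mul_le_one₀ hε1.le (by positivity) (min_le_left _ _)
    · calc ε * min 1 (bm ^ 2 / (6 * (σ₀ : ℝ) ^ 2)) * n ≤ ε * (bm ^ 2 / (6 * (σ₀ : ℝ) ^ 2)) * n := by
            gcongr
            exact min_le_right _ _
        _ = _ := by ring
    -- The distance to the true mean is controlled by the design of `k ∪ t`; this is why the design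
    -- bounds are required up to size `q + |t|`.
    · refine le_sum_sub_modelCols_mulVec_sq hε (hX _ ?_) hb0 hbm hbT hk
      exact (Finset.card_union_le _ _).trans (by omega)

/-! ### Asymptotics of the finite-sample bound. -/

open Filter Asymptotics Topology

/-- The prior penalty absorbs the number of covariates: `p · p^(-c₂ θ) ≤ 1`. -/
theorem mul_rpow_prior_le {p : ℕ} {c₁ c₂ θ η : ℝ} (hc₁ : 0 < c₁) (hc : 1 ≤ c₂ * θ) (hη : 0 ≤ η) :
    p * (c₁⁻¹ * (p : ℝ) ^ (-c₂) * η) ^ θ ≤ (c₁⁻¹ * η) ^ θ := by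
  rcases Nat.eq_zero_or_pos p with rfl | hp
  · rw [Nat.cast_zero, zero_mul]
    positivity
  · have hp' : (1 : ℝ) ≤ p := by exact_mod_cast hp
    have hp0 : (0 : ℝ) < p := by positivity
    rw [show c₁⁻¹ * (p : ℝ) ^ (-c₂) * η = (p : ℝ) ^ (-c₂) * (c₁⁻¹ * η) by ring,
      mul_rpow (by positivity) (by positivity), ← mul_assoc, ← rpow_mul hp0.le]
    have h1 : (p : ℝ) * (p : ℝ) ^ (-c₂ * θ) ≤ 1 := by
      nth_rw 1 [← rpow_one (p : ℝ)]
      rw [← rpow_add hp0]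
      exact rpow_le_one_of_one_le_of_nonpos hp' (by linarith)
    exact mul_le_of_le_one_left (by positivity) h1

theorem isLittleO_natCast_log_rpow (a : ℝ) {b : ℝ} (hb : 0 < b) :
    (fun n : ℕ => Real.log n ^ a) =o[atTop] fun n : ℕ => (n : ℝ) ^ b :=
  (isLittleO_log_rpow_rpow_atTop a hb).comp_tendsto tendsto_natCast_atTop_atTop

theorem isLittleO_natCast_rpow {a b : ℝ} (h : a < b) :
    (fun n : ℕ => (n : ℝ) ^ a) =o[atTop] fun n : ℕ => (n : ℝ) ^ b := by
  refine ((isBigO_refl (fun n : ℕ => (n : ℝ) ^ a) atTop).mul_isLittleO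
    (isLittleO_natCast_log_rpow 0 (sub_pos.2 h))).congr' ?_ ?_
  · exact Eventually.of_forall fun n => by simp
  · filter_upwards [eventually_gt_atTop 0] with n hn
    rw [← rpow_add (by exact_mod_cast hn), add_sub_cancel]

theorem eventually_inv_le_rpow {ε : ℕ → ℝ}
    (hε : (fun n : ℕ => (ε n)⁻¹) =O[atTop] fun n : ℕ => Real.log n ^ (1 / 8 : ℝ)) {δ : ℝ}
    (hδ : 0 < δ) : ∀ᶠ n : ℕ in atTop, (ε n)⁻¹ ≤ (n : ℝ) ^ δ := by
  have h := (hε.trans_isLittleO (isLittleO_natCast_log_rpow _ hδ)).bound one_pos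
  filter_upwards [h] with n hn
  rw [one_mul, norm_of_nonneg (rpow_nonneg (Nat.cast_nonneg n) δ)] at hn
  exact (le_abs_self _).trans hn

theorem tendsto_size_div {q : ℕ → ℕ} {ξ : ℝ} (hξ : ξ < 1)
    (hq : (fun n : ℕ => (q n : ℝ)) =O[atTop] fun n : ℕ => (n : ℝ) ^ ξ) :
    Tendsto (fun n : ℕ => (q n : ℝ) / n) atTop (𝓝 0) := by
  have h1 : (fun n : ℕ => (n : ℝ) ^ ξ) =o[atTop] fun n : ℕ => (n : ℝ) ^ (1 : ℝ) :=
    isLittleO_natCast_rpow hξ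
  simp only [rpow_one] at h1
  exact (hq.trans_isLittleO h1).tendsto_div_nhds_zero

/-- `(q/n)^2` decays at least like the power `n^(-2(1-ξ))`, while every power of `1/ε` is at most a
power of `log n`. -/
theorem tendsto_superset_rate {q : ℕ → ℕ} {ξ : ℝ} (hξ : ξ < 1)
    (hq : (fun n : ℕ => (q n : ℝ)) =O[atTop] fun n : ℕ => (n : ℝ) ^ ξ) {ε : ℕ → ℝ}
    (hε : (fun n : ℕ => (ε n)⁻¹) =O[atTop] fun n : ℕ => Real.log n ^ (1 / 8 : ℝ)) {ρ : ℝ}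
    (hρ : 0 ≤ ρ) (T : ℕ) (D : ℝ) :
    Tendsto (fun n : ℕ => D * ((q n : ℝ) / n) ^ 2 * ((ε n)⁻¹ ^ ρ * (ε n)⁻¹ ^ T)) atTop (𝓝 0) := by
  have hlog : ∀ᶠ n : ℕ in atTop, 0 < Real.log n := by
    filter_upwards [eventually_gt_atTop 1] with n hn
    exact log_pos (by exact_mod_cast hn)
  have h1 : (fun n : ℕ => (ε n)⁻¹ ^ ρ * (ε n)⁻¹ ^ T) =O[atTop]
      fun n : ℕ => Real.log n ^ ((ρ + T) / 8) := by
    have h2 := (hε.rpow hρ (hlog.mono fun n hn => (rpow_pos_of_pos hn _).le)).mul (hε.pow T)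
    refine h2.congr' EventuallyEq.rfl ?_
    filter_upwards [hlog] with n hn
    rw [← rpow_natCast, ← rpow_mul hn.le, ← rpow_mul hn.le, ← rpow_add hn]
    congr 1
    ring
  have h3 : (fun n : ℕ => (q n : ℝ) / n) =O[atTop] fun n : ℕ => (n : ℝ) ^ (ξ - 1) := by
    refine (hq.mul (isBigO_refl (fun n : ℕ => (n : ℝ)⁻¹) atTop)).congr' ?_ ?_
    · exact Eventually.of_forall fun n => rfl
    · filter_upwards [eventually_gt_atTop 0] with n hn
      rw [rpow_sub_one (by positivity), div_eq_mul_inv]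
  have h4 : (fun n : ℕ => D * ((q n : ℝ) / n) ^ 2 * ((ε n)⁻¹ ^ ρ * (ε n)⁻¹ ^ T)) =o[atTop]
      fun _ : ℕ => (1 : ℝ) := by
    refine (((h3.pow 2).const_mul_left D).mul_isLittleO (h1.trans_isLittleO
      (isLittleO_natCast_log_rpow _ (b := 2 * (1 - ξ)) (by linarith)))).congr'
      EventuallyEq.rfl ?_
    filter_upwards [eventually_gt_atTop 0] with n hn
    have hn' : (0 : ℝ) < n := by exact_mod_cast hn
    rw [← rpow_natCast, ← rpow_mul hn'.le, ← rpow_add hn']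
    rw [show (ξ - 1) * ((2 : ℕ) : ℝ) + 2 * (1 - ξ) = 0 by push_cast; ring, rpow_zero]
  exact (isLittleO_one_iff ℝ).1 h4

/-- Since `ε n * n ≥ n^(1-δ)` eventually and `κ < 1 - δ`, the negative term dominates. It is the
comparison of the test's exponent with the logarithm of the prior odds and of `1/L`. -/
theorem tendsto_sub_mul_atBot {κ δ : ℝ} (hκδ : κ + δ < 1) (hδ : δ < 1) {v ε : ℕ → ℝ}
    (hv : v =O[atTop] fun n : ℕ => (n : ℝ) ^ κ) (hε0 : ∀ n, 1 ≤ n → 0 < ε n)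
    (hε : ∀ᶠ n : ℕ in atTop, (ε n)⁻¹ ≤ (n : ℝ) ^ δ) {a : ℝ} (ha : 0 < a) :
    Tendsto (fun n : ℕ => v n - a * (ε n * n)) atTop atBot := by
  have h1 : v =o[atTop] fun n : ℕ => (n : ℝ) ^ (1 - δ) :=
    hv.trans_isLittleO (isLittleO_natCast_rpow (by linarith))
  have h2 : Tendsto (fun n : ℕ => (n : ℝ) ^ (1 - δ)) atTop atTop :=
    (tendsto_rpow_atTop (by linarith)).comp tendsto_natCast_atTop_atTop
  refine tendsto_atBot_mono' _ ?_ (h2.const_mul_atTop_of_neg (r := -(a / 2)) (by linarith))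
  filter_upwards [h1.bound (half_pos ha), hε, eventually_ge_atTop 1] with n hn hεn hn1
  have hn' : (0 : ℝ) < n := by exact_mod_cast hn1
  rw [norm_of_nonneg (rpow_nonneg hn'.le _)] at hn
  have h3 : (n : ℝ) ^ (1 - δ) ≤ ε n * n := by
    rw [rpow_sub hn', rpow_one, mul_comm, div_eq_mul_inv]
    gcongr
    rw [inv_le_comm₀ (by positivity) (hε0 n hn1)]
    exact hεn
  have h4 : a * (n : ℝ) ^ (1 - δ) ≤ a * (ε n * n) := by gcongr
  linarith [(le_abs_self (v n)).trans hn]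

/-- Puts the price of a wrong model on a logarithmic scale: affine in `log p` and `log n`, hence `O
(n^κ)`. -/
theorem inv_prior_mul_le {p n T : ℕ} (hn : 0 < n) {c₁ c₂ c ε ρ : ℝ} (hc₁ : 0 < c₁) (hc₂ : 0 < c₂)
    (hc : 0 < c) (hε : 0 < ε) (hε' : ε⁻¹ ≤ n) :
    ((c₁⁻¹ * (p : ℝ) ^ (-c₂)) ^ T * (c * ((n : ℝ) ^ (-ρ) * √(ε / n)) ^ T / n))⁻¹ ≤
      exp (T * (Real.log c₁ + c₂ * Real.log p) - Real.log c + (1 + T * (ρ + 1)) * Real.log n) := by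
  have hn' : (0 : ℝ) < n := by exact_mod_cast hn
  have h1 : (c₁⁻¹ * (p : ℝ) ^ (-c₂))⁻¹ ≤ exp (Real.log c₁ + c₂ * Real.log p) := by
    rcases Nat.eq_zero_or_pos p with rfl | hp
    · rw [Nat.cast_zero, zero_rpow (by linarith), mul_zero, inv_zero]
      positivity
    · have hp' : (0 : ℝ) < p := by exact_mod_cast hp
      rw [exp_add, exp_log hc₁, mul_comm c₂, ← rpow_def_of_pos hp', rpow_neg hp'.le, mul_inv,
        inv_inv, inv_inv]
  have h2 : (√(ε / n))⁻¹ ≤ n := by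
    rw [← sqrt_inv, inv_div, sqrt_le_left hn'.le, div_eq_mul_inv, sq]
    gcongr
  have h3 : ((n : ℝ) ^ (-ρ) * √(ε / n))⁻¹ ≤ exp ((ρ + 1) * Real.log n) := by
    rw [add_mul, one_mul, exp_add, exp_log hn', mul_comm ρ, ← rpow_def_of_pos hn', mul_inv,
      rpow_neg hn'.le, inv_inv]
    gcongr
  have h4 : 0 ≤ (c₁⁻¹ * (p : ℝ) ^ (-c₂))⁻¹ := by positivity
  calc _ = (c₁⁻¹ * (p : ℝ) ^ (-c₂))⁻¹ ^ T * (c⁻¹ * ((n : ℝ) ^ (-ρ) * √(ε / n))⁻¹ ^ T * n) := by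
        rw [mul_inv, inv_div, inv_pow, inv_pow, div_eq_mul_inv, mul_inv]
        ring
    _ ≤ exp (Real.log c₁ + c₂ * Real.log p) ^ T *
          (c⁻¹ * exp ((ρ + 1) * Real.log n) ^ T * n) := by gcongr
    _ = _ := by
        rw [← exp_nat_mul, ← exp_nat_mul]
        rw [show T * (Real.log c₁ + c₂ * Real.log p) - Real.log c +
            (1 + T * (ρ + 1)) * Real.log n = T * (Real.log c₁ + c₂ * Real.log p) + -Real.log c +
            T * ((ρ + 1) * Real.log n) + Real.log n by ring, exp_add, exp_add, exp_add, exp_neg,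
          exp_log hc, exp_log hn']
        ring

end PMOM

/-! ### Strong selection consistency. -/

theorem theorem5p2
    {Ω : Type*} [MeasurableSpace Ω] (P : MeasureTheory.Measure Ω)
    [MeasureTheory.IsProbabilityMeasure P]
    -- the design: `p n` covariates, `n × p n` design matrix, `p n × p n` prior matrix
    (p : ℕ → ℕ) (X : ∀ n, Matrix (Fin n) (Fin (p n)) ℝ)
    (A : ∀ n, Matrix (Fin (p n)) (Fin (p n)) ℝ)
    -- the constants of the hierarchical model
    (r : ℕ) (hr : 1 ≤ r) (α₁ α₂ : ℝ) (hα₁ : 0 < α₁) (hα₂ : 0 < α₂)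
    (c₁ c₂ : ℝ) (hc₁ : 0 < c₁) (hc₂ : 1 < c₂)
    -- the true model, fixed in `n`: nonzero coefficients exactly on `t`
    (t : Finset ℕ) (β₀ : ℕ → ℝ) (hβ₀ : ∀ i, β₀ i ≠ 0 ↔ i ∈ t)
    (ht : ∀ᶠ n in Filter.atTop, ∀ i ∈ t, i < p n)
    -- i.i.d. normal noise of variance `σ₀²`
    (σ₀ : NNReal) (hσ₀ : 0 < σ₀) (e : ∀ n, Fin n → Ω → ℝ)
    (he_law : ∀ n i, ProbabilityTheory.HasLaw (e n i)
      (ProbabilityTheory.gaussianReal 0 (σ₀ ^ 2)) P)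
    (he_indep : ∀ n, ProbabilityTheory.iIndepFun (e n) P)
    -- bound on the model size; the true model is in the support of the prior
    (q : ℕ → ℕ) (ξ : ℝ) (hξ : ξ < 1)
    (hq : (fun n : ℕ => (q n : ℝ)) =O[Filter.atTop] fun n : ℕ => (n : ℝ) ^ ξ)
    (htq : ∀ᶠ n in Filter.atTop, t.card ≤ q n)
    -- eigenvalues of the submatrices of the design
    (ε : ℕ → ℝ) (hε : ∀ n, 1 ≤ n → 0 < ε n ∧ ε n < 1)
    (hε_rate : (fun n : ℕ => (ε n)⁻¹) =O[Filter.atTop]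
      fun n : ℕ => Real.log n ^ (1 / 8 : ℝ))
    (hX : ∀ n, 1 ≤ n → ∀ k : Finset (Fin (p n)), k.card ≤ q n + t.card →
      EigenBounds (X n) k (ε n))
    -- eigenvalues of the prior matrix
    (a₁ a₂ : ℝ) (ha₁ : 0 < a₁) (hA : ∀ n, (A n).IsHermitian)
    (hA_eig : ∀ n, 1 ≤ n → ∀ i, a₁ < (hA n).eigenvalues i ∧ (hA n).eigenvalues i < a₂)
    -- growth of the number of covariates
    (κ : ℝ) (hκ₀ : 0 < κ) (hκ₁ : κ < 1)
    (hp : (fun n : ℕ => Real.log (p n)) =O[Filter.atTop] fun n : ℕ => (n : ℝ) ^ κ) :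
    MeasureTheory.TendstoInMeasure P
      (fun n ω => posterior r α₁ α₂ c₁ c₂ (q n) (X n) (A n) (modelOf t (p n))
        (response (X n) β₀ fun i => e n i ω))
      Filter.atTop (fun _ => 1) := by
  classical
  -- Such a `θ` exists exactly because `c₂ > 1`.
  obtain ⟨θ, hθ⟩ := exists_between (inv_lt_one_of_one_lt₀ hc₂)
  have hc₂0 : 0 < c₂ := zero_lt_one.trans hc₂
  have hθ0 : 0 < θ := (inv_pos.2 hc₂0).trans hθ.1
  have hcθ : 1 ≤ c₂ * θ := ((inv_lt_iff_one_lt_mul₀' hc₂0).1 hθ.1).le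
  -- The eigenvalue condition says nothing about `a₂` when there are no covariates; the maximum is
  -- positive in any case and is still an upper bound.
  have ha₂ : 0 < max a₁ a₂ := lt_max_of_lt_left ha₁
  obtain ⟨bm, D, c, γ₀, hbm, hD, hc, hγ₀, hbound⟩ := PMOM.exists_measure_posterior_le (P := P) hr
    hα₁ hα₂ hc₁ c₂ hβ₀ hσ₀ ha₁ ha₂ hθ0 hθ.2
  set ρ : ℝ := (r : ℝ) + 1 / 2 with hρ
  have hρ0 : 0 ≤ ρ := by positivity
  -- With `δ = (1 - κ)/2` one has `κ + δ < 1`, so `n ε n` outgrows `n^κ`.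
  have hδ0 : 0 < (1 - κ) / 2 := by linarith
  have hεδ := PMOM.eventually_inv_le_rpow hε_rate hδ0
  have hinv : ∀ᶠ n : ℕ in Filter.atTop, (ε n)⁻¹ ≤ n := by
    simpa using PMOM.eventually_inv_le_rpow hε_rate one_pos
  set w : ℕ → ℝ := fun n => t.card * (Real.log c₁ + c₂ * Real.log (p n)) - Real.log c +
    (1 + t.card * (ρ + 1)) * Real.log n with hw
  have hconst : ∀ a : ℝ, (fun _ : ℕ => a) =O[Filter.atTop] fun n : ℕ => (n : ℝ) ^ κ := fun a => by
    have := (PMOM.isLittleO_natCast_rpow hκ₀).isBigO.const_mul_left a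
    simpa using this
  have hlogn : (fun n : ℕ => Real.log n) =O[Filter.atTop] fun n : ℕ => (n : ℝ) ^ κ := by
    simpa using (PMOM.isLittleO_natCast_log_rpow 1 hκ₀).isBigO
  have hwO : w =O[Filter.atTop] fun n : ℕ => (n : ℝ) ^ κ :=
    ((((hconst _).add (hp.const_mul_left c₂)).const_mul_left _).sub (hconst _)).add
      (hlogn.const_mul_left _)
  have hsup : Filter.Tendsto (fun n => ENNReal.ofReal (Real.exp ((c₁⁻¹ *
      (D * ((q n : ℝ) / n) ^ 2 * ((ε n)⁻¹ ^ ρ * (ε n)⁻¹ ^ t.card))) ^ θ) - 1))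
      Filter.atTop (nhds 0) := by
    have h1 := PMOM.tendsto_superset_rate hξ hq hε_rate hρ0 t.card D
    have h2 := ((h1.const_mul c₁⁻¹).rpow_const (p := θ) (Or.inr hθ0.le)).rexp.sub_const 1
    rw [mul_zero, Real.zero_rpow hθ0.ne', Real.exp_zero, sub_self] at h2
    simpa using ENNReal.tendsto_ofReal h2
  have hexp : ∀ {v : ℕ → ℝ} {a : ℝ}, v =O[Filter.atTop] (fun n : ℕ => (n : ℝ) ^ κ) → 0 < a →
      Filter.Tendsto (fun n => ENNReal.ofReal (Real.exp (v n - a * (ε n * n))))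
        Filter.atTop (nhds 0) := by
    intro v a hv ha
    have h1 := Real.tendsto_exp_atBot.comp (PMOM.tendsto_sub_mul_atBot (by linarith)
      (by linarith) hv (fun n hn => (hε n hn).1) hεδ ha)
    simpa using ENNReal.tendsto_ofReal h1
  -- The two errors of the test, each multiplied by the price `exp (θ w n)` of prior odds and lower
  -- bound.
  have hns1 := hexp (v := fun n => θ * w n + θ * (1 / 2)) (a := θ * (γ₀ / 16))
    ((hwO.const_mul_left θ).add (hconst _)) (by positivity)
  have hns2 := hexp (v := fun n => θ * w n) (a := (1 - θ) * (γ₀ / 2)) (hwO.const_mul_left θ)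
    (mul_pos (by linarith [hθ.2]) (by positivity))
  -- Bounds the sum over all wrong models uniformly in `n`, by `p · p^(-c₂ θ) ≤ 1`.
  set K : ENNReal := ENNReal.ofReal (Real.exp ((c₁⁻¹ * PMOM.massBound r a₁ (max a₁ a₂)) ^ θ))
  refine MeasureTheory.tendstoInMeasure_of_ne_top fun δ hδ hδt => ?_
  have hδθ : (δ ^ θ)⁻¹ ≠ ⊤ := by simp [hδ.ne', hδt]
  have hlim := ENNReal.Tendsto.const_mul (a := (δ ^ θ)⁻¹) (hsup.add
    (ENNReal.Tendsto.const_mul (a := K) (hns1.add hns2) (Or.inr ENNReal.ofReal_ne_top)))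
    (Or.inr hδθ)
  simp only [add_zero, mul_zero] at hlim
  have hsize : ∀ᶠ n in Filter.atTop, 2 * (q n + t.card + 1) ≤ n := by
    have h1 := (PMOM.tendsto_size_div hξ hq).add
      (tendsto_const_div_atTop_nhds_zero_nat ((t.card : ℝ) + 1))
    rw [add_zero] at h1
    filter_upwards [h1.eventually_lt_const (show (0 : ℝ) < 1 / 2 by norm_num),
      Filter.eventually_gt_atTop 0] with n hn hn0
    have hn' : (0 : ℝ) < n := by exact_mod_cast hn0
    rw [← add_div, div_lt_iff₀ hn'] at hn
    have h2 : 2 * ((q n : ℝ) + t.card + 1) ≤ n := by linarith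
    exact_mod_cast h2
  have hbox : ∀ᶠ n : ℕ in Filter.atTop, 2 * √(1 / (n : ℝ)) ≤ bm := by
    have h1 := (tendsto_const_div_atTop_nhds_zero_nat (1 : ℝ)).sqrt.const_mul 2
    rw [Real.sqrt_zero, mul_zero] at h1
    exact (h1.eventually_lt_const hbm).mono fun n hn => hn.le
  refine tendsto_of_tendsto_of_tendsto_of_le_of_le' tendsto_const_nhds hlim
    (Filter.Eventually.of_forall fun _ => bot_le) ?_
  filter_upwards [ht, htq, hinv, hsize, hbox, Filter.eventually_gt_atTop 0]
    with n htn htqn hinvn hsizen hboxn hn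
  have hn' : (0 : ℝ) < n := by exact_mod_cast hn
  obtain ⟨hε0, hε1⟩ := hε n hn
  have hquad : PMOM.QuadBounds (A n) a₁ (max a₁ a₂) :=
    PMOM.quadBounds_of_eigenvalues (hA n) fun i =>
      ⟨(hA_eig n hn i).1.le, (hA_eig n hn i).2.le.trans (le_max_right _ _)⟩
  refine (hbound hn htn (hA n) hquad (he_law n) (he_indep n) htqn hsizen hε0 hε1
    (fun k hk => PMOM.designBounds_of_eigenBounds hn (by omega) (hX n hn k hk)) ?_ ?_ hδ.ne'
    hδt).trans ?_
  · rwa [inv_le_iff_one_le_mul₀ hε0] at hinvn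
  · refine le_trans ?_ hboxn
    gcongr
  · have hη : 0 ≤ D * ((q n : ℝ) / n) ^ 2 * ((ε n)⁻¹ ^ ρ * (ε n)⁻¹ ^ t.card) := by positivity
    have hK : 0 ≤ PMOM.massBound r a₁ (max a₁ a₂) := by unfold PMOM.massBound; positivity
    have hW := PMOM.inv_prior_mul_le (p := p n) (T := t.card) (ρ := ρ) hn hc₁ hc₂0 hc hε0 hinvn
    have hWθ : ENNReal.ofReal (((c₁⁻¹ * (p n : ℝ) ^ (-c₂)) ^ t.card *
        (c * ((n : ℝ) ^ (-ρ) * √(ε n / n)) ^ t.card / n))⁻¹) ^ θ ≤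
        ENNReal.ofReal (Real.exp (θ * w n)) := by
      refine (ENNReal.rpow_le_rpow (ENNReal.ofReal_le_ofReal hW) hθ0.le).trans (le_of_eq ?_)
      rw [ENNReal.ofReal_rpow_of_pos (Real.exp_pos _), ← Real.exp_mul, mul_comm θ]
    gcongr (δ ^ θ)⁻¹ * (ENNReal.ofReal (Real.exp ?_ - 1) + ?_)
    · exact PMOM.mul_rpow_prior_le hc₁ hcθ hη
    · refine mul_le_mul' (ENNReal.ofReal_le_ofReal (Real.exp_le_exp.2
        (PMOM.mul_rpow_prior_le hc₁ hcθ hK))) ((mul_le_mul_left hWθ _).trans (le_of_eq ?_))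
      rw [ENNReal.ofReal_rpow_of_pos (Real.exp_pos _), ENNReal.ofReal_rpow_of_pos (Real.exp_pos _),
        mul_add, ← ENNReal.ofReal_mul (Real.exp_pos _).le, ← ENNReal.ofReal_mul (Real.exp_pos _).le,
        ← Real.exp_mul, ← Real.exp_mul, ← Real.exp_add, ← Real.exp_add]
      congr 3
      · ring_nf
      · ring_nf
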